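/- Let $k$ be a perfect field and let $X$ be an essentially smooth $k$-scheme (separated, quasi-compact, locally Noetherian, and covered by affine opens whose rings of functions are localizations of smooth $k$-algebras). Let $x\in X$ be a point of codimension $i$, let $R=\mathcal O_{X,x}$, let $\mathfrak m$ be its maximal ideal and $\kappa=k(x)$ its residue field. Then $\dim_\kappa \mathfrak m/\mathfrak m^2=i$, and the following hold. 1. Let $R^{\mathrm{fl}}$ be the abelian category of $R$-modules of finite length. The functor $M\mapsto M^\sharp=\mathrm{Ext}^i_R(M,R)$ maps $R^{\mathrm{fl}}$ to itself and is exact. There is a unique natural isomorphism $\varpi:\mathrm{id}\to{}^{\sharp\sharp}$ with $(\varpi_M)^\sharp\circ\varpi_{M^\sharp}=\mathrm{id}$ which is adjoint to evaluation. This last condition means: for $m\in M$, $e\in M^\sharp$ and an ideal $I$ killing $m$ and $e$, with $f:R/I\to M$, $1\mapsto m$, and $g:R/I\to M^\sharp$, $1\mapsto e$, one has $g^*(\varpi_M(m))=f^*(e)$ in $\mathrm{Ext}^i_R(R/I,R)$. So $(R^{\mathrm{fl}},{}^\sharp,\varpi)$ is an exact category with duality. Let $\mathrm{GW}^{\mathrm{fl}}(R)$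 be its Grothendieck-Witt group: the abelian group generated by the symmetric spaces $(M,\varphi)$ (with $\varphi:M\cong M^\sharp$ and $\varphi^\sharp\varpi_M=\varphi$), modulo isometry, $[M\perp N]=[M]+[N]$, and $[M]=[H(L)]$ whenever $L$ is a Lagrangian of $M$, where $H(L)$ is the hyperbolic space on $L\oplus L^\sharp$. 2. There is a unique $R$-linear isomorphism $c:(\det \mathfrak m/\mathfrak m^2)^\vee\to\mathrm{Ext}^i_R(\kappa,R)$ such that, for every system $x_1,\dots,x_i$ of generators of $\mathfrak m$ (which is a regular sequence), $c$ sends the dual basis element of $\bar x_1\wedge\dots\wedge\bar x_i$ to the Yoneda class of the Koszul resolution of $\kappa=R/(x_1,\dots,x_i)$. Here this class is the product of the classes of the extensions $0\to R/(x_1,\dots,x_{j-1})\xrightarrow{x_j}R/(x_1,\dots,x_{j-1})\to R/(x_1,\dots,x_j)\to0$. 3. For a field $F$, let $\mathrm K^{\mathrm{MW}}_*(F)$ be the graded ring generated by $[a]$ ($a\in F^\times$) in degree $1$ and $\eta$ in degree $-1$, with relations $[a][1-a]=0$ for $a\ne0,1$, $[ab]=[a]+[b]+\eta[a][b]$, $\eta[a]=[a]\eta$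 and $\eta(\eta[-1]+2)=0$. Put $\langle a\rangle=1+\eta[a]$. For a graded line $(L,n)$ over $F$, where $L^0=L\setminus\{0\}$, put $\mathrm K^{\mathrm{MW}}_0(F,(L,n))=\mathrm K^{\mathrm{MW}}_0(F)\otimes_{\mathbb Z[F^\times]}\mathbb Z[L^0]$, with $a\in F^\times$ acting on $\mathrm K^{\mathrm{MW}}_0(F)$ by $\langle a\rangle$. Let $D(\mathfrak m/\mathfrak m^2)^{-1}=((\det\mathfrak m/\mathfrak m^2)^\vee,-i)$. Then there is a unique isomorphism of abelian groups $$\mathrm K^{\mathrm{MW}}_0(k(x),D(\mathfrak m/\mathfrak m^2)^{-1})\;\xrightarrow{\ \cong\ }\;\mathrm{GW}^{\mathrm{fl}}(\mathcal O_{X,x})$$ sending $\langle a\rangle\otimes l$, for all $a\in\kappa^\times$ and all nonzero $l$, to the class of the symmetric space $(\kappa,\varphi)$ where $\varphi:\kappa\to\mathrm{Ext}^i_R(\kappa,R)$ is the $R$-linear map with $\varphi(1)=c(al)$. -/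

import Mathlib

open CategoryTheory CategoryTheory.Limits

universe u

noncomputable section

/-! ### Milnor-Witt K-theory of a field -/

/-- The generators `[a]` (`a ∈ Fˣ`, of degree `1`) and `η` (of degree `-1`). -/
inductive KMWGen (F : Type u) [Field F] : Type u
  | sym (a : Fˣ) : KMWGen F
  | eta : KMWGen F

/-- The degree of a generator. -/
def KMWGen.deg {F : Type u} [Field F] : KMWGen F → ℤ
  | .sym _ => 1
  | .eta => -1

/-- The free associative unital ring on the symbols `[a]` and `η`. -/
abbrev KMWFree (F : Type u) [Field F] : Type u := FreeAlgebra ℤ (KMWGen F)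

/-- The symbol `[a]` in the free ring. -/
def KMWFree.sym {F : Type u} [Field F] (a : Fˣ) : KMWFree F := FreeAlgebra.ι ℤ (KMWGen.sym a)

/-- The element `η` in the free ring. -/
def KMWFree.eta (F : Type u) [Field F] : KMWFree F := FreeAlgebra.ι ℤ KMWGen.eta

/-- The defining relations of Milnor-Witt K-theory. -/
inductive KMWRel (F : Type u) [Field F] : KMWFree F → KMWFree F → Prop
  | steinberg (a b : Fˣ) (h : (a : F) + (b : F) = 1) :
      KMWRel F (KMWFree.sym a * KMWFree.sym b) 0
  | sym_mul (a b : Fˣ) :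
      KMWRel F (KMWFree.sym (a * b))
        (KMWFree.sym a + KMWFree.sym b + KMWFree.eta F * KMWFree.sym a * KMWFree.sym b)
  | eta_comm (a : Fˣ) :
      KMWRel F (KMWFree.eta F * KMWFree.sym a) (KMWFree.sym a * KMWFree.eta F)
  | eta_hyp :
      KMWRel F (KMWFree.eta F * (KMWFree.eta F * KMWFree.sym (-1) + 2)) 0

/-- The Milnor-Witt K-theory ring `K^MW_*(F)` (all degrees together). -/
def KMW (F : Type u) [Field F] : Type u := RingQuot (KMWRel F)

instance KMW.instRing (F : Type u) [Field F] : Ring (KMW F) :=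
  inferInstanceAs (Ring (RingQuot (KMWRel F)))

namespace KMW

variable {F : Type u} [Field F]

/-- The quotient map from the free ring. -/
def mk (F : Type u) [Field F] : KMWFree F →+* KMW F := RingQuot.mkRingHom (KMWRel F)

/-- The symbol `[a]`. -/
def sym (a : Fˣ) : KMW F := mk F (KMWFree.sym a)

/-- The element `η`. -/
def eta (F : Type u) [Field F] : KMW F := mk F (KMWFree.eta F)

/-- `⟨a⟩ = 1 + η[a]`. -/
def form (a : Fˣ) : KMW F := 1 + eta F * sym a

theorem mk_rel {x y : KMWFree F} (h : KMWRel F x y) : mk F x = mk F y :=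
  RingQuot.mkRingHom_rel h

theorem sym_mul (a b : Fˣ) : sym (a * b) = sym a + sym b + eta F * sym a * sym b := by
  simpa only [sym, eta, map_add, map_mul] using mk_rel (KMWRel.sym_mul (F := F) a b)

theorem eta_comm (a : Fˣ) : eta F * sym a = sym a * eta F := by
  simpa only [sym, eta, map_mul] using mk_rel (KMWRel.eta_comm (F := F) a)

theorem eta_hyp : eta F * (eta F * sym (-1) + 2) = 0 := by
  simpa only [sym, eta, map_mul, map_add, map_ofNat, map_zero] using
    mk_rel (KMWRel.eta_hyp (F := F))

theorem form_mul (a b : Fˣ) : form (a * b) = form a * form b := by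
  have h : eta F * sym a * (eta F * sym b) = eta F * (eta F * sym a * sym b) := by
    calc eta F * sym a * (eta F * sym b) = eta F * (sym a * eta F) * sym b := by noncomm_ring
      _ = eta F * (eta F * sym a * sym b) := by rw [← eta_comm]; noncomm_ring
  calc form (a * b) = 1 + eta F * (sym a + sym b + eta F * sym a * sym b) := by
        rw [form, sym_mul]
    _ = 1 + eta F * sym a + eta F * sym b + eta F * sym a * (eta F * sym b) := by
        rw [h]; noncomm_ring
    _ = form a * form b := by simp only [form]; noncomm_ring

theorem form_one : form (1 : Fˣ) = 1 := by
  have h1 : (1 : Fˣ) = (-1) * (-1) := by simp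
  have h : eta F * sym (1 : Fˣ) = eta F * (eta F * sym (-1) + 2) * sym (-1) := by
    conv_lhs => rw [h1, sym_mul]
    noncomm_ring
  rw [form, h, eta_hyp, zero_mul, add_zero]

/-- `u ↦ ⟨u⟩` as a homomorphism of monoids. -/
def formHom (F : Type u) [Field F] : Fˣ →* KMW F where
  toFun := form
  map_one' := form_one
  map_mul' := form_mul

/-- The action of `ℤ[Fˣ]` on `K^MW_*(F)`, through `u ↦ ⟨u⟩`. -/
instance instModule : Module (MonoidAlgebra ℤ Fˣ) (KMW F) :=
  Module.compHom (KMW F) (MonoidAlgebra.lift ℤ (KMW F) Fˣ (formHom F)).toRingHom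

theorem smul_def (r : MonoidAlgebra ℤ Fˣ) (x : KMW F) :
    r • x = MonoidAlgebra.lift ℤ (KMW F) Fˣ (formHom F) r * x := rfl

/-- The class of a word in the generators. -/
def word (w : List (KMWGen F)) : KMW F := (w.map fun g => mk F (FreeAlgebra.ι ℤ g)).prod

/-- The degree of a word in the generators. -/
def wordDeg (w : List (KMWGen F)) : ℤ := (w.map KMWGen.deg).sum

theorem form_mul_word_mem (n : ℤ) (a : Fˣ) (x : KMW F)
    (hx : x ∈ AddSubgroup.closure {y : KMW F | ∃ w, wordDeg w = n ∧ word w = y}) :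
    form a * x ∈ AddSubgroup.closure {y : KMW F | ∃ w, wordDeg w = n ∧ word w = y} := by
  induction hx using AddSubgroup.closure_induction with
  | mem x hx =>
    obtain ⟨w, hw, rfl⟩ := hx
    rw [form, add_mul, one_mul]
    refine add_mem (AddSubgroup.subset_closure ⟨w, hw, rfl⟩)
      (AddSubgroup.subset_closure ⟨KMWGen.eta :: KMWGen.sym a :: w, ?_, ?_⟩)
    · simpa [wordDeg, KMWGen.deg] using hw
    · simp [word, eta, sym, KMWFree.eta, KMWFree.sym, mul_assoc]
  | zero => simp
  | add x y _ _ hx hy => rw [mul_add]; exact add_mem hx hy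
  | neg x _ hx => rw [mul_neg]; exact neg_mem hx

/-- The degree `n` part `K^MW_n(F)`: the additive group generated by the words of degree `n` in the
generators. It is stable under `ℤ[Fˣ]`. -/
def piece (F : Type u) [Field F] (n : ℤ) : Submodule (MonoidAlgebra ℤ Fˣ) (KMW F) where
  toAddSubmonoid :=
    (AddSubgroup.closure {y : KMW F | ∃ w, wordDeg w = n ∧ word w = y}).toAddSubmonoid
  smul_mem' r x hx := by
    induction r using MonoidAlgebra.induction_on with
    | of a =>
      have : (MonoidAlgebra.of ℤ Fˣ a) • x = form a * x := by
        rw [smul_def, MonoidAlgebra.lift_of]; rfl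
      rw [this]
      exact form_mul_word_mem n a x hx
    | add r s hr hs => rw [add_smul]; exact AddSubgroup.add_mem _ hr hs
    | smul c r hr =>
      rw [show (c • r) • x = c • (r • x) from by
        rw [smul_def, smul_def, map_zsmul, smul_mul_assoc]]
      exact AddSubgroup.zsmul_mem _ hr c

theorem form_mem_piece (a : Fˣ) : form a ∈ piece F 0 := by
  refine add_mem (S := AddSubgroup (KMW F)) (AddSubgroup.subset_closure ⟨[], ?_, ?_⟩)
    (AddSubgroup.subset_closure ⟨[KMWGen.eta, KMWGen.sym a], ?_, ?_⟩)
  · simp [wordDeg]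
  · simp [word]
  · simp [wordDeg, KMWGen.deg]
  · simp [word, eta, sym, KMWFree.eta, KMWFree.sym]

/-- `⟨a⟩` as an element of `K^MW_0(F)`. -/
def form₀ (a : Fˣ) : piece F 0 := ⟨form a, form_mem_piece a⟩

end KMW

/-! ### Graded lines and twisted Milnor-Witt K-theory -/

/-- A graded line bundle over (the spectrum of) a field. -/
structure GradedLine (F : Type u) [Field F] : Type (u + 1) where
  line : ModuleCat.{u} F
  finrank_eq_one : Module.finrank F line = 1
  deg : ℤ

namespace GradedLine

variable {F : Type u} [Field F]

/-- `D(V) = (det V, rk V)`. -/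
def D (V : Type u) [AddCommGroup V] [Module F V] [Module.Finite F V] : GradedLine F where
  line := ModuleCat.of F (⋀[F]^(Module.finrank F V) V)
  finrank_eq_one := by
    change Module.finrank F (⋀[F]^(Module.finrank F V) V) = 1
    rw [exteriorPower.finrank_eq, Nat.choose_self]
  deg := Module.finrank F V

/-- The inverse `(L, a)⁻¹ = (L^∨, -a)`. -/
def inv (L : GradedLine F) : GradedLine F where
  line := ModuleCat.of F (Module.Dual F L.line)
  finrank_eq_one := by
    change Module.finrank F (Module.Dual F L.line) = 1
    rw [Subspace.dual_finrank_eq, L.finrank_eq_one]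
  deg := -L.deg

/-- The set `L⁰` of nonzero vectors. -/
abbrev nonzero (L : GradedLine F) : Type u := {l : L.line // l ≠ 0}

/-- The action of `Fˣ` on `L⁰`. -/
instance instMulAction (L : GradedLine F) : MulAction Fˣ L.nonzero where
  smul u l := ⟨(u : F) • l.1, smul_ne_zero u.ne_zero l.2⟩
  one_smul l := Subtype.ext (one_smul F l.1)
  mul_smul u v l := Subtype.ext (mul_smul (u : F) (v : F) l.1)

/-- The `ℤ[Fˣ]`-module `ℤ[L⁰]`. -/
abbrev freeModule (L : GradedLine F) : Type u :=
  (Representation.ofMulAction ℤ Fˣ L.nonzero).asModule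

/-- The basis element of `ℤ[L⁰]` given by `l ∈ L⁰`. -/
def single (L : GradedLine F) (l : L.nonzero) : L.freeModule :=
  (Representation.asModuleEquiv (Representation.ofMulAction ℤ Fˣ L.nonzero)).symm
    (MonoidAlgebra.single l 1)

end GradedLine

/-- Twisted Milnor-Witt K-theory `K^MW_n(F, L) = K^MW_n(F) ⊗_{ℤ[Fˣ]} ℤ[L⁰]`. -/
abbrev TwistedKMW (F : Type u) [Field F] (n : ℤ) (L : GradedLine F) : Type u :=
  TensorProduct (MonoidAlgebra ℤ Fˣ) (KMW.piece F n) L.freeModule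

/-- The element `⟨u⟩ ⊗ l` of `K^MW_0(F, L)`. -/
def TwistedKMW.form {F : Type u} [Field F] {L : GradedLine F} (a : Fˣ) (l : L.nonzero) :
    TwistedKMW F 0 L :=
  TensorProduct.tmul (MonoidAlgebra ℤ Fˣ) (KMW.form₀ a) (L.single l)

/-! ### Exact categories with duality and Grothendieck-Witt groups -/

section Duality

variable {C : Type*} [Category C] [Abelian C]

/-- The structure of an exact category with duality on an abelian category `C` (with all short
exact sequences) whose duality functor is `D`: the functor `D` is exact, and the natural isomorphism
`η : 1 ≅ DD` satisfies `D(η_A) ∘ η_{D A} = 1`. -/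
structure ExactDuality (D : Cᵒᵖ ⥤ C) where
  additive : D.Additive
  preservesFiniteLimits : PreservesFiniteLimits D
  preservesFiniteColimits : PreservesFiniteColimits D
  η : 𝟭 C ≅ D.rightOp ⋙ D
  triangle (A : C) : η.hom.app (D.obj (Opposite.op A)) ≫ D.map (η.hom.app A).op = 𝟙 _

/-- A symmetric space `(X, φ)`: `φ : X ≅ D X` with `D(φ) ∘ η_X = φ`. -/
structure SymmetricSpace {D : Cᵒᵖ ⥤ C} (𝒟 : ExactDuality D) where
  X : C
  φ : X ≅ D.obj (Opposite.op X)
  symm : 𝒟.η.hom.app X ≫ D.map φ.hom.op = φ.hom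

section Helpers

variable (D : Cᵒᵖ ⥤ C) (X Y : C)

theorem map_fst_inl : D.map (biprod.fst : X ⊞ Y ⟶ X).op ≫
    D.map (biprod.inl : X ⟶ X ⊞ Y).op = 𝟙 _ := by
  rw [← D.map_comp, ← op_comp, biprod.inl_fst, op_id, D.map_id]

theorem map_snd_inr : D.map (biprod.snd : X ⊞ Y ⟶ Y).op ≫
    D.map (biprod.inr : Y ⟶ X ⊞ Y).op = 𝟙 _ := by
  rw [← D.map_comp, ← op_comp, biprod.inr_snd, op_id, D.map_id]

theorem map_fst_inr [D.Additive] : D.map (biprod.fst : X ⊞ Y ⟶ X).op ≫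
    D.map (biprod.inr : Y ⟶ X ⊞ Y).op = 0 := by
  rw [← D.map_comp, ← op_comp, biprod.inr_fst, op_zero, D.map_zero]

theorem map_snd_inl [D.Additive] : D.map (biprod.snd : X ⊞ Y ⟶ Y).op ≫
    D.map (biprod.inl : X ⟶ X ⊞ Y).op = 0 := by
  rw [← D.map_comp, ← op_comp, biprod.inl_snd, op_zero, D.map_zero]

theorem map_total [D.Additive] : D.map (biprod.inl : X ⟶ X ⊞ Y).op ≫ D.map (biprod.fst : X ⊞ Y ⟶ X).op +
    D.map (biprod.inr : Y ⟶ X ⊞ Y).op ≫ D.map (biprod.snd : X ⊞ Y ⟶ Y).op = 𝟙 _ := by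
  rw [← D.map_comp, ← D.map_comp, ← op_comp, ← op_comp, ← D.map_add, ← op_add, biprod.total,
    op_id, D.map_id]

end Helpers

theorem ExactDuality.naturality {D : Cᵒᵖ ⥤ C} (𝒟 : ExactDuality D) {X Y : C} (f : X ⟶ Y) :
    𝒟.η.hom.app X ≫ D.map (D.map f.op).op = f ≫ 𝒟.η.hom.app Y :=
  (𝒟.η.hom.naturality f).symm

theorem ExactDuality.naturality_assoc {D : Cᵒᵖ ⥤ C} (𝒟 : ExactDuality D) {X Y Z : C} (f : X ⟶ Y)
    (g : D.obj (Opposite.op (D.obj (Opposite.op Y))) ⟶ Z) :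
    𝒟.η.hom.app X ≫ D.map (D.map f.op).op ≫ g = f ≫ 𝒟.η.hom.app Y ≫ g := by
  rw [← Category.assoc, 𝒟.naturality, Category.assoc]

namespace SymmetricSpace

variable {D : Cᵒᵖ ⥤ C} {𝒟 : ExactDuality D}

/-- Isometry of symmetric spaces. -/
def Isometric (S T : SymmetricSpace 𝒟) : Prop :=
  ∃ f : S.X ≅ T.X, f.hom ≫ T.φ.hom ≫ D.map f.hom.op = S.φ.hom

/-- The orthogonal sum. -/
def orthSum (S T : SymmetricSpace 𝒟) : SymmetricSpace 𝒟 where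
  X := S.X ⊞ T.X
  φ :=
    { hom := biprod.fst ≫ S.φ.hom ≫ D.map (biprod.fst : S.X ⊞ T.X ⟶ S.X).op +
        biprod.snd ≫ T.φ.hom ≫ D.map (biprod.snd : S.X ⊞ T.X ⟶ T.X).op
      inv := D.map (biprod.inl : S.X ⟶ S.X ⊞ T.X).op ≫ S.φ.inv ≫ biprod.inl +
        D.map (biprod.inr : T.X ⟶ S.X ⊞ T.X).op ≫ T.φ.inv ≫ biprod.inr
      hom_inv_id := by
        have := 𝒟.additive
        simp only [Preadditive.add_comp, Preadditive.comp_add, Category.assoc,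
          reassoc_of% map_fst_inl D, reassoc_of% map_snd_inr D, reassoc_of% map_fst_inr D,
          reassoc_of% map_snd_inl D, Iso.hom_inv_id_assoc, zero_comp, comp_zero, add_zero,
          zero_add, biprod.total]
      inv_hom_id := by
        have := 𝒟.additive
        simp only [Preadditive.add_comp, Preadditive.comp_add, Category.assoc,
          biprod.inl_fst_assoc, biprod.inr_snd_assoc, biprod.inl_snd_assoc,
          biprod.inr_fst_assoc, Iso.inv_hom_id_assoc, zero_comp, comp_zero, add_zero,
          zero_add, map_total D] }
  symm := by
    have := 𝒟.additive
    have hS := S.symm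
    have hT := T.symm
    simp only [op_add, op_comp, Functor.map_add, Functor.map_comp, Preadditive.comp_add,
      Category.assoc, 𝒟.naturality_assoc]
    rw [reassoc_of% hS, reassoc_of% hT]

/-- The hyperbolic space `H(L) = (L ⊕ D L, ((0, 1), (η, 0)))`. -/
def hyperbolic (𝒟 : ExactDuality D) (L : C) : SymmetricSpace 𝒟 where
  X := L ⊞ D.obj (Opposite.op L)
  φ :=
    { hom := biprod.snd ≫ D.map (biprod.fst : L ⊞ D.obj (Opposite.op L) ⟶ L).op +
        biprod.fst ≫ 𝒟.η.hom.app L ≫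
          D.map (biprod.snd : L ⊞ D.obj (Opposite.op L) ⟶ D.obj (Opposite.op L)).op
      inv := D.map (biprod.inl : L ⟶ L ⊞ D.obj (Opposite.op L)).op ≫ biprod.inr +
        D.map (biprod.inr : D.obj (Opposite.op L) ⟶ L ⊞ D.obj (Opposite.op L)).op ≫
          𝒟.η.inv.app L ≫ biprod.inl
      hom_inv_id := by
        have := 𝒟.additive
        simp only [Preadditive.add_comp, Preadditive.comp_add, Category.assoc,
          reassoc_of% map_fst_inl D, reassoc_of% map_snd_inr D, reassoc_of% map_fst_inr D,
          reassoc_of% map_snd_inl D, Iso.hom_inv_id_app_assoc, zero_comp, comp_zero, add_zero,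
          zero_add, Functor.id_obj, Functor.comp_obj, Functor.rightOp_obj]
        rw [add_comm, biprod.total]
      inv_hom_id := by
        have := 𝒟.additive
        simp only [Preadditive.add_comp, Preadditive.comp_add, Category.assoc,
          biprod.inl_fst_assoc, biprod.inr_snd_assoc, biprod.inl_snd_assoc,
          biprod.inr_fst_assoc, Iso.inv_hom_id_app_assoc, zero_comp, comp_zero, add_zero,
          zero_add]
        simp only [Functor.rightOp_obj]
        exact map_total D _ _ }
  symm := by
    have := 𝒟.additive
    have h := 𝒟.triangle L
    simp only [op_add, op_comp, Functor.map_add, Functor.map_comp, Preadditive.comp_add,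
      Category.assoc, 𝒟.naturality_assoc]
    rw [reassoc_of% h, add_comm]
    simp only [Functor.id_obj]

/-- `i : L ⟶ X` is a Lagrangian of `(X, φ)`: the sequence `0 → L → X → D L → 0`, with second map
`D(i) ∘ φ`, is exact. -/
def IsLagrangian (S : SymmetricSpace 𝒟) {L : C} (i : L ⟶ S.X) : Prop :=
  ∃ w : i ≫ (S.φ.hom ≫ D.map i.op) = 0,
    (ShortComplex.mk i (S.φ.hom ≫ D.map i.op) w).ShortExact

end SymmetricSpace

/-- The relations defining the Grothendieck-Witt group, as elements of the free abelian group on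
the symmetric spaces. -/
inductive GWRel {D : Cᵒᵖ ⥤ C} (𝒟 : ExactDuality D) : FreeAbelianGroup (SymmetricSpace 𝒟) → Prop
  | isometric (S T : SymmetricSpace 𝒟) (h : S.Isometric T) :
      GWRel 𝒟 (FreeAbelianGroup.of S - FreeAbelianGroup.of T)
  | orthSum (S T : SymmetricSpace 𝒟) :
      GWRel 𝒟 (FreeAbelianGroup.of (S.orthSum T) -
        (FreeAbelianGroup.of S + FreeAbelianGroup.of T))
  | metabolic (S : SymmetricSpace 𝒟) (L : C) (i : L ⟶ S.X) (h : S.IsLagrangian i) :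
      GWRel 𝒟 (FreeAbelianGroup.of S -
        FreeAbelianGroup.of (SymmetricSpace.hyperbolic 𝒟 L))

/-- The Grothendieck-Witt group of an exact category with duality. -/
abbrev GW {D : Cᵒᵖ ⥤ C} (𝒟 : ExactDuality D) : Type _ :=
  FreeAbelianGroup (SymmetricSpace 𝒟) ⧸ AddSubgroup.closure {x | GWRel 𝒟 x}

/-- The class `[X, φ]` in the Grothendieck-Witt group. -/
def GW.of {D : Cᵒᵖ ⥤ C} {𝒟 : ExactDuality D} (S : SymmetricSpace 𝒟) : GW 𝒟 :=
  QuotientAddGroup.mk (FreeAbelianGroup.of S)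

end Duality

/-! ### Finite length modules and the duality `Ext^i(-, R)` -/

section FiniteLength

variable (R : Type u) [CommRing R]

/-- The property of being a module of finite length. -/
def finLenProp : ObjectProperty (ModuleCat.{u} R) := fun M => IsFiniteLength R M

theorem IsFiniteLength.prod' {M N : Type*} [AddCommGroup M] [Module R M] [AddCommGroup N]
    [Module R N] (hM : IsFiniteLength R M) (hN : IsFiniteLength R N) :
    IsFiniteLength R (M × N) := by
  rw [isFiniteLength_iff_isNoetherian_isArtinian] at *
  obtain ⟨_, _⟩ := hM
  obtain ⟨_, _⟩ := hN
  exact ⟨inferInstance, inferInstance⟩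

instance : (finLenProp R).ContainsZero where
  exists_zero := ⟨ModuleCat.of R PUnit, ModuleCat.isZero_of_subsingleton _, by
    rw [finLenProp, isFiniteLength_iff_isNoetherian_isArtinian]
    exact ⟨inferInstance, inferInstance⟩⟩

instance : (finLenProp R).IsClosedUnderSubobjects where
  prop_of_mono f hf hN :=
    IsFiniteLength.of_injective hN ((ModuleCat.mono_iff_injective f).1 hf)

instance : (finLenProp R).IsClosedUnderQuotients where
  prop_of_epi f hf hM :=
    IsFiniteLength.of_surjective hM ((ModuleCat.epi_iff_surjective f).1 hf)

instance : (finLenProp R).IsClosedUnderBinaryProducts where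
  limitsOfShape_le := by
    rintro X ⟨p⟩
    let a := (p.π.app ⟨WalkingPair.left⟩).hom
    let b := (p.π.app ⟨WalkingPair.right⟩).hom
    have hp := IsFiniteLength.prod' R (p.prop_diag_obj ⟨WalkingPair.left⟩)
      (p.prop_diag_obj ⟨WalkingPair.right⟩)
    refine IsFiniteLength.of_injective (f := a.prod b) hp ?_
    rw [← LinearMap.ker_eq_bot, LinearMap.ker_eq_bot']
    intro x hx
    have h1 : ModuleCat.ofHom (LinearMap.toSpanSingleton R X x) = 0 := by
      refine p.isLimit.hom_ext ?_
      rintro ⟨_ | _⟩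
      · ext
        simpa using congrArg Prod.fst hx
      · ext
        simpa using congrArg Prod.snd hx
    simpa using congrArg (fun f => f.hom (1 : R)) h1

instance : (finLenProp R).IsClosedUnderFiniteProducts :=
  ObjectProperty.IsClosedUnderFiniteProducts.mk'

/-- The abelian category of `R`-modules of finite length. -/
abbrev FinLen : Type (u + 1) := (finLenProp R).FullSubcategory

theorem isFiniteLength_ext [IsNoetherianRing R] (M N : ModuleCat.{u} R) [Module.Finite R N]
    (hM : IsFiniteLength R M) (i : ℕ) : IsFiniteLength R (Abelian.Ext M N i) := by
  obtain ⟨_, _⟩ := isFiniteLength_iff_isNoetherian_isArtinian.1 hM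
  obtain ⟨k, g, hg⟩ := Module.Finite.exists_fin (R := R) (M := M)
  obtain ⟨n, e, he⟩ := Module.Finite.exists_fin (R := R) (M := Abelian.Ext M N i)
  let J := Module.annihilator R M
  have hJ : IsArtinian R (R ⧸ J) := by
    let f : R →ₗ[R] (Fin k → M) := LinearMap.pi fun j => LinearMap.toSpanSingleton R M (g j)
    have hf : LinearMap.ker f = J := by
      ext r
      have : r ∈ LinearMap.ker f ↔ ∀ j, r • g j = 0 := by
        rw [LinearMap.mem_ker, funext_iff]; rfl
      rw [this, Module.mem_annihilator]
      refine ⟨fun h m => ?_, fun h j => h _⟩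
      have hm : m ∈ Submodule.span R (Set.range g) := hg ▸ Submodule.mem_top
      induction hm using Submodule.span_induction with
      | mem x hx => obtain ⟨j, rfl⟩ := hx; exact h j
      | zero => simp
      | add x y _ _ hx hy => rw [smul_add, hx, hy, add_zero]
      | smul a x _ hx => rw [smul_comm, hx, smul_zero]
    exact isArtinian_of_injective (J.liftQ f hf.ge)
      (LinearMap.ker_eq_bot.1 (Submodule.ker_liftQ_eq_bot _ _ _ hf.le))
  rw [isFiniteLength_iff_isNoetherian_isArtinian]
  refine ⟨inferInstance, ?_⟩
  have hkill : ∀ (r : R), r ∈ J → ∀ x : Abelian.Ext M N i, r • x = 0 := by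
    intro r hr x
    have h0 : r • 𝟙 M = 0 := by
      ext m
      exact Module.mem_annihilator.1 hr m
    have : r • x = (Abelian.Ext.mk₀ (r • 𝟙 M)).comp x (zero_add i) := by
      simp [Abelian.Ext.mk₀_smul]
    rw [this, h0, Abelian.Ext.mk₀_zero, Abelian.Ext.zero_comp]
  let q : (Fin n → R ⧸ J) →ₗ[R] Abelian.Ext M N i :=
    LinearMap.lsum R (fun _ => R ⧸ J) R fun j =>
      J.liftQ (LinearMap.toSpanSingleton R _ (e j)) fun r hr => by
        simpa using hkill r hr (e j)
  refine isArtinian_of_surjective _ q (LinearMap.range_eq_top.1 (top_le_iff.1 ?_))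
  rw [← he, Submodule.span_le]
  rintro _ ⟨j, rfl⟩
  refine ⟨Pi.single j (Submodule.Quotient.mk 1), ?_⟩
  have h1 : q (Pi.single j (Submodule.Quotient.mk 1)) =
      J.liftQ (LinearMap.toSpanSingleton R _ (e j)) (fun r hr => by simpa using hkill r hr (e j))
        (Submodule.Quotient.mk 1) := by
    simp only [q, LinearMap.lsum_piSingle]
  rw [h1, Submodule.liftQ_apply, LinearMap.toSpanSingleton_apply, one_smul]

/-- The functor `M ↦ Ext^i_R(M, R)` on modules of finite length. -/
def extDual [IsNoetherianRing R] (i : ℕ) : (FinLen R)ᵒᵖ ⥤ FinLen R where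
  obj M := ⟨ModuleCat.of R (Abelian.Ext M.unop.obj (ModuleCat.of R R) i),
    isFiniteLength_ext R M.unop.obj (ModuleCat.of R R) M.unop.property i⟩
  map f := ObjectProperty.homMk (ModuleCat.ofHom
    ((Abelian.Ext.mk₀ f.unop.hom).precompOfLinear R (ModuleCat.of R R) (zero_add i)))
  map_id M := by
    ext x
    exact Abelian.Ext.mk₀_id_comp x
  map_comp f g := by
    ext x
    exact (Abelian.Ext.mk₀_comp_mk₀_assoc g.unop.hom f.unop.hom x).symm

variable {R}

/-- The biduality `ϖ_M : M → Ext^i(Ext^i(M, R), R)` is the canonical one, i.e. the adjoint of the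
evaluation pairing: for `m ∈ M` and `e ∈ Ext^i(M, R)`, given by maps `f : R ⧸ I → M` and
`g : R ⧸ I → Ext^i(M, R)` sending `1` to `m` and `e`, one has `g^*(ϖ_M(m)) = f^*(e)` in
`Ext^i(R ⧸ I, R)`. -/
def ExactDuality.IsCanonical [IsNoetherianRing R] {i : ℕ} (𝒟 : ExactDuality (extDual R i)) :
    Prop :=
  ∀ (M : FinLen R) (I : Ideal R) (f : ModuleCat.of R (R ⧸ I) ⟶ M.obj)
    (g : ModuleCat.of R (R ⧸ I) ⟶
      ModuleCat.of R (Abelian.Ext M.obj (ModuleCat.of R R) i)),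
    let m : M.obj := f.hom (1 : R ⧸ I)
    let e : Abelian.Ext M.obj (ModuleCat.of R R) i := g.hom (1 : R ⧸ I)
    let ϖm : Abelian.Ext (ModuleCat.of R (Abelian.Ext M.obj (ModuleCat.of R R) i))
      (ModuleCat.of R R) i := (𝒟.η.hom.app M).hom.hom m
    (Abelian.Ext.mk₀ g).comp ϖm (zero_add i) = (Abelian.Ext.mk₀ f).comp e (zero_add i)

end FiniteLength

/-! ### The Koszul class of a regular sequence -/

section Koszul

variable {R : Type u} [CommRing R]

/-- The quotient `M ⧸ (r₁, …, rₙ) M`, formed one element at a time. -/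
def koszulQuot : ModuleCat.{u} R → List R → ModuleCat.{u} R
  | M, [] => M
  | M, r :: rs => koszulQuot (M.smulShortComplex r).X₃ rs

/-- The projection `M → M ⧸ (r₁, …, rₙ) M`. -/
def koszulProj : (M : ModuleCat.{u} R) → (rs : List R) → (M ⟶ koszulQuot M rs)
  | M, [] => 𝟙 M
  | M, r :: rs => (M.smulShortComplex r).g ≫ koszulProj (M.smulShortComplex r).X₃ rs

/-- The class in `Ext^n(M ⧸ (r₁, …, rₙ) M, M)` of the Koszul resolution of a regular sequence. It
is the Yoneda product of the classes of the short exact sequences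
`0 → M ⧸ (r₁, …, r_{j-1}) → M ⧸ (r₁, …, r_{j-1}) → M ⧸ (r₁, …, r_j) → 0` (multiplication by
`r_j`). For `M = R` this is the Yoneda class of the Koszul complex, with
`d(e₁ ∧ ⋯ ∧ eₙ) = ∑ (-1)^{j-1} r_j e₁ ∧ ⋯ ∧ ê_j ∧ ⋯ ∧ eₙ` and with its top term identified with `R`
by `e₁ ∧ ⋯ ∧ eₙ ↦ 1`. -/
def koszulClass : (M : ModuleCat.{u} R) → (rs : List R) →
    RingTheory.Sequence.IsWeaklyRegular M rs → Abelian.Ext (koszulQuot M rs) M rs.length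
  | M, [], _ => Abelian.Ext.mk₀ (𝟙 M)
  | M, r :: rs, h =>
    (koszulClass (M.smulShortComplex r).X₃ rs
      ((RingTheory.Sequence.isWeaklyRegular_cons_iff M r rs).1 h).2).comp
      ((RingTheory.Sequence.isWeaklyRegular_cons_iff M r rs).1 h).1.smulShortComplex_shortExact.extClass
      rfl

end Koszul

/-! ### Local rings -/

section LocalRing

open IsLocalRing

variable (R : Type u) [CommRing R] [IsLocalRing R]

/-- The residue field as an `R`-module of finite length. -/
def residueObj : FinLen R where
  obj := ModuleCat.of R (ResidueField R)
  property := by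
    have : IsSimpleModule R (ResidueField R) :=
      isSimpleModule_iff_isCoatom.2 (maximalIdeal.isMaximal R).out
    exact isFiniteLength_iff_isNoetherian_isArtinian.2 ⟨inferInstance, inferInstance⟩

/-- The graded line `D(𝔪 ⧸ 𝔪²)⁻¹` over the residue field. -/
def conormalTwist [IsNoetherianRing R] : GradedLine (ResidueField R) :=
  (GradedLine.D (F := ResidueField R) (CotangentSpace R)).inv

variable {R}

/-- The additive isomorphism `c` from the line `det(𝔪 ⧸ 𝔪²)^∨` to `Ext^i(κ, R)`, where `κ` is the
residue field, is the canonical one: it is linear, and for each system `x₁, …, x_i` of generators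
of `𝔪` it sends the dual of `x̄₁ ∧ ⋯ ∧ x̄_i` to the class of the Koszul resolution of
`κ = R ⧸ (x₁, …, x_i)`. -/
def IsKoszulIso [IsNoetherianRing R] {i : ℕ}
    (hd : Module.finrank (ResidueField R) (CotangentSpace R) = i)
    (c : (conormalTwist R).line ≃+ Abelian.Ext (residueObj R).obj (ModuleCat.of R R) i) : Prop :=
  (∀ (r : R) (l : (conormalTwist R).line), c (residue R r • l) = r • c l) ∧
  ∀ x : Fin (Module.finrank (ResidueField R) (CotangentSpace R)) → maximalIdeal R,
    Ideal.span (Set.range fun j => (x j : R)) = maximalIdeal R →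
    ∀ l : Module.Dual (ResidueField R)
        (⋀[ResidueField R]^(Module.finrank (ResidueField R) (CotangentSpace R)) (CotangentSpace R)),
      l (exteriorPower.ιMulti (ResidueField R) _ fun j => (maximalIdeal R).toCotangent (x j)) = 1 →
      ∃ (h : RingTheory.Sequence.IsWeaklyRegular (ModuleCat.of R R) (List.ofFn fun j => (x j : R)))
        (θ : koszulQuot (ModuleCat.of R R) (List.ofFn fun j => (x j : R)) ≅ (residueObj R).obj),
        koszulProj (ModuleCat.of R R) (List.ofFn fun j => (x j : R)) ≫ θ.hom =
          ModuleCat.ofHom (Algebra.linearMap R (ResidueField R)) ∧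
        (Abelian.Ext.mk₀ θ.hom).comp (c l) (by rw [List.length_ofFn, hd, zero_add]) =
          koszulClass (ModuleCat.of R R) (List.ofFn fun j => (x j : R)) h

/-- The isomorphism `e : K^MW_0(κ, D(𝔪 ⧸ 𝔪²)⁻¹) ≅ GW^fl(R)` sends each `⟨a⟩ ⊗ l` to the class of the
symmetric space `(κ, φ)` where `φ : κ → Ext^i(κ, R)` is the `R`-linear map with `φ(1) = c(a l)`. -/
def IsLocalMultIso [IsNoetherianRing R] {i : ℕ} (𝒟 : ExactDuality (extDual R i))
    (c : (conormalTwist R).line ≃+ Abelian.Ext (residueObj R).obj (ModuleCat.of R R) i)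
    (e : TwistedKMW (ResidueField R) 0 (conormalTwist R) ≃+ GW 𝒟) : Prop :=
  ∀ (a : (ResidueField R)ˣ) (l : (conormalTwist R).nonzero),
    ∃ (φ : residueObj R ≅ (extDual R i).obj (Opposite.op (residueObj R)))
      (hφ : 𝒟.η.hom.app (residueObj R) ≫ (extDual R i).map φ.hom.op = φ.hom),
      (φ.hom.hom.hom (1 : ResidueField R) :
        Abelian.Ext (residueObj R).obj (ModuleCat.of R R) i) = c ((a : ResidueField R) • l.1) ∧
      e (TwistedKMW.form a l) = GW.of { X := residueObj R, φ := φ, symm := hφ }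

end LocalRing

/-! ### Essentially smooth schemes -/

section EssentiallySmooth

open AlgebraicGeometry

/-- A scheme over a field `k` is essentially smooth if it is separated, quasi-compact, and covered
by affine opens whose rings of functions are localizations of smooth `k`-algebras. -/
structure IsEssentiallySmooth {k : Type u} [Field k] {X : Scheme.{u}}
    (f : X ⟶ Spec (CommRingCat.of k)) : Prop where
  separated : IsSeparated f
  quasiCompact : QuasiCompact f
  exists_localization (x : X) : ∃ U : X.Opens, x ∈ U ∧ IsAffineOpen U ∧
    ∃ (B : CommRingCat.{u}) (φ : CommRingCat.of k ⟶ B) (ψ : B ⟶ Γ(X, U)) (S : Submonoid B),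
      φ.hom.Smooth ∧ (letI := ψ.hom.toAlgebra; IsLocalization S Γ(X, U)) ∧
      φ ≫ ψ = (Scheme.ΓSpecIso (CommRingCat.of k)).inv ≫ f.appLE ⊤ U le_top

end EssentiallySmooth

end

/-! Regularity. A smooth algebra is locally étale over a polynomial ring, so R is a regular local
ring (`IsEssentiallySmooth.isRegularLocalRing_stalk`). Hence i is both the Krull dimension of R and
the dimension of 𝔪/𝔪², and every system of i generators of 𝔪 is a regular sequence
(`IsLocalRing.isWeaklyRegular_of_ofList_eq`).

The map c. The Koszul class of such a system spans Ext^i(κ, R) over κ, and the other Ext^j(κ, R)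
vanish (`KoszulRep.ext_bijective`, `KoszulRep.ext_eq_zero`). Changing the generators by a matrix
multiplies the class by the inverse of the determinant modulo 𝔪 (`KoszulRep.det_smul`). The dual of
the wedge of the generators obeys the same rule, so c can be defined with one system and is then
correct for all of them.

Duality. Dévissage from κ makes Ext^i(-, R) exact on modules of finite length. Instead of working
with iterated Ext groups one represents the functor: with E the colimit of the Ext^i(R/𝔪^n, R),
pulling a class back along the elements of M identifies Ext^i(M, R) with Hom(M, E) (`extEvalEquiv`).
Here E plays the part of an injective hull of κ. The functor Hom(-, E) preserves length, so the
injective map M → M^♯♯ adjoint to evaluation is bijective, and the identities required of it become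
tautologies about evaluation. Adjointness to evaluation leaves no other choice (`isCanonical_iff`).

The Grothendieck-Witt group. Symmetric spaces become modules with a nondegenerate symmetric form
valued in E. A simple submodule is either isotropic, so that one may pass to L^⊥/L, or an orthogonal
summand. Hence each space is Witt equivalent to a diagonal form over κ of the same length
(`FormSpace.exists_wittEquiv_diag`). The class of H(M) depends only on the length of M, so Witt
equivalent spaces of equal length have equal classes (`IsGWInvariant.eq_of_wittEquiv`), and the
one-dimensional classes generate.

The relations among them are ⟨ab²⟩ = ⟨a⟩, ⟨a⟩ + ⟨b⟩ = ⟨a+b⟩ + ⟨ab(a+b)⟩ and ⟨a⟩ + ⟨-a⟩ = ⟨1⟩ + ⟨-1⟩: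
a function on κˣ that respects them extends to all spaces (`IsFormInvariant.isGWInvariant`). The
crux is that it takes the hyperbolic value on every metabolic diagonal form
(`FormSpace.exists_sum_eq_of_isMetabolic`), which is proved in every characteristic by simplifying
an isotropic vector. The group K^MW_0(κ) has the same generators and relations
(`KMW.sumHom_eq_zero_of_formRingHom_eq_zero`), and the twist by the line records which generator of
the socle of E is used. This gives inverse homomorphisms between the two groups. -/

noncomputable section

/-! ### Regularity of the local rings of essentially smooth schemes -/

section Regularity

open IsLocalRing

theorem IsLocalRing.spanFinrank_map_maximalIdeal_le {A B : Type*} [CommRing A] [CommRing B]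
    [IsLocalRing A] [IsNoetherianRing A] (f : A →+* B) :
    ((maximalIdeal A).map f).spanFinrank ≤ (maximalIdeal A).spanFinrank := by
  have fg := (maximalIdeal A).fg_of_isNoetherianRing
  have fin := Submodule.FG.finite_generators fg
  have h : (maximalIdeal A).map f = Ideal.span (f '' (maximalIdeal A).generators) := by
    rw [← Ideal.map_span, Ideal.span, Submodule.span_generators]
  rw [h, ← Submodule.FG.generators_ncard fg]
  exact (Submodule.spanFinrank_span_le_ncard_of_finite (fin.image _)).trans
    (Set.ncard_image_le fin)

/-- Flatness gives going down, so the dimension does not drop from A_p to B_q. Unramifiedness says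
that the maximal ideal of A_p generates that of B_q, so the number of generators does not grow.
Regularity of A_p then bounds the number of generators of the maximal ideal of B_q by the dimension
of B_q. -/
theorem IsRegularLocalRing.of_etale {A B : Type*} [CommRing A] [CommRing B] [Algebra A B]
    [IsRegularRing A] [Algebra.Etale A B] (q : Ideal B) [q.IsPrime] :
    IsRegularLocalRing (Localization.AtPrime q) := by
  have : IsNoetherianRing B := Algebra.FiniteType.isNoetherianRing A B
  let p := q.under A
  have : Module.Flat A B := inferInstance
  have h : p.height ≤ q.height := by
    rw [Ideal.height_eq_height_add_of_liesOver_of_hasGoingDown p q]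
    exact le_self_add
  let := (Localization.localRingHom p q (algebraMap A B) rfl).toAlgebra
  have : Localization.AtPrime.IsLiesOverAlgebra p q := ⟨rfl⟩
  have hq : p.map (algebraMap A (Localization.AtPrime q)) =
      maximalIdeal (Localization.AtPrime q) :=
    ((Algebra.isUnramifiedAt_iff_map_eq A p q).1 inferInstance).2
  have hA : IsRegularLocalRing (Localization.AtPrime p) := inferInstance
  have hm : (maximalIdeal (Localization.AtPrime p)).map
      (algebraMap (Localization.AtPrime p) (Localization.AtPrime q)) =
      maximalIdeal (Localization.AtPrime q) := by
    rw [← hq, ← Localization.AtPrime.map_eq_maximalIdeal, Ideal.map_map,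
      ← IsScalarTower.algebraMap_eq]
  apply IsRegularLocalRing.of_spanFinrank_maximalIdeal_le
  have h1 := spanFinrank_map_maximalIdeal_le
    (algebraMap (Localization.AtPrime p) (Localization.AtPrime q))
  rw [hm] at h1
  have h2 := (isRegularLocalRing_iff _).1 hA
  rw [IsLocalization.AtPrime.ringKrullDim_eq_height p] at h2
  rw [IsLocalization.AtPrime.ringKrullDim_eq_height q]
  refine (Nat.cast_le.2 h1).trans ?_
  rw [h2]
  exact WithBot.coe_le_coe.2 h

theorem IsRegularLocalRing.of_isStandardSmooth {k B : Type*} [Field k] [CommRing B] [Algebra k B]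
    [Algebra.IsStandardSmooth k B] (q : Ideal B) [q.IsPrime] :
    IsRegularLocalRing (Localization.AtPrime q) := by
  obtain ⟨n, g, -, hg⟩ := RingHom.IsStandardSmooth.exists_etale_mvPolynomial
    (f := algebraMap k B) (by rwa [RingHom.isStandardSmooth_algebraMap])
  let := g.toAlgebra
  have : Algebra.Etale (MvPolynomial (Fin n) k) B := hg
  exact IsRegularLocalRing.of_etale (A := MvPolynomial (Fin n) k) q

/-- A smooth algebra becomes standard smooth after inverting some f outside q, and this does not
change the local ring at q. -/
theorem IsRegularLocalRing.of_smooth {k B : Type*} [Field k] [CommRing B] [Algebra k B]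
    [Algebra.Smooth k B] (q : Ideal B) [q.IsPrime] (T : Type*) [CommRing T] [Algebra B T]
    [IsLocalization.AtPrime T q] : IsRegularLocalRing T := by
  obtain ⟨f, hf, hs⟩ := Algebra.IsSmoothAt.exists_notMem_isStandardSmooth k q
  let Q := q.map (algebraMap B (Localization.Away f))
  have hd : Disjoint (Submonoid.powers f : Set B) q := by
    rw [Set.disjoint_left]
    rintro _ ⟨n, rfl⟩ h
    exact hf (Ideal.IsPrime.mem_of_pow_mem ‹_› n h)
  have : Q.IsPrime := IsLocalization.isPrime_of_isPrime_disjoint (Submonoid.powers f) _ _ ‹_› hd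
  have hQ : Q.comap (algebraMap B (Localization.Away f)) = q :=
    IsLocalization.under_map_of_isPrime_disjoint (Submonoid.powers f) _ ‹_› hd
  have h1 := IsRegularLocalRing.of_isStandardSmooth (k := k) Q
  have h2 := IsLocalization.isLocalization_isLocalization_atPrime_isLocalization
    (Submonoid.powers f) (Localization.AtPrime Q) Q
  have h3 : IsLocalization q.primeCompl (Localization.AtPrime Q) := by
    have : (Q.comap (algebraMap B (Localization.Away f))).primeCompl = q.primeCompl := by
      ext; simp only [Ideal.mem_primeCompl_iff, hQ]
    rw [← this]; exact h2
  exact IsRegularLocalRing.of_ringEquiv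
    (IsLocalization.algEquiv q.primeCompl (Localization.AtPrime Q) T).toRingEquiv

open AlgebraicGeometry in
theorem IsEssentiallySmooth.isRegularLocalRing_stalk {k : Type u} [Field k] {X : Scheme.{u}}
    {f : X ⟶ Spec (CommRingCat.of k)} (hf : IsEssentiallySmooth f) (x : X) :
    IsRegularLocalRing (X.presheaf.stalk x) := by
  obtain ⟨U, hxU, hU, B, φ, ψ, S, hφ, hS, -⟩ := hf.exists_localization x
  let := ψ.hom.toAlgebra
  let := φ.hom.toAlgebra
  have : Algebra.Smooth k B := hφ
  have : IsLocalization S Γ(X, U) := hS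
  let P := (hU.primeIdealOf ⟨x, hxU⟩).asIdeal
  let : Algebra Γ(X, U) (X.presheaf.stalk x) :=
    TopCat.Presheaf.algebra_section_stalk X.presheaf (⟨x, hxU⟩ : U)
  have hP : IsLocalization.AtPrime (X.presheaf.stalk x) P := hU.isLocalization_stalk ⟨x, hxU⟩
  let : Algebra B (X.presheaf.stalk x) :=
    ((algebraMap Γ(X, U) (X.presheaf.stalk x)).comp (algebraMap B Γ(X, U))).toAlgebra
  have : IsScalarTower B Γ(X, U) (X.presheaf.stalk x) := .of_algebraMap_eq' rfl
  have := IsLocalization.isLocalization_isLocalization_atPrime_isLocalization S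
    (X.presheaf.stalk x) P
  exact IsRegularLocalRing.of_smooth (k := k) (P.comap (algebraMap B Γ(X, U))) _

end Regularity

/-! ### Minimal generators of the maximal ideal of a regular local ring -/

section RegularLocal

open IsLocalRing RingTheory.Sequence
open scoped Pointwise

/-- Take the smallest prime of a longest chain: the whole chain survives in the quotient. -/
theorem exists_isPrime_ringKrullDim_le_quotient (R : Type*) [CommRing R] [IsLocalRing R]
    [IsNoetherianRing R] :
    ∃ P : Ideal R, P.IsPrime ∧ ringKrullDim R ≤ ringKrullDim (R ⧸ P) := by
  obtain ⟨l, hl, hlen⟩ := (maximalIdeal R).exists_ltSeries_length_eq_height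
  refine ⟨l.head.asIdeal, l.head.2, ?_⟩
  rw [ringKrullDim_quotient, ← maximalIdeal_height_eq_ringKrullDim, ← hlen]
  let L : LTSeries (PrimeSpectrum.zeroLocus (l.head.asIdeal : Set R)) :=
    { length := l.length
      toFun := fun i => ⟨l i, l.head_le i⟩
      step := fun i => l.step i }
  exact Order.LTSeries.length_le_krullDim L

/-- Quotients of regular local rings by a member of a minimal system of generators of the
maximal ideal. -/
theorem IsRegularLocalRing.quotient_of_ofList_eq {R : Type*} [CommRing R] [IsLocalRing R]
    [IsNoetherianRing R] {x : R} {rs : List R}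
    (h : Ideal.ofList (x :: rs) = maximalIdeal R) (hd : ringKrullDim R = (rs.length + 1 : ℕ)) :
    ∃ _ : IsLocalRing (R ⧸ Ideal.span {x}), ringKrullDim (R ⧸ Ideal.span {x}) = rs.length ∧
      Ideal.ofList (rs.map (Ideal.Quotient.mk (Ideal.span {x}))) =
        maximalIdeal (R ⧸ Ideal.span {x}) := by
  have hx : x ∈ maximalIdeal R := by
    rw [← h]; exact Ideal.subset_span (by simp)
  have hle : Ideal.span {x} ≤ maximalIdeal R := by simpa [Ideal.span_le] using hx
  have : Nontrivial (R ⧸ Ideal.span {x}) :=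
    Ideal.Quotient.nontrivial_iff.2 (ne_top_of_le_ne_top (maximalIdeal.isMaximal R).ne_top hle)
  have hloc : IsLocalRing (R ⧸ Ideal.span {x}) :=
    .of_surjective' _ Ideal.Quotient.mk_surjective
  have hmax : Ideal.ofList (rs.map (Ideal.Quotient.mk (Ideal.span {x}))) =
      maximalIdeal (R ⧸ Ideal.span {x}) := by
    have h1 : (maximalIdeal R).map (Ideal.Quotient.mk (Ideal.span {x})) =
        maximalIdeal (R ⧸ Ideal.span {x}) := by
      refine eq_maximalIdeal ?_
      rw [Ideal.Quotient.maximal_ideal_iff_isField_quotient]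
      exact (DoubleQuot.quotQuotEquivQuotOfLE hle).toMulEquiv.isField
        ((Ideal.Quotient.maximal_ideal_iff_isField_quotient _).1 (maximalIdeal.isMaximal R))
    rw [← h1, ← h, Ideal.ofList_cons, Ideal.map_sup, Ideal.map_ofList, Ideal.map_span]
    simp
  refine ⟨hloc, le_antisymm ?_ ?_, hmax⟩
  -- The upper bound counts generators; the lower bound holds because killing one element lowers the
  -- dimension by at most one.
  · refine (ringKrullDim_le_spanFinrank_maximalIdeal _).trans ?_
    rw [← hmax, Ideal.ofList]
    classical
    have := Submodule.spanFinrank_span_le_ncard_of_finite (R := R ⧸ Ideal.span {x})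
      (rs.map (Ideal.Quotient.mk (Ideal.span {x}))).finite_toSet
    refine (Nat.cast_le.2 this).trans ?_
    have h2 := List.toFinset_card_le (rs.map (Ideal.Quotient.mk (Ideal.span {x})))
    rw [← Set.ncard_coe_finset] at h2
    simpa using h2
  · have h1 := Ideal.height_le_ringKrullDim_quotient_add_one (p := maximalIdeal R) hx
    rw [maximalIdeal_height_eq_ringKrullDim, hd] at h1
    simpa [ENat.WithBot.add_le_add_one_right_iff] using h1

/-- Induction on the dimension; R/(x) is a domain by induction. Choose a prime P with dim R/P = dim
R. If P were not inside (x), its image in the domain R/(x) would lower the dimension too much.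
Moreover x is not in P, as otherwise P = (x). So every element of P is x times an element of P, and
Nakayama gives P = 0. -/
theorem IsLocalRing.isDomain_of_ofList_eq (n : ℕ) : ∀ (R : Type u) [CommRing R] [IsLocalRing R]
    [IsNoetherianRing R] (rs : List R), Ideal.ofList rs = maximalIdeal R →
    rs.length = n → ringKrullDim R = n → IsDomain R := by
  induction n with
  | zero =>
    intro R _ _ _ rs h hl _
    obtain rfl := List.length_eq_zero_iff.1 hl
    rw [Ideal.ofList_nil] at h
    exact (isField_iff_maximalIdeal_eq.2 h.symm).isDomain
  | succ n ih =>
    intro R _ _ _ rs h hl hd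
    obtain ⟨x, rs, rfl⟩ : ∃ x rs', rs = x :: rs' := List.exists_cons_of_length_eq_add_one hl
    simp only [List.length_cons, add_left_inj] at hl
    subst hl
    obtain ⟨_, hd', hm'⟩ := IsRegularLocalRing.quotient_of_ofList_eq h hd
    have hdom := ih (R ⧸ Ideal.span {x}) _ hm' (by simp) hd'
    obtain ⟨P, hP, hPd⟩ := exists_isPrime_ringKrullDim_le_quotient R
    have hx : x ∈ maximalIdeal R := by
      rw [← h]; exact Ideal.subset_span (by simp)
    let D := R ⧸ Ideal.span {x}
    -- the image of `P` in `R ⧸ (x)` vanishes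
    have hPx : P ≤ Ideal.span {x} := by
      by_contra hcon
      obtain ⟨y, hyP, hy⟩ := Set.not_subset.1 hcon
      have hy0 : Ideal.Quotient.mk (Ideal.span {x}) y ∈ nonZeroDivisors D :=
        mem_nonZeroDivisors_of_ne_zero (by rwa [ne_eq, Ideal.Quotient.eq_zero_iff_mem])
      have h1 := ringKrullDim_quotient_succ_le_of_nonZeroDivisor hy0
      have h2 : ringKrullDim (D ⧸ P.map (Ideal.Quotient.mk (Ideal.span {x}))) ≤
          ringKrullDim (D ⧸ Ideal.span {Ideal.Quotient.mk (Ideal.span {x}) y}) := by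
        refine ringKrullDim_le_of_surjective (Ideal.Quotient.factor ?_)
          (Ideal.Quotient.factor_surjective _)
        rw [Ideal.span_le, Set.singleton_subset_iff]
        exact Ideal.mem_map_of_mem _ hyP
      have h3 : ringKrullDim (R ⧸ P) ≤
          ringKrullDim ((R ⧸ P) ⧸ (Ideal.span {x}).map (Ideal.Quotient.mk P)) + 1 := by
        have : IsLocalRing (R ⧸ P) := .of_surjective' _ Ideal.Quotient.mk_surjective
        have hx' : Ideal.Quotient.mk P x ∈ maximalIdeal (R ⧸ P) := by
          have : IsLocalHom (Ideal.Quotient.mk P) := .of_surjective _ Ideal.Quotient.mk_surjective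
          rwa [mem_maximalIdeal, mem_nonunits_iff, isUnit_map_iff, ← mem_nonunits_iff,
            ← mem_maximalIdeal]
        have := Ideal.height_le_ringKrullDim_quotient_add_one
          (p := maximalIdeal (R ⧸ P)) hx'
        rwa [maximalIdeal_height_eq_ringKrullDim, ← Set.image_singleton, ← Ideal.map_span] at this
      -- R/(P, x) is a quotient of R/P by one element and of R/(x) by an ideal with a
      -- nonzerodivisor; comparing both yields n + 1 ≤ n.
      rw [ringKrullDim_eq_of_ringEquiv (DoubleQuot.quotQuotEquivComm P (Ideal.span {x}))] at h3
      have h4 := (hPd.trans h3).trans (add_le_add_left h2 1)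
      have h5 := h4.trans h1
      rw [hd, hd'] at h5
      exact absurd (Nat.cast_le.1 h5) (by simp)
    have hxP : x ∉ P := by
      intro hxP
      have : P = Ideal.span {x} := le_antisymm hPx (by simpa [Ideal.span_le] using hxP)
      rw [this, hd, hd'] at hPd
      exact absurd (Nat.cast_le.1 hPd) (by simp)
    have hbot : P = ⊥ := by
      refine Submodule.eq_bot_of_le_smul_of_le_jacobson_bot (Ideal.span {x}) P
        (IsNoetherian.noetherian P) ?_ ?_
      · intro y hy
        obtain ⟨a, rfl⟩ := Ideal.mem_span_singleton'.1 (hPx hy)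
        rw [mul_comm]
        exact Submodule.smul_mem_smul (Ideal.mem_span_singleton_self x)
          ((hP.mem_or_mem hy).resolve_right hxP)
      · rw [jacobson_eq_maximalIdeal _ bot_ne_top, Ideal.span_le]
        simpa using hx
    subst hbot
    exact (Ideal.Quotient.isDomain_iff_prime (⊥ : Ideal R)).2 hP |> fun _ =>
      (RingEquiv.quotientBot R).symm.toMulEquiv.isDomain _

/-- A minimal system of generators of the maximal ideal of a regular local ring is a regular
sequence. -/
theorem IsLocalRing.isWeaklyRegular_of_ofList_eq (n : ℕ) : ∀ (R : Type u) [CommRing R]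
    [IsLocalRing R] [IsNoetherianRing R] (rs : List R), Ideal.ofList rs = maximalIdeal R →
    rs.length = n → ringKrullDim R = n → IsWeaklyRegular R rs := by
  induction n with
  | zero =>
    intro R _ _ _ rs h hl _
    obtain rfl := List.length_eq_zero_iff.1 hl
    exact .nil _ _
  | succ n ih =>
    intro R _ _ _ rs h hl hd
    have := isDomain_of_ofList_eq _ R rs h hl hd
    obtain ⟨x, rs, rfl⟩ : ∃ x rs', rs = x :: rs' := List.exists_cons_of_length_eq_add_one hl
    simp only [List.length_cons, add_left_inj] at hl
    subst hl
    obtain ⟨_, hd', hm'⟩ := IsRegularLocalRing.quotient_of_ofList_eq h hd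
    have hw := ih (R ⧸ Ideal.span {x}) _ hm' (by simp) hd'
    -- The dimension of R/(x) is strictly smaller, so x is nonzero, hence regular because R is a
    -- domain.
    have hx0 : x ≠ 0 := by
      rintro rfl
      have : ringKrullDim (R ⧸ Ideal.span {(0 : R)}) = ringKrullDim R := by
        have h0 : Ideal.span {(0 : R)} = ⊥ := by simp
        exact ringKrullDim_eq_of_ringEquiv
          ((Ideal.quotEquivOfEq h0).trans (RingEquiv.quotientBot R))
      rw [hd', hd] at this
      exact absurd (Nat.cast_inj.1 this) (by simp)
    refine .cons ((fun a b hab => mul_left_cancel₀ hx0 hab)) ?_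
    have hw2 : IsWeaklyRegular (R ⧸ Ideal.span {x}) rs :=
      (isWeaklyRegular_map_algebraMap_iff (R ⧸ Ideal.span {x}) _ rs).1 hw
    have heq : Ideal.span {x} = x • (⊤ : Submodule R R) := by
      rw [← Submodule.ideal_span_singleton_smul, smul_eq_mul, Ideal.mul_top]
    exact ((Submodule.quotEquivOfEq _ _ heq).isWeaklyRegular_congr rs).1 hw2

end RegularLocal

/-! ### Koszul classes, independently of the chosen quotients -/

section KoszulClasses

open Abelian RingTheory.Sequence

variable {R : Type u} [CommRing R]

theorem ModuleCat.shortExact_of_elements {A B C : ModuleCat.{u} R} (f : A ⟶ B) (g : B ⟶ C)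
    (w : f ≫ g = 0) (hf : ∀ a, f.hom a = 0 → a = 0)
    (hfg : ∀ b, g.hom b = 0 → ∃ a, f.hom a = b) (hg : ∀ c, ∃ b, g.hom b = c) :
    (ShortComplex.mk f g w).ShortExact where
  exact := by
    rw [ShortComplex.moduleCat_exact_iff]
    exact hfg
  mono_f := (ModuleCat.mono_iff_injective f).2 ((injective_iff_map_eq_zero _).2 hf)
  epi_g := (ModuleCat.epi_iff_surjective g).2 hg

theorem ModuleCat.ShortExact.elements {A B C : ModuleCat.{u} R} {f : A ⟶ B} {g : B ⟶ C}
    {w : f ≫ g = 0} (h : (ShortComplex.mk f g w).ShortExact) :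
    (∀ a, f.hom a = 0 → a = 0) ∧ (∀ b, g.hom b = 0 → ∃ a, f.hom a = b) ∧
      (∀ c, ∃ b, g.hom b = c) := by
  refine ⟨?_, ?_, ?_⟩
  · exact (injective_iff_map_eq_zero f.hom).1 ((ModuleCat.mono_iff_injective f).1 h.mono_f)
  · exact (ShortComplex.moduleCat_exact_iff _).1 h.exact
  · exact (ModuleCat.epi_iff_surjective g).1 h.epi_g

theorem ShortExact.extClass_congr {C : Type*} [Category C] [Abelian C] [HasExt.{u} C] {A B D : C}
    {f f' : A ⟶ B} {g : B ⟶ D} (h : f = f') {w : f ≫ g = 0} {w' : f' ≫ g = 0}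
    (hS : (ShortComplex.mk f g w).ShortExact) (hS' : (ShortComplex.mk f' g w').ShortExact) :
    hS.extClass = hS'.extClass := by
  subst h; rfl

/-- `KoszulRep M rs π n x`: the sequence `rs` is weakly regular on `M`, `π` identifies `N` with
`M ⧸ (rs) M`, and `x ∈ Ext^n(N, M)` is the Koszul class. -/
def KoszulRep {N : ModuleCat.{u} R} :
    (M : ModuleCat.{u} R) → List R → (M ⟶ N) → (n : ℕ) → Ext N M n → Prop
  | M, [], π, n, x => ∃ (s : N ⟶ M) (h : 0 + 0 = n), π ≫ s = 𝟙 M ∧ s ≫ π = 𝟙 N ∧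
      x = (Ext.mk₀ s).comp (Ext.mk₀ (𝟙 M)) h
  | M, r :: rs, π, n, x => ∃ (M' : ModuleCat.{u} R) (p : M ⟶ M') (w : (r • 𝟙 M) ≫ p = 0)
      (hS : (ShortComplex.mk (r • 𝟙 M) p w).ShortExact) (π' : M' ⟶ N) (m : ℕ) (h : m + 1 = n)
      (e : Ext N M' m), KoszulRep M' rs π' m e ∧ p ≫ π' = π ∧ x = e.comp hS.extClass h

namespace KoszulRep

variable {N M : ModuleCat.{u} R} {rs : List R} {π : M ⟶ N} {n : ℕ} {x : Ext N M n}

/-- Needed for `unique`, where two cokernels of the same element are isomorphic without being equal.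
-/
theorem transport {M₂ : ModuleCat.{u} R} (α : M ≅ M₂) (h : KoszulRep M rs π n x) :
    KoszulRep M₂ rs (α.inv ≫ π) n (x.comp (Ext.mk₀ α.hom) (add_zero n)) := by
  cases rs with
  | nil =>
    obtain ⟨s, rfl, h1, h2, rfl⟩ := h
    refine ⟨s ≫ α.hom, rfl, ?_, ?_, ?_⟩
    · rw [Category.assoc, reassoc_of% h1, Iso.inv_hom_id]
    · simp [h2]
    · simp
  | cons r rs =>
    obtain ⟨M', p, w, hS, π', m, rfl, e, he, rfl, rfl⟩ := h
    have w' : (r • 𝟙 M₂) ≫ α.inv ≫ p = 0 := by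
      have : (r • 𝟙 M₂) ≫ α.inv ≫ p = α.inv ≫ (r • 𝟙 M) ≫ p := by simp
      rw [this, w, comp_zero]
    let S' := ShortComplex.mk (r • 𝟙 M₂) (α.inv ≫ p) w'
    let i : ShortComplex.mk (r • 𝟙 M) p w ≅ S' :=
      ShortComplex.isoMk α α (Iso.refl _) (by simp [S']) (by simp [S'])
    have hS' : S'.ShortExact := ShortComplex.shortExact_of_iso i hS
    refine ⟨M', α.inv ≫ p, w', hS', π', m, rfl, e, he, by simp, ?_⟩
    have := ShortComplex.ShortExact.extClass_naturality hS hS' i.hom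
    have h3 : i.hom.τ₃ = 𝟙 _ := rfl
    have h1 : i.hom.τ₁ = α.hom := rfl
    rw [h3, h1, Ext.mk₀_id_comp] at this
    rw [Ext.comp_assoc_of_third_deg_zero, this]

/-- Two cokernels of r on M are canonically isomorphic, compatibly with the maps to N because M
surjects onto them. Naturality of extension classes carries one Yoneda product to the other. -/
theorem unique {y : Ext N M n} (hx : KoszulRep M rs π n x) (hy : KoszulRep M rs π n y) :
    x = y := by
  induction rs generalizing M n with
  | nil =>
    obtain ⟨s, rfl, h1, h2, rfl⟩ := hx
    obtain ⟨s', -, h1', h2', rfl⟩ := hy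
    have : s = s' := by rw [← Category.comp_id s, ← h1', reassoc_of% h2]
    rw [this]
  | cons r rs ih =>
    obtain ⟨M', p, w, hS, π', m, rfl, e, he, rfl, rfl⟩ := hx
    obtain ⟨M₂, p₂, w₂, hS₂, π₂, m₂, h₂, e₂, he₂, hp, rfl⟩ := hy
    obtain rfl : m₂ = m := by lia
    have := hS.epi_g
    let T₁ := ShortComplex.mk (r • 𝟙 M) p w
    let T₂ := ShortComplex.mk (r • 𝟙 M) p₂ w₂
    let β : M' ≅ M₂ :=
      hS.gIsCokernel.coconePointUniqueUpToIso hS₂.gIsCokernel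
    have hβ : p ≫ β.hom = p₂ :=
      hS.gIsCokernel.comp_coconePointUniqueUpToIso_hom hS₂.gIsCokernel WalkingParallelPair.one
    have hπ : β.inv ≫ π' = π₂ := by
      have := hS₂.epi_g
      rw [Iso.inv_comp_eq, ← cancel_epi p, reassoc_of% hβ, hp]
    have h3 := ih (he.transport β) (hπ ▸ he₂)
    let f : T₁ ⟶ T₂ := ⟨𝟙 _, 𝟙 _, β.hom, by simp [T₁, T₂], by simp [T₁, T₂, hβ]⟩
    have h4 := ShortComplex.ShortExact.extClass_naturality hS hS₂ f
    rw [← h3, Ext.comp_assoc_of_second_deg_zero, ← h4, Ext.comp_mk₀_id]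

theorem postcomp {N₂ : ModuleCat.{u} R} (θ : N ≅ N₂) (h : KoszulRep M rs π n x) :
    KoszulRep M rs (π ≫ θ.hom) n ((Ext.mk₀ θ.inv).comp x (zero_add n)) := by
  induction rs generalizing M n with
  | nil =>
    obtain ⟨s, rfl, h1, h2, rfl⟩ := h
    exact ⟨θ.inv ≫ s, rfl, by simp [h1], by simp [reassoc_of% h2], by simp⟩
  | cons r rs ih =>
    obtain ⟨M', p, w, hS, π', m, rfl, e, he, rfl, rfl⟩ := h
    refine ⟨M', p, w, hS, π' ≫ θ.hom, m, rfl, _, ih he, by simp, ?_⟩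
    rw [Ext.comp_assoc]
    lia

theorem of_koszulClass (M : ModuleCat.{u} R) (rs : List R) (h : IsWeaklyRegular M rs) :
    KoszulRep M rs (koszulProj M rs) rs.length (koszulClass M rs h) := by
  induction rs generalizing M with
  | nil => exact ⟨𝟙 _, rfl, by simp [koszulProj, koszulQuot], by simp [koszulProj, koszulQuot],
      by rw [koszulClass, Ext.comp_mk₀_id]; rfl⟩
  | cons r rs ih =>
    exact ⟨(M.smulShortComplex r).X₃, (M.smulShortComplex r).g, (M.smulShortComplex r).zero,
      ((isWeaklyRegular_cons_iff M r rs).1 h).1.smulShortComplex_shortExact,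
      _, _, rfl, _, ih _ ((isWeaklyRegular_cons_iff M r rs).1 h).2, rfl, rfl⟩

theorem isWeaklyRegular (h : KoszulRep M rs π n x) : IsWeaklyRegular M rs := by
  induction rs generalizing M n with
  | nil => exact .nil _ _
  | cons r rs ih =>
    obtain ⟨M', p, w, hS, π', m, rfl, e, he, rfl, rfl⟩ := h
    obtain ⟨h1, h2, h3⟩ := ModuleCat.ShortExact.elements hS
    have hr : IsSMulRegular M r := by
      rw [isSMulRegular_iff_right_eq_zero_of_smul]
      exact h1
    refine .cons hr ?_
    let T := M.smulShortComplex r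
    let β : T.X₃ ≅ M' :=
      hr.smulShortComplex_shortExact.gIsCokernel.coconePointUniqueUpToIso hS.gIsCokernel
    exact (β.toLinearEquiv.isWeaklyRegular_congr rs).2 (ih he)

/-- Multiplication by t on the left term, and the identity on the others, is an isomorphism from the
extension of r to that of s * r. Pushing out along t multiplies the class by t. -/
theorem scale_head {r : R} (s t : R) (hst : s * t = 1) (h : KoszulRep M (r :: rs) π n x) :
    KoszulRep M (s * r :: rs) π n (t • x) := by
  obtain ⟨M', p, w, hS, π', m, rfl, e, he, rfl, rfl⟩ := h
  have w' : ((s * r) • 𝟙 M) ≫ p = 0 := by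
    have := congrArg (s • ·) w
    simpa [smul_smul] using this
  have hst' : t * s = 1 := by rw [mul_comm, hst]
  let i₁ : M ≅ M := ⟨t • 𝟙 M, s • 𝟙 M, by simp [smul_smul, hst], by simp [smul_smul, hst']⟩
  let i : ShortComplex.mk (r • 𝟙 M) p w ≅ ShortComplex.mk ((s * r) • 𝟙 M) p w' :=
    ShortComplex.isoMk i₁ (Iso.refl _) (Iso.refl _) (by
      simp only [i₁, Linear.smul_comp, Category.id_comp, smul_smul, Iso.refl_hom,
        Category.comp_id]
      congr 1
      linear_combination r * hst) (by simp)
  have hS' := ShortComplex.shortExact_of_iso i hS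
  refine ⟨M', p, w', hS', π', m, rfl, e, he, rfl, ?_⟩
  have := ShortComplex.ShortExact.extClass_naturality hS hS' i.hom
  have h3 : i.hom.τ₃ = 𝟙 _ := rfl
  have h1 : i.hom.τ₁ = t • 𝟙 M := rfl
  rw [h3, h1, Ext.mk₀_id_comp] at this
  rw [← this, ← Ext.smul_eq_comp_mk₀]
  simp

/-- The elements of the sequence enter only through the homotheties that they define. -/
theorem congr_of_smul_eq {rs' : List R}
    (hrs : List.Forall₂ (fun a b => (a • 𝟙 M : M ⟶ M) = b • 𝟙 M) rs rs')
    (h : KoszulRep M rs π n x) : KoszulRep M rs' π n x := by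
  induction rs generalizing M n rs' with
  | nil => cases hrs; exact h
  | cons a as ih =>
    cases hrs with
    | @cons _ b _ bs hab hrs =>
    obtain ⟨M', p, w, hS, π', m, rfl, e, he, rfl, rfl⟩ := h
    have := hS.epi_g
    have w' : (b • 𝟙 M) ≫ p = 0 := hab ▸ w
    have hS' : (ShortComplex.mk (b • 𝟙 M) p w').ShortExact := by
      convert hS using 2
      exact hab.symm
    refine ⟨M', p, w', hS', π', m, rfl, e, ih ?_ he, rfl, ?_⟩
    · refine hrs.imp fun c d hcd => ?_
      rw [← cancel_epi p]
      have := congrArg (· ≫ p) hcd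
      simpa using this
    · rw [ShortExact.extClass_congr hab hS hS']

/-- Multiples of r act as zero on the cokernel of r, where the rest of the sequence lives. -/
theorem add_head_tail {r : R} {rs' : List R}
    (hrs : List.Forall₂ (fun a b => ∃ c, b = a + c * r) rs rs')
    (h : KoszulRep M (r :: rs) π n x) : KoszulRep M (r :: rs') π n x := by
  obtain ⟨M', p, w, hS, π', m, rfl, e, he, rfl, rfl⟩ := h
  refine ⟨M', p, w, hS, π', m, rfl, e, he.congr_of_smul_eq (hrs.imp ?_), rfl, rfl⟩
  rintro a _ ⟨c, rfl⟩
  have := hS.epi_g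
  have hr : (r • 𝟙 M' : M' ⟶ M') = 0 := by
    rw [← cancel_epi p]
    simpa using w
  rw [add_smul, mul_smul, hr, smul_zero, add_zero]

/-- Both products are compared with the Koszul complex M → M² → M on r and s, cut at the kernel K of
M → M''. Its map to the extensions for r, s is the identity on the leftmost M, while its map to
those for s, r is minus the identity. This is the sign. -/
theorem swap_head {r s : R} (hs : IsSMulRegular M s) (hr : IsSMulRegular (QuotSMulTop s M) r)
    (h : KoszulRep M (r :: s :: rs) π n x) : KoszulRep M (s :: r :: rs) π n (-x) := by
  obtain ⟨M', p, w, hS, π', m, rfl, e,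
    ⟨M'', p', w', hS', π'', m, rfl, e, he, rfl, rfl⟩, rfl, rfl⟩ := h
  obtain ⟨a1, a2, a3⟩ := ModuleCat.ShortExact.elements hS
  obtain ⟨b1, b2, b3⟩ := ModuleCat.ShortExact.elements hS'
  have a0 : ∀ m, p.hom (r • m) = 0 := fun m => congrArg (fun f => f.hom m) w
  have b0 : ∀ m, p'.hom (s • m) = 0 := fun m => congrArg (fun f => f.hom m) w'
  -- the quotient by `s`
  let T := M.smulShortComplex s
  let q : M ⟶ T.X₃ := T.g
  have wq : (s • 𝟙 M) ≫ q = 0 := T.zero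
  have hT : (ShortComplex.mk (s • 𝟙 M) q wq).ShortExact := hs.smulShortComplex_shortExact
  obtain ⟨c1, c2, c3⟩ := ModuleCat.ShortExact.elements hT
  have c0 : ∀ m, q.hom (s • m) = 0 := fun m => congrArg (fun f => f.hom m) wq
  have := hT.epi_g
  have := hS.epi_g
  have := hS'.epi_g
  have wd : (s • 𝟙 M) ≫ p ≫ p' = 0 := by
    have : (s • 𝟙 M) ≫ p ≫ p' = p ≫ (s • 𝟙 M') ≫ p' := by simp
    rw [this, w', comp_zero]
  let q' : T.X₃ ⟶ M'' := hT.gIsCokernel.desc (CokernelCofork.ofπ (p ≫ p') wd)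
  have hq' : q ≫ q' = p ≫ p' :=
    hT.gIsCokernel.fac (CokernelCofork.ofπ (p ≫ p') wd) WalkingParallelPair.one
  have hq'e : ∀ m, q'.hom (q.hom m) = p'.hom (p.hom m) := fun m => congrArg (fun f => f.hom m) hq'
  have wq' : (r • 𝟙 T.X₃) ≫ q' = 0 := by
    rw [← cancel_epi q]
    have : q ≫ (r • 𝟙 T.X₃) ≫ q' = ((r • 𝟙 M) ≫ p) ≫ p' := by simp [hq']
    rw [this, w, zero_comp, comp_zero]
  have hT' : (ShortComplex.mk (r • 𝟙 T.X₃) q' wq').ShortExact := by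
    refine ModuleCat.shortExact_of_elements _ _ _ ?_ ?_ ?_
    · exact isSMulRegular_iff_right_eq_zero_of_smul.1 hr
    · intro y hy
      obtain ⟨y, rfl⟩ := c3 y
      rw [hq'e] at hy
      obtain ⟨z, hz⟩ := b2 _ hy
      obtain ⟨z, rfl⟩ := a3 z
      have : p.hom (y - s • z) = 0 := by
        rw [map_sub, map_smul, sub_eq_zero]; exact hz.symm
      obtain ⟨t, ht⟩ := a2 _ this
      refine ⟨q.hom t, ?_⟩
      have h4 := congrArg q.hom ht
      rw [map_sub, c0, sub_zero] at h4
      rw [← h4]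
      exact (map_smul q.hom r t).symm
    · intro z
      obtain ⟨z, rfl⟩ := b3 z
      obtain ⟨z, rfl⟩ := a3 z
      exact ⟨q.hom z, hq'e z⟩
  -- the Koszul complex on two elements
  let K : ModuleCat.{u} R := ModuleCat.of R (LinearMap.ker (p ≫ p').hom)
  let ι : K ⟶ M := ModuleCat.ofHom (LinearMap.ker (p ≫ p').hom).subtype
  have wK : ι ≫ p ≫ p' = 0 := by ext k; exact k.2
  have hK : (ShortComplex.mk ι (p ≫ p') wK).ShortExact := by
    refine ModuleCat.shortExact_of_elements _ _ _ (fun a ha => Subtype.ext ha)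
      (fun b hb => ⟨⟨b, hb⟩, rfl⟩) fun c => ?_
    obtain ⟨c, rfl⟩ := b3 c
    obtain ⟨c, rfl⟩ := a3 c
    exact ⟨c, rfl⟩
  -- The differential is m ↦ (-s m, r m): the second coordinate leads to the extension of r, the
  -- first to that of s with a sign.
  let d : M ⟶ ModuleCat.of R (M × M) :=
    ModuleCat.ofHom ((-(LinearMap.lsmul R M s)).prod (LinearMap.lsmul R M r))
  let σ : ModuleCat.of R (M × M) ⟶ K := ModuleCat.ofHom
    (LinearMap.codRestrict _ ((LinearMap.lsmul R M r).coprod (LinearMap.lsmul R M s)) (by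
      rintro ⟨a, b⟩
      change p'.hom (p.hom (r • a + s • b)) = 0
      rw [map_add, a0, zero_add, map_smul, b0]))
  have wσ : d ≫ σ = 0 := by
    ext k
    change r • (-(s • k)) + s • (r • k) = 0
    rw [smul_neg, smul_comm, neg_add_cancel]
  have hσ : (ShortComplex.mk d σ wσ).ShortExact := by
    refine ModuleCat.shortExact_of_elements _ _ _ ?_ ?_ ?_
    · intro a ha
      exact a1 _ (congrArg Prod.snd ha)
    · rintro ⟨a, b⟩ hab
      have hab : r • a + s • b = 0 := congrArg Subtype.val hab
      have h1 : s • p.hom b = 0 := by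
        have := congrArg p.hom hab
        rwa [map_add, a0, zero_add, map_smul, map_zero] at this
      obtain ⟨c, rfl⟩ := a2 b (b1 _ h1)
      refine ⟨c, Prod.ext ?_ rfl⟩
      have h2 : r • (a + s • c) = 0 := by
        rw [smul_add, ← hab, smul_comm r s c]; rfl
      exact (eq_neg_of_add_eq_zero_left (a1 _ h2)).symm
    · rintro ⟨k, hk⟩
      obtain ⟨c, hc⟩ := b2 _ hk
      obtain ⟨c, rfl⟩ := a3 c
      have : p.hom (k - s • c) = 0 := by rw [map_sub, map_smul, sub_eq_zero]; exact hc.symm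
      obtain ⟨a, ha⟩ := a2 _ this
      refine ⟨(a, c), Subtype.ext ?_⟩
      change r • a + s • c = k
      rw [show r • a = k - s • c from ha, sub_add_cancel]
  -- comparison with the sequence `r, s`
  have := hS'.mono_f
  have := hT'.mono_f
  have wγ : (ι ≫ p) ≫ p' = 0 := by rw [Category.assoc, wK]
  let γ : K ⟶ M' := hS'.fIsKernel.lift (KernelFork.ofι (ι ≫ p) wγ)
  have hγ : γ ≫ (s • 𝟙 M') = ι ≫ p :=
    hS'.fIsKernel.fac (KernelFork.ofι (ι ≫ p) wγ) WalkingParallelPair.zero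
  have wγ' : (ι ≫ q) ≫ q' = 0 := by rw [Category.assoc, hq', wK]
  let γ' : K ⟶ T.X₃ := hT'.fIsKernel.lift (KernelFork.ofι (ι ≫ q) wγ')
  have hγ' : γ' ≫ (r • 𝟙 T.X₃) = ι ≫ q :=
    hT'.fIsKernel.fac (KernelFork.ofι (ι ≫ q) wγ') WalkingParallelPair.zero
  have e1 := ShortComplex.ShortExact.extClass_naturality hK hS'
    ⟨γ, p, 𝟙 _, hγ, (Category.comp_id _).symm⟩
  have e1' := ShortComplex.ShortExact.extClass_naturality hK hT'
    ⟨γ', q, 𝟙 _, hγ', by simp [hq']⟩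
  have e2 := ShortComplex.ShortExact.extClass_naturality hσ hS
    ⟨𝟙 _, ModuleCat.ofHom (LinearMap.snd R M M), γ, by ext k; rfl, by
      have := hS'.mono_f
      rw [← cancel_mono (s • 𝟙 M'), Category.assoc, Category.assoc, hγ]
      refine ModuleCat.hom_ext (LinearMap.ext ?_)
      rintro ⟨a, b⟩
      change s • p.hom b = p.hom (r • a + s • b)
      rw [map_add, a0, zero_add, map_smul]⟩
  have e2' := ShortComplex.ShortExact.extClass_naturality hσ hT
    ⟨-𝟙 _, ModuleCat.ofHom (LinearMap.fst R M M), γ', by ext k; exact smul_neg s k, by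
      have := hT'.mono_f
      rw [← cancel_mono (r • 𝟙 T.X₃), Category.assoc, Category.assoc, hγ']
      refine ModuleCat.hom_ext (LinearMap.ext ?_)
      rintro ⟨a, b⟩
      change r • q.hom a = q.hom (r • a + s • b)
      rw [map_add, c0, add_zero, map_smul]⟩
  dsimp only at e1 e1' e2 e2'
  rw [Ext.mk₀_id_comp] at e1 e1'
  rw [Ext.comp_mk₀_id] at e2
  rw [Ext.mk₀_neg, Ext.comp_neg, Ext.comp_mk₀_id] at e2'
  refine ⟨T.X₃, q, wq, hT, q' ≫ π'', m + 1, rfl, e.comp hT'.extClass rfl,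
    ⟨M'', q', wq', hT', π'', m, rfl, e, he, rfl, rfl⟩, by rw [reassoc_of% hq'], ?_⟩
  rw [← e1, ← e1', Ext.comp_assoc e _ _ rfl (rfl : 1 + 1 = 2) (by lia),
    Ext.comp_assoc e _ _ rfl (rfl : 1 + 1 = 2) (by lia),
    Ext.comp_assoc_of_second_deg_zero, Ext.comp_assoc_of_second_deg_zero, ← e2, ← e2',
    Ext.comp_neg, Ext.comp_neg]

end KoszulRep

end KoszulClasses

/-! ### Elementary operations on systems of generators -/

section KoszulTuples

open Abelian RingTheory.Sequence IsLocalRing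

variable {R : Type u} [CommRing R]

namespace KoszulRep

variable {N M : ModuleCat.{u} R} {rs : List R} {n : ℕ}

/-- On a finite module over a Noetherian local ring, regularity of a sequence in the maximal ideal
does not depend on the order. -/
theorem swap_head_of_mem [IsLocalRing R] [IsNoetherianRing R] [Module.Finite R M] {r s : R}
    {π : M ⟶ N} {x : Ext N M n} (h : KoszulRep M (r :: s :: rs) π n x)
    (hm : ∀ a ∈ r :: s :: rs, a ∈ maximalIdeal R) :
    KoszulRep M (s :: r :: rs) π n (-x) := by
  have h1 := IsLocalRing.isWeaklyRegular_of_perm_of_subset_maximalIdeal h.isWeaklyRegular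
    (.swap s r rs) hm
  rw [isWeaklyRegular_cons_iff, isWeaklyRegular_cons_iff] at h1
  exact h.swap_head h1.1 h1.2.1

/-- Move the head past the next element. If that element is y, multiples of it now act as zero on
the module where r lives; otherwise recurse. Moving back cancels the sign. -/
theorem add_tail_head [IsLocalRing R] [IsNoetherianRing R] [Module.Finite R M] {r a y : R}
    {π : M ⟶ N} {x : Ext N M n} (h : KoszulRep M (r :: rs) π n x) (hy : y ∈ rs)
    (hm : ∀ a ∈ r :: rs, a ∈ maximalIdeal R) :
    KoszulRep M ((r + a * y) :: rs) π n x := by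
  induction rs generalizing M n with
  | nil => cases hy
  | cons z rs ih =>
    have h1 := h.swap_head_of_mem hm
    have hra : r + a * y ∈ maximalIdeal R :=
      add_mem (hm _ (by simp)) (Ideal.mul_mem_left _ _ (hm _ (List.mem_cons_of_mem _ hy)))
    have hm' : ∀ b ∈ z :: (r + a * y) :: rs, b ∈ maximalIdeal R := by
      intro b hb
      simp only [List.mem_cons] at hb hm
      rcases hb with rfl | rfl | hb
      · exact hm _ (by simp)
      · exact hra
      · exact hm _ (by simp [hb])
    suffices h2 : KoszulRep M (z :: (r + a * y) :: rs) π n (-x) by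
      have := h2.swap_head_of_mem hm'
      rwa [neg_neg] at this
    by_cases hyz : y = z
    · subst hyz
      exact h1.add_head_tail (.cons ⟨a, rfl⟩ (List.forall₂_same.2 fun b _ => ⟨0, by simp⟩))
    · obtain ⟨M', p, w, hS, π', m, hmn, e, he, hp, hx⟩ := h1
      have : Module.Finite R M' :=
        .of_surjective p.hom ((ModuleCat.epi_iff_surjective p).1 hS.epi_g)
      refine ⟨M', p, w, hS, π', m, hmn, e, ih he ?_ ?_, hp, hx⟩
      · simpa [hyz] using hy
      · intro b hb
        refine hm b ?_
        simp only [List.mem_cons] at hb ⊢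
        tauto

theorem ofFn_transvection [IsLocalRing R] [IsNoetherianRing R] {k : ℕ} (x : Fin k → R)
    (hx : ∀ i, x i ∈ maximalIdeal R) (j l : Fin k) (hjl : j ≠ l) (a : R) :
    ∀ {M : ModuleCat.{u} R} [Module.Finite R M] {π : M ⟶ N} {n : ℕ} {e : Ext N M n},
      KoszulRep M (List.ofFn x) π n e →
      KoszulRep M (List.ofFn (Function.update x j (x j + a * x l))) π n e := by
  induction k with
  | zero => exact j.elim0
  | succ k ih =>
    intro M _ π n e h
    rw [List.ofFn_succ] at h ⊢
    have hm : ∀ b ∈ x 0 :: List.ofFn (fun i => x i.succ), b ∈ maximalIdeal R := by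
      intro b hb
      rw [← List.ofFn_succ, List.mem_ofFn] at hb
      obtain ⟨i, rfl⟩ := hb
      exact hx i
    cases j using Fin.cases with
    | zero =>
      obtain ⟨l, rfl⟩ := Fin.exists_succ_eq.2 hjl.symm
      simp only [Function.update_self, ne_eq, Fin.succ_ne_zero, not_false_eq_true,
        Function.update_of_ne]
      exact h.add_tail_head (by simp [List.mem_ofFn]) hm
    | succ j =>
      have hu : (fun i : Fin k => Function.update x j.succ (x j.succ + a * x l) i.succ) =
          Function.update (fun i => x i.succ) j (x j.succ + a * x l) := by
        ext i
        by_cases hi : i = j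
        · subst hi; simp
        · simp [Function.update_of_ne, hi]
      rw [hu, Function.update_of_ne (Fin.succ_ne_zero j).symm]
      cases l using Fin.cases with
      | zero =>
        refine h.add_head_tail ?_
        rw [List.forall₂_iff_get]
        refine ⟨by simp, fun i h1 h2 => ?_⟩
        simp only [List.get_eq_getElem, List.getElem_ofFn, Function.update_apply]
        split_ifs with hi
        · exact ⟨a, by rw [hi]⟩
        · exact ⟨0, by simp⟩
      | succ l =>
        obtain ⟨M', p, w, hS, π', m, hmn, e', he, hp, hx'⟩ := h
        have : Module.Finite R M' :=
          .of_surjective p.hom ((ModuleCat.epi_iff_surjective p).1 hS.epi_g)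
        exact ⟨M', p, w, hS, π', m, hmn, e', ih (fun i => x i.succ) (fun i => hx _) j l
          (fun h => hjl (by rw [h])) he, hp, hx'⟩

theorem ofFn_scale {k : ℕ} (x : Fin k → R) (j : Fin k) (s t : R) (hst : s * t = 1) :
    ∀ {M : ModuleCat.{u} R} {π : M ⟶ N} {n : ℕ} {e : Ext N M n},
      KoszulRep M (List.ofFn x) π n e →
      KoszulRep M (List.ofFn (Function.update x j (s * x j))) π n (t • e) := by
  induction k with
  | zero => exact j.elim0
  | succ k ih =>
    intro M π n e h
    rw [List.ofFn_succ] at h ⊢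
    cases j using Fin.cases with
    | zero =>
      simp only [Function.update_self, ne_eq, Fin.succ_ne_zero, not_false_eq_true,
        Function.update_of_ne]
      exact h.scale_head s t hst
    | succ j =>
      have hu : (fun i : Fin k => Function.update x j.succ (s * x j.succ) i.succ) =
          Function.update (fun i => x i.succ) j (s * x j.succ) := by
        ext i
        by_cases hi : i = j
        · subst hi; simp
        · simp [Function.update_of_ne, hi]
      rw [hu, Function.update_of_ne (Fin.succ_ne_zero j).symm]
      obtain ⟨M', p, w, hS, π', m, hmn, e', he, hp, rfl⟩ := h
      exact ⟨M', p, w, hS, π', m, hmn, t • e', ih (fun i => x i.succ) j he, hp, by simp⟩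

variable [IsLocalRing R] [IsNoetherianRing R]

theorem ofFn_add_sum [Module.Finite R M] {k : ℕ} (x : Fin k → R)
    (hx : ∀ i, x i ∈ maximalIdeal R) (j : Fin k) (a : Fin k → R) (s : Finset (Fin k))
    (hs : j ∉ s) {π : M ⟶ N} {e : Ext N M n} (h : KoszulRep M (List.ofFn x) π n e) :
    KoszulRep M (List.ofFn (Function.update x j (x j + ∑ l ∈ s, a l * x l))) π n e := by
  induction s using Finset.induction_on with
  | empty => simpa using h
  | insert l s hl ih =>
    simp only [Finset.mem_insert, not_or] at hs
    have h1 := ih hs.2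
    have h2 := ofFn_transvection _ (fun i => ?_) j l hs.1 (a l) h1
    · rw [Function.update_idem, Function.update_self, Function.update_of_ne (Ne.symm hs.1)] at h2
      rwa [Finset.sum_insert hl, add_comm (a l * x l), ← add_assoc]
    · by_cases hi : i = j
      · subst hi
        rw [Function.update_self]
        exact add_mem (hx _) (sum_mem fun l _ => Ideal.mul_mem_left _ _ (hx _))
      · rw [Function.update_of_ne hi]; exact hx i

/-- Elements of `𝔪²` may be added to the members of a system of generators. -/
theorem ofFn_add_sq [Module.Finite R M] {k : ℕ} (x : Fin k → R)
    (hx : Ideal.span (Set.range x) = maximalIdeal R) (j : Fin k) (z : R)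
    (hz : z ∈ maximalIdeal R ^ 2) (hN : ∀ r ∈ maximalIdeal R, (r • 𝟙 N : N ⟶ N) = 0)
    {π : M ⟶ N} {e : Ext N M n} (h : KoszulRep M (List.ofFn x) π n e) :
    KoszulRep M (List.ofFn (Function.update x j (x j + z))) π n e := by
  have hx' : ∀ i, x i ∈ maximalIdeal R := fun i => hx ▸ Ideal.subset_span ⟨i, rfl⟩
  -- With z = ∑ a_l x_l and all a_l in 𝔪, the new entry is (1 + a_j) x_j + ∑_{l ≠ j} a_l x_l: a
  -- scaling by a unit congruent to 1, followed by transvections.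
  obtain ⟨a, ha, rfl⟩ : ∃ a : Fin k → R, (∀ i, a i ∈ maximalIdeal R) ∧ ∑ i, a i * x i = z := by
    rw [pow_two, ← smul_eq_mul] at hz
    nth_rewrite 2 [← hx] at hz
    obtain ⟨a, ha, hz⟩ := (Submodule.mem_ideal_smul_span_iff_exists_sum _ _ _).1 hz
    refine ⟨a, ha, ?_⟩
    rw [← hz, Finsupp.sum_fintype _ _ (by simp)]
    rfl
  have hu : IsUnit (1 + a j) := by
    rw [← notMem_maximalIdeal]
    intro h1
    exact (maximalIdeal.isMaximal R).ne_top
      ((Ideal.eq_top_iff_one _).2 (by simpa using sub_mem h1 (ha j)))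
  obtain ⟨t, ht⟩ := hu.exists_right_inv
  have h1 := ofFn_scale x j (1 + a j) t ht h
  -- The inverse t of 1 + a_j is congruent to 1 modulo 𝔪, and 𝔪 kills Ext(N, M) because it kills N.
  have hte : t • e = e := by
    have ht1 : t - 1 ∈ maximalIdeal R := by
      have : t - 1 = -(t * a j) := by linear_combination ht
      rw [this]
      exact neg_mem (Ideal.mul_mem_left _ _ (ha j))
    have h0 : (t - 1) • e = 0 := by
      have : (t - 1) • e = (Ext.mk₀ ((t - 1) • 𝟙 N)).comp e (zero_add n) := by
        simp [Ext.mk₀_smul]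
      rw [this, hN _ ht1, Ext.mk₀_zero, Ext.zero_comp]
    rwa [sub_smul, one_smul, sub_eq_zero] at h0
  rw [hte] at h1
  have h2 := ofFn_add_sum _ (fun i => ?_) j a (Finset.univ.erase j) (by simp) h1
  · rw [Function.update_idem, Function.update_self] at h2
    have key : x j + ∑ l, a l * x l = (1 + a j) * x j + ∑ l ∈ Finset.univ.erase j,
        a l * Function.update x j ((1 + a j) * x j) l := by
      rw [← Finset.add_sum_erase _ _ (Finset.mem_univ j), add_mul, one_mul, add_assoc]
      congr 2
      exact Finset.sum_congr rfl fun l hl => by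
        rw [Function.update_of_ne (Finset.ne_of_mem_erase hl)]
    rwa [key]
  · by_cases hi : i = j
    · subst hi
      rw [Function.update_self]
      exact Ideal.mul_mem_left _ _ (hx' _)
    · rw [Function.update_of_ne hi]; exact hx' i

theorem _root_.IsLocalRing.span_range_eq_of_sub_mem_sq {k : ℕ} {x y : Fin k → R}
    (hx : Ideal.span (Set.range x) = maximalIdeal R)
    (hxy : ∀ i, y i - x i ∈ maximalIdeal R ^ 2) :
    Ideal.span (Set.range y) = maximalIdeal R := by
  have hx' : ∀ i, x i ∈ maximalIdeal R := fun i => hx ▸ Ideal.subset_span ⟨i, rfl⟩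
  refine le_antisymm ?_ ?_
  · rw [Ideal.span_le]
    rintro _ ⟨i, rfl⟩
    have := add_mem (hx' i) (Ideal.pow_le_self two_ne_zero (hxy i))
    simpa using this
  · refine Submodule.le_of_le_smul_of_le_jacobson_bot (I := maximalIdeal R)
      (IsNoetherian.noetherian _) (jacobson_eq_maximalIdeal _ bot_ne_top).ge ?_
    rw [← hx, Ideal.span_le]
    rintro _ ⟨i, rfl⟩
    have : x i = y i + -(y i - x i) := by ring
    rw [this, hx]
    refine Submodule.add_mem_sup (Ideal.subset_span ⟨i, rfl⟩) (neg_mem ?_)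
    rw [smul_eq_mul, ← pow_two]
    exact hxy i

/-- The entries are replaced one at a time; by Nakayama each intermediate tuple still generates 𝔪,
which `ofFn_add_sq` requires. -/
theorem ofFn_congr_sq [Module.Finite R M] {k : ℕ} (x y : Fin k → R)
    (hx : Ideal.span (Set.range x) = maximalIdeal R)
    (hxy : ∀ i, y i - x i ∈ maximalIdeal R ^ 2)
    (hN : ∀ r ∈ maximalIdeal R, (r • 𝟙 N : N ⟶ N) = 0)
    {π : M ⟶ N} {e : Ext N M n} (h : KoszulRep M (List.ofFn x) π n e) :
    KoszulRep M (List.ofFn y) π n e := by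
  suffices H : ∀ s : Finset (Fin k), KoszulRep M (List.ofFn (s.piecewise y x)) π n e by
    simpa using H Finset.univ
  intro s
  induction s using Finset.induction_on with
  | empty => simpa using h
  | insert j s hj ih =>
    have h1 := ofFn_add_sq _ (span_range_eq_of_sub_mem_sq hx (fun i => ?_)) j (y j - x j) (hxy j)
      hN ih
    · rw [Finset.piecewise_insert]
      convert h1 using 3
      rw [Finset.piecewise_eq_of_notMem _ _ _ hj]
      ring
    · by_cases hi : i ∈ s
      · rw [Finset.piecewise_eq_of_mem _ _ _ hi]; exact hxy i
      · rw [Finset.piecewise_eq_of_notMem _ _ _ hi, sub_self]; exact zero_mem _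

end KoszulRep

end KoszulTuples

/-! ### The determinant rule for Koszul classes -/

section KoszulDet

open Abelian RingTheory.Sequence IsLocalRing

variable {R : Type u} [CommRing R] [IsLocalRing R]

theorem IsLocalRing.span_range_eq_iff [IsNoetherianRing R] {ι : Type*} (x : ι → maximalIdeal R) :
    Ideal.span (Set.range fun j => (x j : R)) = maximalIdeal R ↔
      Submodule.span (ResidueField R)
        (Set.range fun j => (maximalIdeal R).toCotangent (x j)) = ⊤ := by
  rw [show (Set.range fun j => (maximalIdeal R).toCotangent (x j)) =
    (maximalIdeal R).toCotangent '' Set.range x from Set.range_comp _ _,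
    CotangentSpace.span_image_eq_top_iff]
  rw [← (Submodule.map_injective_of_injective (maximalIdeal R).injective_subtype).eq_iff,
    Submodule.map_span, Submodule.map_top, Submodule.range_subtype, ← Set.range_comp]
  rfl

theorem Ext.smul_congr_of_maximalIdeal {N M : ModuleCat.{u} R} {n : ℕ}
    (hN : ∀ r ∈ maximalIdeal R, (r • 𝟙 N : N ⟶ N) = 0) (e : Ext N M n) {a b : R}
    (h : residue R a = residue R b) : a • e = b • e := by
  have hab : a - b ∈ maximalIdeal R := by
    rw [← residue_eq_zero_iff, map_sub, h, sub_self]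
  have h0 : (a - b) • e = 0 := by
    have : (a - b) • e = (Ext.mk₀ ((a - b) • 𝟙 N)).comp e (zero_add n) := by
      simp [Ext.mk₀_smul]
    rw [this, hN _ hab, Ext.mk₀_zero, Ext.zero_comp]
  rwa [sub_smul, sub_eq_zero] at h0

/-- The class `x̄` of `x ∈ 𝔪` in `𝔪 ⧸ 𝔪²` (as a vector space over the residue field). -/
abbrev cotClass (x : maximalIdeal R) : CotangentSpace R := (maximalIdeal R).toCotangent x

theorem cotClass_smul (a : R) (x : maximalIdeal R) :
    cotClass (a • x) = residue R a • cotClass x := by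
  rw [cotClass, map_smul]; rfl

theorem sub_mem_sq_of_cotClass_eq {x y : maximalIdeal R} (h : cotClass x = cotClass y) :
    (x : R) - y ∈ maximalIdeal R ^ 2 :=
  (Ideal.toCotangent_eq _).1 h

/-- An invertible matrix over the residue field is a product of diagonal matrices and transvections.
Each factor is lifted to R; the lift is immaterial, since tuples agreeing modulo 𝔪² have the same
Koszul class and scalars agreeing modulo 𝔪 act equally on it. -/
theorem KoszulRep.det_smul [IsNoetherianRing R] {N M : ModuleCat.{u} R} [Module.Finite R M]
    (hN : ∀ r ∈ maximalIdeal R, (r • 𝟙 N : N ⟶ N) = 0) {k n : ℕ} {π : M ⟶ N}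
    (A : Matrix (Fin k) (Fin k) (ResidueField R)) (hA : A.det ≠ 0) :
    ∀ (x y : Fin k → maximalIdeal R),
      Submodule.span (ResidueField R) (Set.range fun j => cotClass (x j)) = ⊤ →
      (∀ j, cotClass (y j) = ∑ l, A j l • cotClass (x l)) →
      ∀ e : Ext N M n, KoszulRep M (List.ofFn fun j => (x j : R)) π n e →
      ∀ d : R, residue R d * A.det = 1 →
        KoszulRep M (List.ofFn fun j => (y j : R)) π n (d • e) := by
  refine Matrix.diagonal_transvection_induction_of_det_ne_zero
    (fun A => ∀ (x y : Fin k → maximalIdeal R),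
      Submodule.span (ResidueField R) (Set.range fun j => cotClass (x j)) = ⊤ →
      (∀ j, cotClass (y j) = ∑ l, A j l • cotClass (x l)) →
      ∀ e : Ext N M n, KoszulRep M (List.ofFn fun j => (x j : R)) π n e →
      ∀ d : R, residue R d * A.det = 1 →
        KoszulRep M (List.ofFn fun j => (y j : R)) π n (d • e)) A hA ?_ ?_ ?_
  · intro D hD x y hx hy e he d hd
    choose s hs using fun j => residue_surjective (D j)
    have hu : ∀ j, IsUnit (s j) := by
      intro j
      rw [← isUnit_map_iff (residue R), hs, isUnit_iff_ne_zero]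
      rw [Matrix.det_diagonal] at hD
      exact Finset.prod_ne_zero_iff.1 hD j (Finset.mem_univ j)
    choose t ht using fun j => (hu j).exists_right_inv
    -- Diagonal case: the entries are scaled one at a time, each by s j, which multiplies the class
    -- by t j.
    have hind : ∀ S : Finset (Fin k), KoszulRep M
        (List.ofFn (S.piecewise (fun j => s j * (x j : R)) fun j => (x j : R))) π n
        ((∏ j ∈ S, t j) • e) := by
      intro S
      induction S using Finset.induction_on with
      | empty => simpa using he
      | insert j S hj ih =>
        have h1 := ofFn_scale _ j (s j) (t j) (ht j) ih
        rw [Finset.piecewise_insert, Finset.prod_insert hj, mul_smul]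
        rwa [Finset.piecewise_eq_of_notMem _ _ _ hj] at h1
    have h2 := hind Finset.univ
    rw [Finset.piecewise_univ] at h2
    have h3 : d • e = (∏ j, t j) • e := by
      refine Ext.smul_congr_of_maximalIdeal hN e ?_
      have h4 : residue R (∏ j, t j) * (Matrix.diagonal D).det = 1 := by
        rw [Matrix.det_diagonal, map_prod, ← Finset.prod_mul_distrib]
        refine Finset.prod_eq_one fun j _ => ?_
        rw [← hs, ← map_mul, mul_comm, ht, map_one]
      exact mul_right_cancel₀ hD (hd.trans h4.symm)
    rw [h3]
    have hz : ∀ j, cotClass (y j) = cotClass (s j • x j) := by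
      intro j
      rw [hy, cotClass_smul, hs]
      simp [Matrix.diagonal_apply, ite_smul]
    refine ofFn_congr_sq (fun j => s j * (x j : R)) _ ?_ (fun i => ?_) hN h2
    · have := (span_range_eq_iff (fun j => s j • x j)).2 ?_
      · exact this
      · rw [← top_le_iff, ← hx, Submodule.span_le]
        rintro _ ⟨j, rfl⟩
        have : cotClass (x j) = residue R (t j) • cotClass (s j • x j) := by
          rw [← cotClass_smul, smul_smul, mul_comm, ht, one_smul]
        change cotClass (x j) ∈ _
        rw [this]
        exact Submodule.smul_mem _ _ (Submodule.subset_span ⟨j, rfl⟩)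
    · exact sub_mem_sq_of_cotClass_eq (hz i)
  · intro T x y hx hy e he d hd
    obtain ⟨i, j, hij, c⟩ := T
    obtain ⟨a, rfl⟩ := residue_surjective c
    have hde : d • e = e := by
      rw [Ext.smul_congr_of_maximalIdeal hN e (b := 1), one_smul]
      simpa [Matrix.TransvectionStruct.toMatrix, Matrix.det_transvection_of_ne i j hij] using hd
    rw [hde]
    have hx1 := (span_range_eq_iff x).2 hx
    have h1 := ofFn_transvection (fun j => (x j : R)) (fun j => (x j).2) i j hij a he
    let z : Fin k → maximalIdeal R := Function.update x i (x i + a • x j)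
    have hz : (fun l => (z l : R)) =
        Function.update (fun j => (x j : R)) i (x i + a * x j) := by
      ext l
      by_cases hl : l = i
      · subst hl; simp [z]
      · simp [z, Function.update_of_ne hl]
    rw [← hz] at h1
    refine ofFn_congr_sq _ _ ?_ (fun l => sub_mem_sq_of_cotClass_eq ?_) hN h1
    · rw [span_range_eq_iff, ← top_le_iff, ← hx, Submodule.span_le]
      have hsub : ∀ l, l ≠ i → cotClass (x l) ∈ Submodule.span (ResidueField R)
          (Set.range fun j => cotClass (z j)) := fun l hl =>
        Submodule.subset_span ⟨l, by simp [z, Function.update_of_ne hl]⟩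
      rintro _ ⟨l, rfl⟩
      by_cases hl : l = i
      · subst hl
        have : cotClass (x l) = cotClass (z l) - residue R a • cotClass (x j) := by
          simp only [z, Function.update_self]
          rw [← cotClass_smul, cotClass, cotClass, map_add, add_sub_cancel_right]
        change cotClass (x l) ∈ _
        rw [this]
        exact sub_mem (Submodule.subset_span ⟨l, rfl⟩)
          (Submodule.smul_mem _ _ (hsub j (Ne.symm hij)))
      · exact hsub l hl
    · rw [hy]
      have : ∀ m, (Matrix.TransvectionStruct.toMatrix ⟨i, j, hij, residue R a⟩) l m =
          (1 : Matrix (Fin k) (Fin k) (ResidueField R)) l m +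
            if i = l ∧ j = m then residue R a else 0 := by
        intro m
        simp [Matrix.TransvectionStruct.toMatrix, Matrix.transvection, Matrix.single_apply]
      simp only [this, add_smul, Finset.sum_add_distrib, Matrix.one_apply, ite_smul, one_smul,
        zero_smul, Finset.sum_ite_eq, Finset.mem_univ, if_true]
      by_cases hl : l = i
      · subst hl
        simp only [true_and, Finset.sum_ite_eq, Finset.mem_univ, if_true, z, Function.update_self]
        rw [← cotClass_smul, cotClass, cotClass, cotClass, map_add]
      · simp [z, Function.update_of_ne hl, Ne.symm hl]
  · intro A B hA hB ihA ihB x y hx hy e he d hd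
    choose b hb using fun j l => residue_surjective (B j l)
    -- For a product A * B the intermediate tuple is a lift of B applied to x; then A takes it to y.
    let z : Fin k → maximalIdeal R := fun j => ∑ l, b j l • x l
    have hz : ∀ j, cotClass (z j) = ∑ l, B j l • cotClass (x l) := by
      intro j
      rw [cotClass, map_sum]
      refine Finset.sum_congr rfl fun l _ => ?_
      rw [← hb, ← cotClass_smul]
    obtain ⟨d1, hd1⟩ := residue_surjective (B.det⁻¹)
    obtain ⟨d2, hd2⟩ := residue_surjective (A.det⁻¹)
    have h1 := ihB x z hx hz e he d1 (by rw [hd1, inv_mul_cancel₀ hB])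
    have hspan : Submodule.span (ResidueField R) (Set.range fun j => cotClass (z j)) = ⊤ := by
      rw [← top_le_iff, ← hx, Submodule.span_le]
      rintro _ ⟨l, rfl⟩
      have : cotClass (x l) = ∑ j, B⁻¹ l j • cotClass (z j) := by
        simp only [hz, Finset.smul_sum, smul_smul]
        rw [Finset.sum_comm]
        simp only [← Finset.sum_smul, ← Matrix.mul_apply,
          Matrix.nonsing_inv_mul B (isUnit_iff_ne_zero.2 hB), Matrix.one_apply, ite_smul, one_smul,
          zero_smul, Finset.sum_ite_eq, Finset.mem_univ, if_true]
      change cotClass (x l) ∈ _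
      rw [this]
      exact sum_mem fun j _ => Submodule.smul_mem _ _ (Submodule.subset_span ⟨j, rfl⟩)
    have h2 := ihA z y hspan (fun j => ?_) (d1 • e) h1 d2 (by rw [hd2, inv_mul_cancel₀ hA])
    · rw [smul_smul] at h2
      rwa [Ext.smul_congr_of_maximalIdeal hN e (b := d2 * d1)]
      rw [map_mul, hd1, hd2]
      rw [Matrix.det_mul] at hd
      field_simp
      linear_combination hd
    · rw [hy]
      simp only [hz, Finset.smul_sum, smul_smul, Matrix.mul_apply, Finset.sum_smul]
      rw [Finset.sum_comm]

end KoszulDet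

/-! ### Ext groups computed along a regular sequence -/

section ExtVanishing

open Abelian RingTheory.Sequence IsLocalRing

variable {R : Type u} [CommRing R]

/-- Since r kills N', it acts as zero on every Ext(N', M), so the connecting map Ext^m(N', M') →
Ext^(m+1)(N', M) is onto. Its kernel comes from Ext^m(N', M), which vanishes for m below the length
of the sequence. Thus vanishing and the isomorphism Hom(N', N) ≅ Ext^n(N', M) climb by one degree
with each element. -/
theorem KoszulRep.ext_bijective {N : ModuleCat.{u} R} {rs : List R} (N' : ModuleCat.{u} R)
    (hN' : ∀ r ∈ rs, (r • 𝟙 N' : N' ⟶ N') = 0) {M : ModuleCat.{u} R} {π : M ⟶ N} {n : ℕ}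
    {x : Ext N M n} (h : KoszulRep M rs π n x) :
    (∀ m < n, ∀ y : Ext N' M m, y = 0) ∧
      Function.Bijective fun f : N' ⟶ N => (Ext.mk₀ f).comp x (zero_add n) := by
  induction rs generalizing M n with
  | nil =>
    obtain ⟨s, rfl, h1, h2, rfl⟩ := h
    refine ⟨fun m hm => absurd hm (by lia), ?_⟩
    have : (fun f : N' ⟶ N => (Ext.mk₀ f).comp ((Ext.mk₀ s).comp (Ext.mk₀ (𝟙 M)) (zero_add 0))
        (zero_add 0)) = fun f => Ext.mk₀ (f ≫ s) := by
      ext f; simp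
    rw [this]
    refine (Ext.mk₀_bijective N' M).comp ⟨fun f g hfg => ?_, fun g => ⟨g ≫ π, ?_⟩⟩
    · have := congrArg (· ≫ π) hfg
      simpa [h2] using this
    · simp [h1]
  | cons r rs ih =>
    obtain ⟨M', p, w, hS, π', m, rfl, e, he, rfl, rfl⟩ := h
    obtain ⟨v, b⟩ := ih (fun r hr => hN' r (by simp [hr])) he
    have hr : ∀ (k : ℕ) (y : Ext N' M k), y.comp (Ext.mk₀ (r • 𝟙 M)) (add_zero k) = 0 := by
      intro k y
      rw [← Ext.smul_eq_comp_mk₀]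
      have : r • y = (Ext.mk₀ (r • 𝟙 N')).comp y (zero_add k) := by simp [Ext.mk₀_smul]
      rw [this, hN' r (by simp), Ext.mk₀_zero, Ext.zero_comp]
    refine ⟨fun k hk y => ?_, ?_, ?_⟩
    · cases k with
      | zero =>
        obtain ⟨f, rfl⟩ := (Ext.mk₀_bijective N' M).2 y
        have h0 := hr 0 (Ext.mk₀ f)
        rw [Ext.mk₀_comp_mk₀, Ext.mk₀_eq_zero_iff] at h0
        have := hS.mono_f
        rw [Ext.mk₀_eq_zero_iff, ← cancel_mono (r • 𝟙 M), h0, zero_comp]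
      | succ k =>
        obtain ⟨z, rfl⟩ := Ext.covariant_sequence_exact₁ N' hS y (hr _ y) rfl
        rw [v k (by lia) z, Ext.zero_comp]
    · intro f g hfg
      dsimp only at hfg
      rw [← sub_eq_zero] at hfg
      have h2 : ((Ext.mk₀ (f - g)).comp e (zero_add m)).comp hS.extClass rfl = 0 := by
        rw [Ext.comp_assoc (a₂₃ := m + 1) _ _ _ _ rfl (by lia), sub_eq_add_neg, Ext.mk₀_add,
          Ext.add_comp, Ext.mk₀_neg, Ext.neg_comp, ← sub_eq_add_neg, hfg]
      obtain ⟨z, hz⟩ := Ext.covariant_sequence_exact₃ N' hS _ rfl h2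
      have hz0 : z.comp (Ext.mk₀ p) (add_zero m) = 0 := by
        cases m with
        | zero =>
          obtain ⟨t, rfl⟩ := (Ext.mk₀_bijective N' M).2 z
          have h0 := hr 0 (Ext.mk₀ t)
          rw [Ext.mk₀_comp_mk₀, Ext.mk₀_eq_zero_iff] at h0
          have := hS.mono_f
          have ht : t = 0 := by rw [← cancel_mono (r • 𝟙 M), h0, zero_comp]
          rw [ht, Ext.mk₀_zero, Ext.zero_comp]
        | succ k =>
          obtain ⟨z, rfl⟩ := Ext.covariant_sequence_exact₁ N' hS z (hr _ z) rfl
          rw [v k (by lia) z, Ext.zero_comp, Ext.zero_comp]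
      have h3 : (Ext.mk₀ (f - g)).comp e (zero_add m) = 0 := by
        rw [← hz]; exact hz0
      refine b.1 ?_
      dsimp only
      rw [← sub_eq_zero, ← h3, sub_eq_add_neg, sub_eq_add_neg, Ext.mk₀_add, Ext.add_comp,
        Ext.mk₀_neg, Ext.neg_comp]
    · intro y
      obtain ⟨z, rfl⟩ := Ext.covariant_sequence_exact₁ N' hS y (hr _ y) rfl
      obtain ⟨f, rfl⟩ := b.2 z
      refine ⟨f, ?_⟩
      dsimp only
      rw [Ext.comp_assoc]
      lia

/-- By the long exact sequence, dividing by one regular element raises the last nonzero degree of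
Ext(-, L) by at most one. -/
theorem KoszulRep.ext_eq_zero {N : ModuleCat.{u} R} {rs : List R} (L : ModuleCat.{u} R)
    {M : ModuleCat.{u} R} {π : M ⟶ N} {n : ℕ} {x : Ext N M n} (h : KoszulRep M rs π n x) {a : ℕ}
    (hM : ∀ j > a, ∀ y : Ext M L j, y = 0) : ∀ j > a + n, ∀ y : Ext N L j, y = 0 := by
  induction rs generalizing M n a with
  | nil =>
    obtain ⟨s, rfl, h1, h2, rfl⟩ := h
    intro j hj y
    have : y = (Ext.mk₀ s).comp ((Ext.mk₀ π).comp y (zero_add j)) (zero_add j) := by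
      rw [Ext.mk₀_comp_mk₀_assoc, h2, Ext.mk₀_id_comp]
    have h0 := hM j (by lia) ((Ext.mk₀ π).comp y (zero_add j))
    rw [this, h0, Ext.comp_zero]
  | cons r rs ih =>
    obtain ⟨M', p, w, hS, π', m, rfl, e, he, rfl, rfl⟩ := h
    have := ih he (a := a + 1) (fun j hj y => ?_)
    · intro j hj y
      exact this j (by lia) y
    · obtain ⟨z, rfl⟩ := Ext.contravariant_sequence_exact₃ hS L y (hM j (by lia) _)
        (n₀ := j - 1) (by lia)
      have hz := hM (j - 1) (by lia) z
      subst hz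
      rw [Ext.comp_zero]

variable [IsLocalRing R]

/-- Dévissage: a vanishing statement for `Ext(-, L)` on the residue field holds on all modules of
finite length. -/
theorem ext_eq_zero_of_isFiniteLength (L : ModuleCat.{u} R) (n : ℕ)
    (h : ∀ y : Ext (residueObj R).obj L n, y = 0) (M : Type u) [AddCommGroup M] [Module R M]
    (hM : IsFiniteLength R M) (y : Ext (ModuleCat.of R M) L n) : y = 0 := by
  induction hM with
  | @of_subsingleton M _ _ _ =>
    have h0 : (𝟙 (ModuleCat.of R M)) = 0 := by ext m; exact Subsingleton.elim _ _
    rw [← Ext.mk₀_id_comp y, h0, Ext.mk₀_zero, Ext.zero_comp]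
  | @of_simple_quotient M _ _ S hS hfin ih =>
    have hex : (ShortComplex.mk (ModuleCat.ofHom S.subtype) (ModuleCat.ofHom S.mkQ)
        (by ext m; simp)).ShortExact := by
      refine ModuleCat.shortExact_of_elements _ _ _ (fun a ha => Subtype.ext ha) (fun b hb => ?_)
        (Submodule.mkQ_surjective S)
      exact ⟨⟨b, (Submodule.Quotient.mk_eq_zero S).1 hb⟩, rfl⟩
    obtain ⟨z, rfl⟩ := Ext.contravariant_sequence_exact₂ hex L y (ih _)
    obtain ⟨I, hI, ⟨φ⟩⟩ := isSimpleModule_iff_quot_maximal.1 hS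
    obtain rfl := eq_maximalIdeal hI
    let θ : ModuleCat.of R (M ⧸ S) ≅ (residueObj R).obj :=
      LinearEquiv.toModuleIso (X₂ := ResidueField R) φ
    have : z = (Ext.mk₀ θ.hom).comp ((Ext.mk₀ θ.inv).comp z (zero_add n)) (zero_add n) := by
      rw [Ext.mk₀_comp_mk₀_assoc, Iso.hom_inv_id, Ext.mk₀_id_comp]
    have h0 := h ((Ext.mk₀ θ.inv).comp z (zero_add n))
    rw [this, h0, Ext.comp_zero, Ext.comp_zero]

end ExtVanishing

/-! ### The isomorphism between the determinant line and Ext^i(κ, R) -/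

section KoszulIso

open Abelian RingTheory.Sequence IsLocalRing

section Quot

variable {R : Type u} [CommRing R]

theorem Ideal.ofList_ofFn {k : ℕ} (x : Fin k → R) :
    Ideal.ofList (List.ofFn x) = Ideal.span (Set.range x) := by
  rw [Ideal.ofList]
  congr 1
  ext
  simp [List.mem_ofFn]

theorem koszulProj_surjective (M : ModuleCat.{u} R) (rs : List R) :
    Function.Surjective (koszulProj M rs).hom := by
  induction rs generalizing M with
  | nil => exact fun m => ⟨m, rfl⟩
  | cons r rs ih => exact (ih _).comp (Submodule.mkQ_surjective _)

open scoped Pointwise in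
theorem koszulProj_eq_zero_iff (M : ModuleCat.{u} R) (rs : List R) (m : M) :
    (koszulProj M rs).hom m = 0 ↔ m ∈ Ideal.ofList rs • (⊤ : Submodule R M) := by
  induction rs generalizing M with
  | nil =>
    rw [Ideal.ofList_nil, Submodule.bot_smul, Submodule.mem_bot]
    rfl
  | cons r rs ih =>
    have h1 : (koszulProj M (r :: rs)).hom m = 0 ↔
        (koszulProj (M.smulShortComplex r).X₃ rs).hom ((r • (⊤ : Submodule R M)).mkQ m) = 0 :=
      Iff.rfl
    have h2 : Ideal.ofList rs • (⊤ : Submodule R (QuotSMulTop r M)) =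
        (Ideal.ofList rs • (⊤ : Submodule R M)).map (r • (⊤ : Submodule R M)).mkQ := by
      rw [Submodule.map_smul'', Submodule.map_top, Submodule.range_mkQ]
    refine h1.trans ((ih (M.smulShortComplex r).X₃ _).trans ?_)
    change (r • (⊤ : Submodule R M)).mkQ m ∈
      Ideal.ofList rs • (⊤ : Submodule R (QuotSMulTop r M)) ↔ _
    rw [h2, ← Submodule.mem_comap, Submodule.comap_map_mkQ, Ideal.ofList_cons_smul]

/-- Passage between the relation `KoszulRep`, which permits any model of the quotients, and the
chosen class `koszulClass`. -/
theorem koszulRep_iff {N M : ModuleCat.{u} R} {rs : List R} (h : IsWeaklyRegular M rs) {π : M ⟶ N}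
    (θ : koszulQuot M rs ≅ N) (hθ : koszulProj M rs ≫ θ.hom = π) {n : ℕ} (hn : 0 + n = rs.length)
    (e : Ext N M n) :
    KoszulRep M rs π n e ↔ (Ext.mk₀ θ.hom).comp e hn = koszulClass M rs h := by
  obtain rfl : n = rs.length := by lia
  have h1 := (KoszulRep.of_koszulClass M rs h).postcomp θ
  rw [hθ] at h1
  constructor
  · intro he
    rw [he.unique h1, Ext.mk₀_comp_mk₀_assoc, Iso.hom_inv_id, Ext.mk₀_id_comp]
  · intro he
    rw [← he, Ext.mk₀_comp_mk₀_assoc, Iso.inv_hom_id, Ext.mk₀_id_comp] at h1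
    exact h1

end Quot

variable (R : Type u) [CommRing R] [IsLocalRing R]

/-- The projection from `R` onto its residue field. -/
def residueProj : ModuleCat.of R R ⟶ (residueObj R).obj :=
  ModuleCat.ofHom (Algebra.linearMap R (ResidueField R))

variable {R}

theorem exists_koszulQuot_iso (rs : List R) (h : Ideal.ofList rs = maximalIdeal R) :
    ∃ θ : koszulQuot (ModuleCat.of R R) rs ≅ (residueObj R).obj,
      koszulProj (ModuleCat.of R R) rs ≫ θ.hom = residueProj R := by
  have hk : LinearMap.ker (koszulProj (ModuleCat.of R R) rs).hom = maximalIdeal R := by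
    ext r
    rw [LinearMap.mem_ker, koszulProj_eq_zero_iff, h, smul_eq_mul, Ideal.mul_top]
  let e : koszulQuot (ModuleCat.of R R) rs ≃ₗ[R] ResidueField R :=
    ((koszulProj (ModuleCat.of R R) rs).hom.quotKerEquivOfSurjective
      (koszulProj_surjective _ _)).symm ≪≫ₗ Submodule.quotEquivOfEq _ _ hk
  refine ⟨e.toModuleIso (X₂ := ResidueField R), ?_⟩
  ext
  change e ((koszulProj (ModuleCat.of R R) rs).hom 1) = 1
  have : ((koszulProj (ModuleCat.of R R) rs).hom.quotKerEquivOfSurjective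
      (koszulProj_surjective _ _)).symm ((koszulProj (ModuleCat.of R R) rs).hom 1) =
      Submodule.Quotient.mk (1 : R) := by
    rw [LinearEquiv.symm_apply_eq]; rfl
  exact congrArg (Submodule.quotEquivOfEq _ _ hk) this

theorem residueObj_smul_eq_zero (r : R) (hr : r ∈ maximalIdeal R) :
    (r • 𝟙 (residueObj R).obj : (residueObj R).obj ⟶ (residueObj R).obj) = 0 := by
  refine ModuleCat.hom_ext (LinearMap.ext fun (x : ResidueField R) => ?_)
  change r • x = 0
  rw [Algebra.smul_def, ResidueField.algebraMap_eq, (residue_eq_zero_iff r).2 hr, zero_mul]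

theorem residueObj_end_eq_smul (f : (residueObj R).obj ⟶ (residueObj R).obj) :
    ∃ r : R, f = r • 𝟙 _ := by
  obtain ⟨r, hr⟩ := residue_surjective (R := R) (f.hom (1 : ResidueField R))
  refine ⟨r, ModuleCat.hom_ext (LinearMap.ext fun (x : ResidueField R) => ?_)⟩
  obtain ⟨s, rfl⟩ := residue_surjective x
  have h1 : residue R s = s • (1 : ResidueField R) := by
    rw [Algebra.smul_def, mul_one]; rfl
  have h2 : f.hom (s • (1 : ResidueField R)) = s • f.hom (1 : ResidueField R) := map_smul f.hom s _
  rw [h1, h2, ← hr]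
  change s • residue R r = r • s • (1 : ResidueField R)
  simp only [Algebra.smul_def, mul_one, ResidueField.algebraMap_eq]
  exact mul_comm _ _

variable {i : ℕ}

/-- `ext_bijective` with N' = κ gives Ext^i(κ, R) = End(κ) · e, and endomorphisms of κ are
homotheties. -/
theorem KoszulRep.smul_surjective {rs : List R} (hrs : ∀ r ∈ rs, r ∈ maximalIdeal R)
    {e : Ext (residueObj R).obj (ModuleCat.of R R) i}
    (he : KoszulRep (ModuleCat.of R R) rs (residueProj R) i e)
    (y : Ext (residueObj R).obj (ModuleCat.of R R) i) : ∃ r : R, r • e = y := by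
  obtain ⟨f, hf⟩ := (he.ext_bijective (residueObj R).obj
    (fun r hr => residueObj_smul_eq_zero r (hrs r hr))).2.2 y
  obtain ⟨r, rfl⟩ := residueObj_end_eq_smul f
  refine ⟨r, ?_⟩
  rw [← hf]
  simp [Ext.mk₀_smul]

theorem KoszulRep.smul_eq_zero_iff {rs : List R} (hrs : ∀ r ∈ rs, r ∈ maximalIdeal R)
    {e : Ext (residueObj R).obj (ModuleCat.of R R) i}
    (he : KoszulRep (ModuleCat.of R R) rs (residueProj R) i e) (r : R) :
    r • e = 0 ↔ r ∈ maximalIdeal R := by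
  have h0 : r • e = (Ext.mk₀ (r • 𝟙 (residueObj R).obj)).comp e (zero_add i) := by
    simp [Ext.mk₀_smul]
  constructor
  · intro h
    have h1 : r • 𝟙 (residueObj R).obj = 0 := by
      refine (he.ext_bijective (residueObj R).obj
        (fun r hr => residueObj_smul_eq_zero r (hrs r hr))).2.1 ?_
      dsimp only
      rw [← h0, h, Ext.mk₀_zero, Ext.zero_comp]
    have h2 : r • (1 : ResidueField R) = 0 :=
      congrArg (fun f : (residueObj R).obj ⟶ (residueObj R).obj => f.hom (1 : ResidueField R)) h1
    rw [Algebra.smul_def, mul_one] at h2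
    exact (residue_eq_zero_iff r).1 h2
  · intro h
    rw [h0, residueObj_smul_eq_zero r h, Ext.mk₀_zero, Ext.zero_comp]

variable [IsNoetherianRing R]

theorem exists_koszulRep (hdim : ringKrullDim R = i) {k : ℕ} (hk : k = i)
    (x : Fin k → maximalIdeal R) (hx : Ideal.span (Set.range fun j => (x j : R)) = maximalIdeal R) :
    ∃ e : Ext (residueObj R).obj (ModuleCat.of R R) i,
      KoszulRep (ModuleCat.of R R) (List.ofFn fun j => (x j : R)) (residueProj R) i e := by
  subst hk
  have hl : Ideal.ofList (List.ofFn fun j => (x j : R)) = maximalIdeal R :=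
    (Ideal.ofList_ofFn _).trans hx
  have hw : IsWeaklyRegular (ModuleCat.of R R) (List.ofFn fun j => (x j : R)) :=
    isWeaklyRegular_of_ofList_eq k R _ hl (by simp) hdim
  obtain ⟨θ, hθ⟩ := exists_koszulQuot_iso _ hl
  have h1 := (KoszulRep.of_koszulClass _ _ hw).postcomp θ
  rw [hθ] at h1
  have h2 : ∀ n (_ : (List.ofFn fun j => (x j : R)).length = n),
      ∃ e : Ext (residueObj R).obj (ModuleCat.of R R) n,
      KoszulRep (ModuleCat.of R R) (List.ofFn fun j => (x j : R)) (residueProj R) n e := by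
    rintro _ rfl
    exact ⟨_, h1⟩
  exact h2 k (by simp)

theorem exists_generators (R : Type u) [CommRing R] [IsLocalRing R] [IsNoetherianRing R] :
    ∃ x : Fin (Module.finrank (ResidueField R) (CotangentSpace R)) → maximalIdeal R,
      Ideal.span (Set.range fun j => (x j : R)) = maximalIdeal R := by
  let b := Module.finBasis (ResidueField R) (CotangentSpace R)
  choose x hx using fun j => (maximalIdeal R).toCotangent_surjective (b j)
  refine ⟨x, (span_range_eq_iff x).2 ?_⟩
  simp_rw [hx]
  exact b.span_eq

theorem isKoszulIso_iff
    (hd : Module.finrank (ResidueField R) (CotangentSpace R) = i)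
    (c : (conormalTwist R).line ≃+ Ext (residueObj R).obj (ModuleCat.of R R) i) :
    IsKoszulIso hd c ↔
      (∀ (r : R) (l : (conormalTwist R).line), c (residue R r • l) = r • c l) ∧
      ∀ x : Fin (Module.finrank (ResidueField R) (CotangentSpace R)) → maximalIdeal R,
        Ideal.span (Set.range fun j => (x j : R)) = maximalIdeal R →
        ∀ l : Module.Dual (ResidueField R)
          (⋀[ResidueField R]^(Module.finrank (ResidueField R) (CotangentSpace R))
            (CotangentSpace R)),
        l (exteriorPower.ιMulti (ResidueField R) _ fun j => cotClass (x j)) = 1 →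
        KoszulRep (ModuleCat.of R R) (List.ofFn fun j => (x j : R)) (residueProj R) i (c l) := by
  refine and_congr_right fun _ => forall₄_congr fun x hx l hl => ?_
  constructor
  · rintro ⟨h, θ, hθ, hc⟩
    exact (koszulRep_iff h θ hθ _ _).2 hc
  · intro h
    have hl : Ideal.ofList (List.ofFn fun j => (x j : R)) = maximalIdeal R :=
      (Ideal.ofList_ofFn _).trans hx
    obtain ⟨θ, hθ⟩ := exists_koszulQuot_iso _ hl
    exact ⟨h.isWeaklyRegular, θ, hθ, (koszulRep_iff h.isWeaklyRegular θ hθ _ _).1 h⟩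

/-- For generators `x` of the maximal ideal, the class `e` of their Koszul resolution and a
linear form `l` with value `s` on the wedge of the classes of `x`, the class `s • e` represents the
Koszul resolution of every other system of generators on whose wedge `l` has value `1`. -/
theorem KoszulRep.smul_of_ιMulti {k : ℕ}
    {x y : Fin k → maximalIdeal R}
    (b : Module.Basis (Fin k) (ResidueField R) (CotangentSpace R)) (hb : ∀ j, b j = cotClass (x j))
    {e : Ext (residueObj R).obj (ModuleCat.of R R) i}
    (he : KoszulRep (ModuleCat.of R R) (List.ofFn fun j => (x j : R)) (residueProj R) i e)
    (l : Module.Dual (ResidueField R) (⋀[ResidueField R]^k (CotangentSpace R)))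
    (hl : l (exteriorPower.ιMulti (ResidueField R) k fun j => cotClass (y j)) = 1)
    {s : R} (hs : residue R s = l (exteriorPower.ιMulti (ResidueField R) k b)) :
    KoszulRep (ModuleCat.of R R) (List.ofFn fun j => (y j : R)) (residueProj R) i (s • e) := by
  have h1 := congrArg (fun f => f fun j => cotClass (y j))
    ((l.compAlternatingMap (exteriorPower.ιMulti (ResidueField R) k)).eq_smul_basis_det b)
  have h2 : (1 : ResidueField R) = l (exteriorPower.ιMulti (ResidueField R) k b) *
      (b.toMatrix fun j => cotClass (y j)).det := by
    rw [← hl]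
    exact h1
  rw [← hs, ← Matrix.det_transpose] at h2
  have h3 : Submodule.span (ResidueField R)
      (Set.range fun j => cotClass (x j)) = ⊤ := by
    simp_rw [← hb]
    exact b.span_eq
  refine KoszulRep.det_smul residueObj_smul_eq_zero _ ?_ x y h3 ?_ e he s h2.symm
  · intro h0
    rw [h0, mul_zero] at h2
    exact one_ne_zero h2
  · intro j
    simp_rw [← hb]
    exact (b.sum_repr (cotClass (y j))).symm

theorem exists_isKoszulIso (hdim : ringKrullDim R = i)
    (hd : Module.finrank (ResidueField R) (CotangentSpace R) = i) :
    ∃ c : (conormalTwist R).line ≃+ Ext (residueObj R).obj (ModuleCat.of R R) i,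
      IsKoszulIso hd c := by
  obtain ⟨x, hx⟩ := exists_generators R
  obtain ⟨e, he⟩ := exists_koszulRep hdim hd x hx
  have hmem : ∀ r ∈ List.ofFn fun j => (x j : R), r ∈ maximalIdeal R := by
    intro r hr
    obtain ⟨j, rfl⟩ := (List.mem_ofFn' _ _).1 hr
    exact (x j).2
  let b : Module.Basis _ (ResidueField R) (CotangentSpace R) :=
    basisOfTopLeSpanOfCardEqFinrank (fun j => cotClass (x j)) ((span_range_eq_iff x).1 hx).ge
      (by simp)
  have hb : ∀ j, b j = cotClass (x j) := fun j => by
    simp [b]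
  let v := exteriorPower.ιMulti (ResidueField R) _ b
  -- With v the wedge of the chosen generators and e their Koszul class, c is l ↦ l(v) e. The
  -- condition for other generators is the determinant rule.
  let g : R →ₗ[R] Ext (residueObj R).obj (ModuleCat.of R R) i := LinearMap.toSpanSingleton R _ e
  let g' : ResidueField R →ₗ[R] Ext (residueObj R).obj (ModuleCat.of R R) i :=
    Submodule.liftQ (maximalIdeal R) g fun r hr => (he.smul_eq_zero_iff hmem r).2 hr
  have hg' : ∀ r, g' (residue R r) = r • e := fun r => rfl
  have hg0 : ∀ t, g' t = 0 → t = 0 := by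
    intro t
    obtain ⟨r, rfl⟩ := residue_surjective t
    rw [hg', he.smul_eq_zero_iff hmem, residue_eq_zero_iff]
    exact id
  let w : (conormalTwist R).line →+ ResidueField R :=
    { toFun := fun l : Module.Dual (ResidueField R) _ => l v
      map_zero' := rfl
      map_add' := fun _ _ => rfl }
  have hext : ∀ l₁ l₂ : Module.Dual (ResidueField R) (⋀[ResidueField R]^_ (CotangentSpace R)),
      l₁ v = l₂ v → l₁ = l₂ := by
    intro l₁ l₂ h
    refine exteriorPower.linearMap_ext ?_
    rw [(l₁.compAlternatingMap (exteriorPower.ιMulti (ResidueField R) _)).eq_smul_basis_det b,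
      (l₂.compAlternatingMap (exteriorPower.ιMulti (ResidueField R) _)).eq_smul_basis_det b]
    exact congrArg (· • b.det) h
  have hbij : Function.Bijective (g'.toAddMonoidHom.comp w) := by
    constructor
    · intro l₁ l₂ h
      refine hext l₁ l₂ ?_
      have h : g' (w l₁) = g' (w l₂) := h
      rw [← sub_eq_zero, ← map_sub] at h
      exact sub_eq_zero.1 (hg0 _ h)
    · intro y
      obtain ⟨r, hr⟩ := he.smul_surjective hmem y
      refine ⟨exteriorPower.alternatingMapLinearEquiv (residue R r • b.det), ?_⟩
      have : exteriorPower.alternatingMapLinearEquiv (residue R r • b.det) v = residue R r := by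
        rw [exteriorPower.alternatingMapLinearEquiv_apply_ιMulti,
          AlternatingMap.smul_apply, b.det_self, smul_eq_mul, mul_one]
      exact (congrArg g' this).trans hr
  refine ⟨AddEquiv.ofBijective _ hbij, (isKoszulIso_iff hd _).2 ⟨?_, ?_⟩⟩
  · intro r l
    change g' (residue R r * w l) = r • g' (w l)
    rw [← map_smul, Algebra.smul_def]
    rfl
  · intro y hy l hl
    obtain ⟨s, hs⟩ := residue_surjective (R := R) (l v)
    have := he.smul_of_ιMulti b hb l hl hs
    rw [← hg', hs] at this
    exact this

theorem existsUnique_isKoszulIso (hdim : ringKrullDim R = i)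
    (hd : Module.finrank (ResidueField R) (CotangentSpace R) = i) :
    ∃! c : (conormalTwist R).line ≃+ Ext (residueObj R).obj (ModuleCat.of R R) i,
      IsKoszulIso hd c := by
  obtain ⟨c, hc⟩ := exists_isKoszulIso hdim hd
  refine ⟨c, hc, fun c' hc' => ?_⟩
  obtain ⟨x, hx⟩ := exists_generators R
  rw [isKoszulIso_iff] at hc hc'
  let b : Module.Basis _ (ResidueField R) (CotangentSpace R) :=
    basisOfTopLeSpanOfCardEqFinrank (fun j => cotClass (x j)) ((span_range_eq_iff x).1 hx).ge
      (by simp)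
  have hb : ⇑b = fun j => cotClass (x j) := by simp [b]
  -- The dual of the wedge of one system of generators is a basis of the line, and its image is
  -- prescribed; linearity does the rest.
  let l₀ : (conormalTwist R).line := exteriorPower.alternatingMapLinearEquiv b.det
  have hl₀ : (show Module.Dual (ResidueField R) (⋀[ResidueField R]^_ (CotangentSpace R)) from l₀)
      (exteriorPower.ιMulti (ResidueField R) _ fun j => cotClass (x j)) = 1 := by
    rw [← hb]
    refine (exteriorPower.alternatingMapLinearEquiv_apply_ιMulti _ _).trans b.det_self
  have h0 : c' l₀ = c l₀ := (hc'.2 x hx l₀ hl₀).unique (hc.2 x hx l₀ hl₀)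
  have hne : l₀ ≠ 0 := by
    rintro h
    rw [h] at hl₀
    exact zero_ne_one hl₀
  ext l
  obtain ⟨t, ht⟩ := exists_smul_eq_of_finrank_eq_one (conormalTwist R).finrank_eq_one hne l
  obtain ⟨r, rfl⟩ := residue_surjective t
  rw [← ht, hc.1, hc'.1, h0]

end KoszulIso

/-! ### Evaluation of Ext classes in local cohomology -/

section ExtEval

open Abelian IsLocalRing

section Pull

variable {R : Type u} [CommRing R] {M N P : ModuleCat.{u} R} (i : ℕ)

/-- The map `Ext^i(N, R) → Ext^i(M, R)` induced by `f : M ⟶ N`. -/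
def extPull (f : M ⟶ N) :
    Ext N (ModuleCat.of R R) i →ₗ[R] Ext M (ModuleCat.of R R) i :=
  (Ext.mk₀ f).precompOfLinear R (ModuleCat.of R R) (zero_add i)

variable {i}

theorem extPull_apply (f : M ⟶ N) (e : Ext N (ModuleCat.of R R) i) :
    extPull i f e = (Ext.mk₀ f).comp e (zero_add i) := rfl

theorem extPull_extPull (f : M ⟶ N) (g : N ⟶ P) (e : Ext P (ModuleCat.of R R) i) :
    extPull i f (extPull i g e) = extPull i (f ≫ g) e :=
  Ext.mk₀_comp_mk₀_assoc f g e

theorem extPull_id (e : Ext M (ModuleCat.of R R) i) : extPull i (𝟙 M) e = e :=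
  Ext.mk₀_id_comp e

theorem extPull_add (f g : M ⟶ N) (e : Ext N (ModuleCat.of R R) i) :
    extPull i (f + g) e = extPull i f e + extPull i g e := by
  simp only [extPull_apply, Ext.mk₀_add, Ext.add_comp]

theorem extPull_smul (r : R) (f : M ⟶ N) (e : Ext N (ModuleCat.of R R) i) :
    extPull i (r • f) e = r • extPull i f e := by
  simp only [extPull_apply, Ext.mk₀_smul, Ext.smul_comp]

theorem extPull_zero (e : Ext N (ModuleCat.of R R) i) : extPull i (0 : M ⟶ N) e = 0 := by
  simp only [extPull_apply, Ext.mk₀_zero, Ext.zero_comp]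

/-- The map `R ⧸ I ⟶ M` with `1 ↦ m`, for an element `m` killed by `I`. -/
def elementMap (I : Ideal R) (m : M) (h : ∀ r ∈ I, r • m = 0) : ModuleCat.of R (R ⧸ I) ⟶ M :=
  ModuleCat.ofHom (Submodule.liftQ I (LinearMap.toSpanSingleton R M m) h)

theorem elementMap_mk (I : Ideal R) (m : M) (h : ∀ r ∈ I, r • m = 0) (r : R) :
    (elementMap I m h).hom (Ideal.Quotient.mk I r) = r • m := rfl

theorem elementMap_one (I : Ideal R) (m : M) (h : ∀ r ∈ I, r • m = 0) :
    (elementMap I m h).hom (1 : R ⧸ I) = m := one_smul R m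

theorem quotient_hom_ext {I : Ideal R} {f g : ModuleCat.of R (R ⧸ I) ⟶ M}
    (h : f.hom (1 : R ⧸ I) = g.hom (1 : R ⧸ I)) : f = g := by
  refine ModuleCat.hom_ext (LinearMap.ext fun (x : R ⧸ I) => ?_)
  obtain ⟨r, rfl⟩ := Ideal.Quotient.mk_surjective x
  have : Ideal.Quotient.mk I r = r • (1 : R ⧸ I) := by
    rw [Algebra.smul_def, mul_one]; rfl
  rw [this]
  exact (map_smul f.hom r (1 : R ⧸ I)).trans ((congrArg (r • ·) h).trans
    (map_smul g.hom r (1 : R ⧸ I)).symm)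

theorem quotient_smul_one_eq_zero {I J : Ideal R} (h : I ≤ J) (r : R) (hr : r ∈ I) :
    r • (1 : R ⧸ J) = 0 := by
  rw [Algebra.smul_def, mul_one]
  exact Ideal.Quotient.eq_zero_iff_mem.2 (h hr)

/-- The projection `R ⧸ I ⟶ R ⧸ J`. -/
def quotientMap {I J : Ideal R} (h : I ≤ J) : ModuleCat.of R (R ⧸ I) ⟶ ModuleCat.of R (R ⧸ J) :=
  elementMap (M := ModuleCat.of R (R ⧸ J)) I (1 : R ⧸ J) (quotient_smul_one_eq_zero h)

theorem quotientMap_comp_elementMap {I J : Ideal R} (hIJ : I ≤ J) (m : M)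
    (h : ∀ r ∈ J, r • m = 0) :
    quotientMap hIJ ≫ elementMap J m h = elementMap I m fun r hr => h r (hIJ hr) := by
  refine quotient_hom_ext ?_
  have h1 : (quotientMap hIJ).hom (1 : R ⧸ I) = (1 : R ⧸ J) := elementMap_one _ _ _
  exact (congrArg (elementMap J m h).hom h1).trans
    ((elementMap_one J m h).trans (elementMap_one I m _).symm)

theorem elementMap_comp {I : Ideal R} (m : M) (h : ∀ r ∈ I, r • m = 0) (f : M ⟶ N) :
    elementMap I m h ≫ f = elementMap I (f.hom m) fun r hr => by
      rw [← map_smul, h r hr, map_zero] :=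
  quotient_hom_ext ((congrArg f.hom (elementMap_one I m h)).trans (elementMap_one I _ _).symm)

theorem exists_extPull_eq (f : M ⟶ N) (g : N ⟶ P)
    (w : f ≫ g = 0) (hf : Function.Injective f.hom) (hg : Function.Surjective g.hom)
    (hfg : ∀ b, g.hom b = 0 → ∃ a, f.hom a = b) (e : Ext N (ModuleCat.of R R) i)
    (he : extPull i f e = 0) : ∃ e', extPull i g e' = e :=
  Ext.contravariant_sequence_exact₂
    (ModuleCat.shortExact_of_elements f g w ((injective_iff_map_eq_zero _).1 hf) hfg hg) _ e he

end Pull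

variable (R : Type u) [CommRing R] [IsLocalRing R] (i : ℕ)

/-- `Ext^j(M, R) = 0` for `M` of finite length and `j ≠ i`, and `Ext^i(κ, R)` is one-dimensional:
the ring is Gorenstein of dimension `i`. -/
class HasExtDuality : Prop where
  ext_eq_zero (M : ModuleCat.{u} R) (hM : IsFiniteLength R M) (j : ℕ) (hj : j ≠ i)
    (y : Ext M (ModuleCat.of R R) j) : y = 0
  exists_generator : ∃ k : Ext (residueObj R).obj (ModuleCat.of R R) i,
    (∀ y, ∃ r : R, r • k = y) ∧ ∀ r : R, r • k = 0 ↔ r ∈ maximalIdeal R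

variable {R i}

/-- By dévissage the vanishing need only be checked on κ. In degrees below i it is `ext_bijective`.
Above i it holds because κ arises from the projective module R by i successive quotients by regular
elements. -/
theorem HasExtDuality.of_finrank_eq [IsNoetherianRing R] (hdim : ringKrullDim R = i)
    (hd : Module.finrank (ResidueField R) (CotangentSpace R) = i) : HasExtDuality R i := by
  obtain ⟨x, hx⟩ := exists_generators R
  obtain ⟨e, he⟩ := exists_koszulRep hdim hd x hx
  have hmem : ∀ r ∈ List.ofFn fun j => (x j : R), r ∈ maximalIdeal R := by
    intro r hr
    obtain ⟨j, rfl⟩ := (List.mem_ofFn' _ _).1 hr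
    exact (x j).2
  refine ⟨fun M hM j hj => ?_, e, he.smul_surjective hmem, he.smul_eq_zero_iff hmem⟩
  refine ext_eq_zero_of_isFiniteLength _ _ ?_ M hM
  rcases hj.lt_or_gt with hj | hj
  · exact (he.ext_bijective _ fun r hr => residueObj_smul_eq_zero r (hmem r hr)).1 j hj
  · have : Projective (ModuleCat.of R R) :=
      ModuleCat.projective_of_free (Module.Basis.singleton Unit R)
    refine he.ext_eq_zero _ (a := 0) ?_ j (by lia)
    intro j hj y
    obtain ⟨j, rfl⟩ := Nat.exists_eq_succ_of_ne_zero hj.ne'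
    exact y.eq_zero_of_projective

/-- Each simple subquotient is killed by 𝔪, so each step of a composition series costs one power. -/
theorem exists_pow_smul_eq_zero {M : Type u} [AddCommGroup M] [Module R M]
    (hM : IsFiniteLength R M) : ∃ n, ∀ r ∈ maximalIdeal R ^ n, ∀ x : M, r • x = 0 := by
  induction hM with
  | of_subsingleton => exact ⟨0, fun r _ x => Subsingleton.elim _ _⟩
  | @of_simple_quotient M _ _ S hS hfin ih =>
    obtain ⟨n, hn⟩ := ih
    obtain ⟨I, hI, ⟨φ⟩⟩ := isSimpleModule_iff_quot_maximal.1 hS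
    obtain rfl := eq_maximalIdeal hI
    refine ⟨n + 1, fun r hr x => ?_⟩
    rw [pow_succ] at hr
    induction hr using Submodule.mul_induction_on' with
    | mem_mul_mem a ha b hb =>
      have h1 : b • x ∈ S := by
        rw [← Submodule.Quotient.mk_eq_zero, Submodule.Quotient.mk_smul, ← φ.map_eq_zero_iff,
          map_smul]
        obtain ⟨c, hc⟩ := Ideal.Quotient.mk_surjective (φ (Submodule.Quotient.mk x))
        rw [← hc, Algebra.smul_def, Ideal.Quotient.algebraMap_eq, ← map_mul,
          Ideal.Quotient.eq_zero_iff_mem]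
        exact Ideal.mul_mem_right _ _ hb
      rw [mul_smul]
      exact congrArg Subtype.val (hn a ha ⟨_, h1⟩)
    | add a _ b _ ha hb => rw [add_smul, ha, hb, add_zero]

section

variable [hR : HasExtDuality R i]

theorem extPull_injective {M N : ModuleCat.{u} R} (hM : IsFiniteLength R M) (f : M ⟶ N)
    (hf : Function.Surjective f.hom) : Function.Injective (extPull i f) := by
  -- In degree 0 this is left exactness of Hom; in positive degree the obstruction is in Ext^(i-1)
  -- of the kernel, which vanishes.
  rcases Nat.eq_zero_or_pos i with rfl | hi
  · have : Epi f := (ModuleCat.epi_iff_surjective f).2 hf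
    exact Ext.precomp_mk₀_injective_of_epi _ f
  · refine (injective_iff_map_eq_zero _).2 fun e he => ?_
    have hex : (ShortComplex.mk (ModuleCat.ofHom (LinearMap.ker f.hom).subtype) f
        (by ext m; exact m.2)).ShortExact :=
      ModuleCat.shortExact_of_elements _ _ _ (fun a ha => Subtype.ext ha)
        (fun b hb => ⟨⟨b, hb⟩, rfl⟩) hf
    obtain ⟨z, rfl⟩ := Ext.contravariant_sequence_exact₃ hex _ e he (n₀ := i - 1) (by lia)
    have := hR.ext_eq_zero _ (hM.of_injective (Submodule.subtype_injective _)) (i - 1) (by lia) z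
    subst this
    rw [Ext.comp_zero]

/-- The obstruction to lifting lies in Ext^(i+1) of the cokernel, which vanishes. -/
theorem extPull_surjective {M N : ModuleCat.{u} R} (hN : IsFiniteLength R N) (f : M ⟶ N)
    (hf : Function.Injective f.hom) : Function.Surjective (extPull i f) := by
  have hex : (ShortComplex.mk f (ModuleCat.ofHom (LinearMap.range f.hom).mkQ)
      (by ext m; simp)).ShortExact :=
    ModuleCat.shortExact_of_elements _ _ _ ((injective_iff_map_eq_zero _).1 hf)
      (fun b hb => (Submodule.Quotient.mk_eq_zero _).1 hb) (Submodule.mkQ_surjective _)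
  intro e
  exact Ext.contravariant_sequence_exact₁ hex _ e rfl
    (hR.ext_eq_zero _ (hN.of_surjective (Submodule.mkQ_surjective _)) _ (by lia) _)

end

theorem isFiniteLength_quotient_pow [IsNoetherianRing R] (n : ℕ) :
    IsFiniteLength R (R ⧸ maximalIdeal R ^ n) := by
  rw [isFiniteLength_iff_isNoetherian_isArtinian]
  refine ⟨inferInstance, ?_⟩
  rcases Nat.eq_zero_or_pos n with rfl | hn
  · have : Subsingleton (R ⧸ maximalIdeal R ^ 0) := by
      rw [pow_zero, Ideal.one_eq_top]
      exact Ideal.Quotient.subsingleton_iff.2 rfl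
    infer_instance
  · have : IsArtinianRing (R ⧸ maximalIdeal R ^ n) :=
      quotient_artinian_of_mem_minimalPrimes_of_isLocalRing _
        ⟨⟨(maximalIdeal.isMaximal R).isPrime, Ideal.pow_le_self hn.ne'⟩,
          fun J hJ _ => hJ.1.le_of_pow_le hJ.2⟩
    exact isArtinian_of_surjective_algebraMap
      (Ideal.Quotient.mk_surjective (I := maximalIdeal R ^ n))

variable (R i) in
/-- The transition maps of the system `Ext^i(R ⧸ 𝔪^n, R)`. -/
def extTransition (a b : ℕ) (h : a ≤ b) :
    Ext (ModuleCat.of R (R ⧸ maximalIdeal R ^ a)) (ModuleCat.of R R) i →ₗ[R]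
      Ext (ModuleCat.of R (R ⧸ maximalIdeal R ^ b)) (ModuleCat.of R R) i :=
  extPull i (quotientMap (Ideal.pow_le_pow_right h))

instance : DirectedSystem
    (fun n => Ext (ModuleCat.of R (R ⧸ maximalIdeal R ^ n)) (ModuleCat.of R R) i)
    (fun a b h => extTransition R i a b h) where
  map_self a x := by
    have : quotientMap (Ideal.pow_le_pow_right (I := maximalIdeal R) (le_refl a)) = 𝟙 _ :=
      quotient_hom_ext (elementMap_one _ _ _)
    change extPull i _ x = x
    rw [this, extPull_id]
  map_map a b c hab hbc x := by
    change extPull i _ (extPull i _ x) = extPull i _ x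
    rw [extPull_extPull]
    exact congrArg (fun f => extPull i f x) (quotientMap_comp_elementMap _ _ _)

variable (R i) in
/-- The direct limit of the modules `Ext^i(R ⧸ 𝔪^n, R)`: the `i`-th local cohomology of `R`. -/
abbrev ExtLimit : Type u :=
  Module.DirectLimit
    (fun n => Ext (ModuleCat.of R (R ⧸ maximalIdeal R ^ n)) (ModuleCat.of R R) i)
    (fun a b h => extTransition R i a b h)

variable (R i) in
/-- The canonical map `Ext^i(R ⧸ 𝔪^n, R) → ExtLimit R i`. -/
def toExtLimit (n : ℕ) :
    Ext (ModuleCat.of R (R ⧸ maximalIdeal R ^ n)) (ModuleCat.of R R) i →ₗ[R] ExtLimit R i :=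
  Module.DirectLimit.of R ℕ
    (fun n => Ext (ModuleCat.of R (R ⧸ maximalIdeal R ^ n)) (ModuleCat.of R R) i)
    (fun a b h => extTransition R i a b h) n

theorem toExtLimit_extPull {a b : ℕ} (h : a ≤ b)
    (x : Ext (ModuleCat.of R (R ⧸ maximalIdeal R ^ a)) (ModuleCat.of R R) i) :
    toExtLimit R i b (extPull i (quotientMap (Ideal.pow_le_pow_right h)) x) = toExtLimit R i a x :=
  Module.DirectLimit.of_f (f := fun a b h => extTransition R i a b h) (hij := h)

/-- The transition maps are pullbacks along surjections of modules of finite length, hence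
injective. -/
theorem toExtLimit_injective [IsNoetherianRing R] [HasExtDuality R i] (n : ℕ) :
    Function.Injective (toExtLimit R i n) := by
  refine (injective_iff_map_eq_zero _).2 fun x hx => ?_
  obtain ⟨b, hb, h⟩ := Module.DirectLimit.of.zero_exact hx
  refine (injective_iff_map_eq_zero _).1
    (extPull_injective (isFiniteLength_quotient_pow b) _ ?_) x h
  intro (y : R ⧸ maximalIdeal R ^ n)
  obtain ⟨r, rfl⟩ := Ideal.Quotient.mk_surjective y
  refine ⟨Ideal.Quotient.mk _ r, (elementMap_mk _ _ _ r).trans ?_⟩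
  change r • (1 : R ⧸ maximalIdeal R ^ n) = _
  rw [Algebra.smul_def, mul_one]
  rfl

theorem exists_toExtLimit (y : ExtLimit R i) : ∃ n x, toExtLimit R i n x = y :=
  Module.DirectLimit.exists_of y

/-- A power of the maximal ideal that kills a module of finite length. -/
def killExponent (M : FinLen R) : ℕ := (exists_pow_smul_eq_zero M.property).choose

theorem killExponent_spec (M : FinLen R) (x : M.obj) (r : R)
    (hr : r ∈ maximalIdeal R ^ killExponent M) : r • x = 0 :=
  (exists_pow_smul_eq_zero M.property).choose_spec r hr x

/-- The evaluation `Ext^i(M, R) → Hom(M, ExtLimit R i)`: the class `e` goes to the map which sends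
`m` to the pullback of `e` under `R ⧸ 𝔪^n ⟶ M`, `1 ↦ m`. -/
def extEval (M : FinLen R) :
    Ext M.obj (ModuleCat.of R R) i →ₗ[R] M.obj →ₗ[R] ExtLimit R i :=
  LinearMap.mk₂ R (fun e m => toExtLimit R i (killExponent M)
      (extPull i (elementMap _ m (killExponent_spec M m)) e))
    (fun e e' m => by rw [map_add, map_add])
    (fun r e m => by rw [map_smul, map_smul])
    (fun e m m' => by
      rw [← map_add, ← extPull_add]
      refine congrArg (fun f => toExtLimit R i (killExponent M) (extPull i f e))
        (quotient_hom_ext ((elementMap_one _ _ _).trans ?_))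
      exact (congrArg₂ (· + ·) (elementMap_one _ m (killExponent_spec M m))
        (elementMap_one _ m' (killExponent_spec M m'))).symm)
    (fun r e m => by
      rw [← map_smul, ← extPull_smul]
      refine congrArg (fun f => toExtLimit R i (killExponent M) (extPull i f e))
        (quotient_hom_ext ((elementMap_one _ _ _).trans ?_))
      exact (congrArg (r • ·) (elementMap_one _ m (killExponent_spec M m))).symm)

/-- Any power of 𝔪 that kills m may be used in the evaluation: the values for two exponents agree in
the limit. -/
theorem extEval_apply (M : FinLen R) (e : Ext M.obj (ModuleCat.of R R) i) (m : M.obj) (n : ℕ)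
    (h : ∀ r ∈ maximalIdeal R ^ n, r • m = 0) :
    extEval M e m = toExtLimit R i n (extPull i (elementMap _ m h) e) := by
  have h1 : extEval M e m = toExtLimit R i (killExponent M)
      (extPull i (elementMap _ m (killExponent_spec M m)) e) := rfl
  rw [h1, ← toExtLimit_extPull (le_max_left _ n),
    ← toExtLimit_extPull (le_max_right (killExponent M) n),
    extPull_extPull, extPull_extPull, quotientMap_comp_elementMap, quotientMap_comp_elementMap]

theorem extEval_extPull {M N : FinLen R} (f : M.obj ⟶ N.obj) (e : Ext N.obj (ModuleCat.of R R) i)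
    (m : M.obj) : extEval M (extPull i f e) m = extEval N e (f.hom m) := by
  rw [extEval_apply M _ m _ (killExponent_spec M m), extPull_extPull, elementMap_comp,
    ← extEval_apply]

end ExtEval

/-! ### Ext^i(-, R) is represented by a dualizing module -/

section ExtEvalBijective

open Abelian IsLocalRing

variable {R : Type u} [CommRing R] [IsLocalRing R] {i : ℕ}

theorem LinearMap.exists_comp_eq_of_surjective {R M N P : Type*} [Ring R] [AddCommGroup M]
    [Module R M] [AddCommGroup N] [Module R N] [AddCommGroup P] [Module R P] (g : M →ₗ[R] N)
    (hg : Function.Surjective g) (φ : M →ₗ[R] P) (h : LinearMap.ker g ≤ LinearMap.ker φ) :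
    ∃ ψ : N →ₗ[R] P, ψ ∘ₗ g = φ := by
  refine ⟨(LinearMap.ker g).liftQ _ h ∘ₗ (g.quotKerEquivOfSurjective hg).symm.toLinearMap, ?_⟩
  ext b
  have : (g.quotKerEquivOfSurjective hg).symm (g b) = Submodule.Quotient.mk b := by
    rw [LinearEquiv.symm_apply_eq]; rfl
  simp only [LinearMap.comp_apply, LinearEquiv.coe_coe, this, Submodule.liftQ_apply]

/-- A module of finite length as an object of `FinLen R`. -/
abbrev FinLen.of (M : Type u) [AddCommGroup M] [Module R M] (h : IsFiniteLength R M) : FinLen R :=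
  ⟨ModuleCat.of R M, h⟩

/-- This and the surjective counterpart are the two halves of a five lemma, used in the dévissage.
-/
theorem extEval_injective_of_exact {A M C : FinLen R} (f : A.obj ⟶ M.obj) (g : M.obj ⟶ C.obj)
    (w : f ≫ g = 0) (hf : Function.Injective f.hom) (hg : Function.Surjective g.hom)
    (hfg : ∀ b, g.hom b = 0 → ∃ a, f.hom a = b)
    (hA : Function.Injective (extEval (i := i) A)) (hC : Function.Injective (extEval (i := i) C)) :
    Function.Injective (extEval (i := i) M) := by
  refine (injective_iff_map_eq_zero _).2 fun e he => ?_
  have h1 : extPull i f e = 0 := (injective_iff_map_eq_zero _).1 hA _ <| LinearMap.ext fun a => by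
    rw [extEval_extPull, he]; rfl
  obtain ⟨e', rfl⟩ := exists_extPull_eq f g w hf hg hfg e h1
  have h2 : e' = 0 := (injective_iff_map_eq_zero _).1 hC _ <| LinearMap.ext fun c => by
    obtain ⟨b, rfl⟩ := hg c
    rw [← extEval_extPull, he]; rfl
  rw [h2, map_zero]

theorem extEval_surjective_of_exact [HasExtDuality R i] {A M C : FinLen R} (f : A.obj ⟶ M.obj)
    (g : M.obj ⟶ C.obj) (hf : Function.Injective f.hom) (hg : Function.Surjective g.hom)
    (hfg : ∀ b, g.hom b = 0 → ∃ a, f.hom a = b)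
    (hA : Function.Surjective (extEval (i := i) A))
    (hC : Function.Surjective (extEval (i := i) C)) :
    Function.Surjective (extEval (i := i) M) := by
  intro φ
  obtain ⟨a, ha⟩ := hA (φ ∘ₗ f.hom)
  obtain ⟨e, rfl⟩ := extPull_surjective M.property f hf a
  have h1 : LinearMap.ker g.hom ≤ LinearMap.ker (φ - extEval M e) := by
    intro b hb
    obtain ⟨a, rfl⟩ := hfg b hb
    rw [LinearMap.mem_ker, LinearMap.sub_apply, ← extEval_extPull, ha, LinearMap.comp_apply,
      sub_self]
  obtain ⟨ψ, hψ⟩ := g.hom.exists_comp_eq_of_surjective hg _ h1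
  obtain ⟨e', he'⟩ := hC ψ
  refine ⟨e + extPull i g e', LinearMap.ext fun b => ?_⟩
  rw [map_add, LinearMap.add_apply, extEval_extPull, he']
  have := LinearMap.congr_fun hψ b
  simp only [LinearMap.comp_apply, LinearMap.sub_apply] at this
  rw [this]
  abel

/-- Dévissage for properties of modules of finite length over a local ring. -/
theorem FinLen.devissage (P : FinLen R → Prop)
    (h0 : ∀ M : FinLen R, Subsingleton M.obj → P M)
    (h1 : ∀ M : FinLen R, Nonempty (M.obj ≃ₗ[R] (residueObj R).obj) → P M)
    (h2 : ∀ (A M C : FinLen R) (f : A.obj ⟶ M.obj) (g : M.obj ⟶ C.obj), f ≫ g = 0 →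
      Function.Injective f.hom → Function.Surjective g.hom →
      (∀ b, g.hom b = 0 → ∃ a, f.hom a = b) → P A → P C → P M) (M : FinLen R) : P M := by
  obtain ⟨M, hM⟩ := M
  suffices ∀ (M : Type u) [AddCommGroup M] [Module R M] (_ : IsFiniteLength R M)
      (h : IsFiniteLength R M), P (FinLen.of M h) from this M hM hM
  intro M _ _ hM
  induction hM with
  | of_subsingleton => exact fun h => h0 _ (by assumption)
  | @of_simple_quotient M _ _ S hS hfin ih =>
    intro h
    obtain ⟨I, hI, ⟨φ⟩⟩ := isSimpleModule_iff_quot_maximal.1 hS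
    obtain rfl := eq_maximalIdeal hI
    exact h2 (FinLen.of S hfin) (FinLen.of M h)
      (FinLen.of (M ⧸ S) (h.of_surjective (Submodule.mkQ_surjective S)))
      (ModuleCat.ofHom S.subtype) (ModuleCat.ofHom S.mkQ) (by ext m; simp)
      (Submodule.subtype_injective S) (Submodule.mkQ_surjective S)
      (fun b hb => ⟨⟨b, (Submodule.Quotient.mk_eq_zero S).1 hb⟩, rfl⟩) (ih hfin) (h1 _ ⟨φ⟩)

theorem residue_eq_smul_one (r : R) :
    (residue R r : ResidueField R) = r • (1 : ResidueField R) := by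
  rw [Algebra.smul_def, mul_one]
  rfl

theorem exists_generator_of_equiv_residueObj {M : Type u} [AddCommGroup M] [Module R M]
    (θ : M ≃ₗ[R] (residueObj R).obj) : ∃ m : M, (∀ r : R, r • m = 0 ↔ r ∈ maximalIdeal R) ∧
      ∀ x, ∃ r : R, r • m = x := by
  obtain ⟨m, hm⟩ : ∃ m, θ m = (1 : ResidueField R) := θ.surjective _
  refine ⟨m, fun r => ?_, fun x => ?_⟩
  · rw [← θ.map_eq_zero_iff, map_smul, hm, ← residue_eq_zero_iff, residue_eq_smul_one]
    rfl
  · obtain ⟨r, hr⟩ := residue_surjective (R := R) (θ x)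
    refine ⟨r, θ.injective ?_⟩
    rw [map_smul, hm, ← hr, residue_eq_smul_one]
    rfl

variable (R i) in
theorem exists_residueObj_equiv_ext [hR : HasExtDuality R i] :
    Nonempty ((residueObj R).obj ≃ₗ[R] Ext (residueObj R).obj (ModuleCat.of R R) i) := by
  obtain ⟨k, hk, hk0⟩ := hR.exists_generator
  let g : (residueObj R).obj →ₗ[R] Ext (residueObj R).obj (ModuleCat.of R R) i :=
    Submodule.liftQ (maximalIdeal R) (LinearMap.toSpanSingleton R _ k) fun r hr => (hk0 r).2 hr
  refine ⟨LinearEquiv.ofBijective g ⟨(injective_iff_map_eq_zero g).2 fun x hx => ?_, fun y => ?_⟩⟩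
  · obtain ⟨r, rfl⟩ := residue_surjective (R := R) x
    exact (residue_eq_zero_iff r).2 ((hk0 r).1 hx)
  · obtain ⟨r, rfl⟩ := hk y
    exact ⟨residue R r, rfl⟩

variable [IsNoetherianRing R] [hR : HasExtDuality R i]

/-- By dévissage it suffices to treat M ≅ κ. A generator of M gives a surjection from R/𝔪, so
pulling back along it is injective, as is the map to the limit. -/
theorem extEval_injective (M : FinLen R) : Function.Injective (extEval (i := i) M) := by
  refine FinLen.devissage (fun M => Function.Injective (extEval (i := i) M)) ?_ ?_
    (fun A M C f g w hf hg hfg => extEval_injective_of_exact f g w hf hg hfg) M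
  · intro M hM
    refine (injective_iff_map_eq_zero _).2 fun e _ => ?_
    have : 𝟙 M.obj = 0 := by ext m; exact Subsingleton.elim _ _
    rw [← extPull_id e, this, extPull_zero]
  · rintro M ⟨θ⟩
    refine (injective_iff_map_eq_zero _).2 fun e he => ?_
    obtain ⟨m, hmax, hspan⟩ := exists_generator_of_equiv_residueObj θ
    have hm : ∀ r ∈ maximalIdeal R ^ 1, r • m = 0 := fun r hr => by
      rw [pow_one] at hr
      exact (hmax r).2 hr
    have h1 := extEval_apply M e m 1 hm
    rw [he, LinearMap.zero_apply] at h1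
    have h2 := (injective_iff_map_eq_zero _).1 (toExtLimit_injective 1) _ h1.symm
    refine (injective_iff_map_eq_zero _).1 (extPull_injective (isFiniteLength_quotient_pow 1) _ ?_)
      _ h2
    intro x
    obtain ⟨r, rfl⟩ := hspan x
    exact ⟨Ideal.Quotient.mk _ r, elementMap_mk _ _ _ r⟩

/-- For M ≅ κ with generator m, a map φ is given by the element φ(m), which 𝔪 kills. It comes from
some z in Ext^i(R/𝔪^(n+1), R), also killed by 𝔪 as the map to the limit is injective. Such a z
restricts to zero on the kernel of R/𝔪^(n+1) → M, so it comes from Ext^i(M, R). -/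
theorem extEval_surjective (M : FinLen R) : Function.Surjective (extEval (i := i) M) := by
  refine FinLen.devissage (fun M => Function.Surjective (extEval (i := i) M)) ?_ ?_
    (fun A M C f g _ hf hg hfg => extEval_surjective_of_exact f g hf hg hfg) M
  · exact fun M hM φ => ⟨0, LinearMap.ext fun m => by
      rw [Subsingleton.elim m 0, map_zero, map_zero]⟩
  · rintro M ⟨θ⟩ φ
    obtain ⟨m, hmax, hspan⟩ := exists_generator_of_equiv_residueObj θ
    obtain ⟨n, y, hy⟩ := exists_toExtLimit (φ m)
    -- The exponent n + 1 guarantees a positive power, which kills m even when n = 0.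
    have hn : ∀ r ∈ maximalIdeal R ^ (n + 1), r • m = 0 := fun r hr =>
      (hmax r).2 (Ideal.pow_le_self n.succ_ne_zero hr)
    rw [← toExtLimit_extPull n.le_succ] at hy
    generalize extPull i (quotientMap (Ideal.pow_le_pow_right n.le_succ)) y = z at hy
    have hz : ∀ r ∈ maximalIdeal R, r • z = 0 := fun r hr => by
      refine (injective_iff_map_eq_zero _).1 (toExtLimit_injective (n + 1)) _ ?_
      rw [map_smul, hy, ← map_smul, (hmax r).2 hr, map_zero]
    let Q := FinLen.of (R ⧸ maximalIdeal R ^ (n + 1)) (isFiniteLength_quotient_pow (n + 1))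
    let g : Q.obj ⟶ M.obj := elementMap _ m hn
    have hg : Function.Surjective g.hom := fun x => by
      obtain ⟨r, rfl⟩ := hspan x
      exact ⟨Ideal.Quotient.mk _ r, elementMap_mk _ _ _ r⟩
    let K : FinLen R := FinLen.of (LinearMap.ker g.hom)
      (Q.property.of_injective (Submodule.subtype_injective _))
    let f : K.obj ⟶ Q.obj := ModuleCat.ofHom (LinearMap.ker g.hom).subtype
    -- An element of the kernel is the class of some r in 𝔪, so evaluating z there gives r • z = 0.
    -- Injectivity of the evaluation on the kernel concludes.
    have hfz : extPull i f z = 0 := by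
      refine (injective_iff_map_eq_zero _).1 (extEval_injective K) _ (LinearMap.ext fun a => ?_)
      have hk : ∀ r ∈ maximalIdeal R ^ (n + 1), r • f.hom a = 0 := by
        intro r hr
        obtain ⟨s, hs⟩ := Ideal.Quotient.mk_surjective (I := maximalIdeal R ^ (n + 1)) (f.hom a)
        rw [← hs, Algebra.smul_def]
        exact (map_mul (Ideal.Quotient.mk (maximalIdeal R ^ (n + 1))) r s).symm.trans
          (Ideal.Quotient.eq_zero_iff_mem.2 (Ideal.mul_mem_right _ _ hr))
      rw [extEval_extPull, extEval_apply Q z (f.hom a) (n + 1) hk]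
      obtain ⟨r, hr⟩ := Ideal.Quotient.mk_surjective (I := maximalIdeal R ^ (n + 1)) (f.hom a)
      have h3 : elementMap (maximalIdeal R ^ (n + 1)) (f.hom a) hk = r • 𝟙 Q.obj := by
        refine quotient_hom_ext ((elementMap_one _ _ _).trans (hr.symm.trans ?_))
        change _ = r • (1 : R ⧸ maximalIdeal R ^ (n + 1))
        rw [Algebra.smul_def, mul_one]
        rfl
      have h4 : r • m = 0 := by
        have h5 : g.hom (f.hom a) = 0 := a.2
        rw [← hr] at h5
        exact h5
      rw [h3, extPull_smul, extPull_id, hz r ((hmax r).1 h4), map_zero]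
      rfl
    obtain ⟨e, he⟩ := exists_extPull_eq f g (by ext a; exact a.2) (Subtype.val_injective) hg
      (fun b hb => ⟨⟨b, hb⟩, rfl⟩) z hfz
    refine ⟨e, LinearMap.ext fun x => ?_⟩
    obtain ⟨r, rfl⟩ := hspan x
    rw [map_smul, map_smul, extEval_apply M e m (n + 1) hn, he, hy]

variable (i) in
/-- Ext duality is represented by `ExtLimit R i` on modules of finite length. -/
def extEvalEquiv (M : FinLen R) :
    Ext M.obj (ModuleCat.of R R) i ≃ₗ[R] M.obj →ₗ[R] ExtLimit R i :=
  LinearEquiv.ofBijective (extEval M) ⟨extEval_injective M, extEval_surjective M⟩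

variable (i) in
theorem exists_extLimit_extension {M N : Type u} [AddCommGroup M] [Module R M] [AddCommGroup N]
    [Module R N] (hN : IsFiniteLength R N) (f : M →ₗ[R] N) (hf : Function.Injective f)
    (φ : M →ₗ[R] ExtLimit R i) : ∃ ψ : N →ₗ[R] ExtLimit R i, ψ ∘ₗ f = φ := by
  obtain ⟨e, rfl⟩ := extEval_surjective (FinLen.of M (hN.of_injective hf)) φ
  obtain ⟨e', rfl⟩ := extPull_surjective (M := ModuleCat.of R M) hN (ModuleCat.ofHom f) hf e
  exact ⟨extEval (FinLen.of N hN) e', LinearMap.ext fun m =>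
    (extEval_extPull (M := FinLen.of M (hN.of_injective hf)) (N := FinLen.of N hN)
      (ModuleCat.ofHom f) e' m).symm⟩

instance : IsSimpleModule R (residueObj R).obj :=
  isSimpleModule_iff_isCoatom.2 (maximalIdeal.isMaximal R).out

/-- Length is preserved by `Hom(-, E)`, for `E` the direct limit of the `Ext^i(R ⧸ 𝔪^n, R)`. -/
theorem length_extLimit_dual (M : FinLen R) :
    Module.length R (M.obj →ₗ[R] ExtLimit R i) = Module.length R M.obj := by
  refine FinLen.devissage
    (fun M => Module.length R (M.obj →ₗ[R] ExtLimit R i) = Module.length R M.obj) ?_ ?_ ?_ M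
  · intro M hM
    rw [Module.length_eq_zero, Module.length_eq_zero]
  · rintro M ⟨θ⟩
    -- On κ the dual is Ext^i(κ, R), which is again isomorphic to κ.
    obtain ⟨k⟩ := exists_residueObj_equiv_ext R i
    have h1 : (M.obj →ₗ[R] ExtLimit R i) ≃ₗ[R] (residueObj R).obj :=
      LinearEquiv.congrLeft (ExtLimit R i) R θ ≪≫ₗ (extEvalEquiv i (residueObj R)).symm ≪≫ₗ k.symm
    rw [h1.length_eq, θ.length_eq]
  · intro A M C f g w hf hg hfg hA hC
    have h1 := Module.length_eq_add_of_exact f.hom g.hom hf hg fun b => ⟨hfg b, ?_⟩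
    · have h2 := Module.length_eq_add_of_exact (g.hom.lcomp R (ExtLimit R i))
        (f.hom.lcomp R (ExtLimit R i)) (fun φ ψ h => LinearMap.ext fun c => ?_) (fun φ => ?_)
        fun φ => ⟨fun h => ?_, ?_⟩
      · rw [h1, h2, hA, hC, add_comm]
      · obtain ⟨b, rfl⟩ := hg c
        exact LinearMap.congr_fun h b
      · exact exists_extLimit_extension i M.property f.hom hf φ
      · refine g.hom.exists_comp_eq_of_surjective hg φ fun b hb => ?_
        obtain ⟨a, rfl⟩ := hfg b hb
        exact LinearMap.congr_fun h a
      · rintro ⟨ψ, rfl⟩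
        refine LinearMap.ext fun a => ?_
        change ψ ((f ≫ g).hom a) = 0
        rw [w]
        exact map_zero ψ
    · rintro ⟨a, rfl⟩
      exact congrArg (fun f => f.hom a) w

/-- If every map kills m, then the submodule spanned by m has zero dual, since maps on it extend to
M. Duals have the same length, so this submodule is zero. -/
theorem exists_extLimit_dual_ne_zero {M : Type u} [AddCommGroup M] [Module R M]
    (hM : IsFiniteLength R M) {m : M} (hm : m ≠ 0) : ∃ φ : M →ₗ[R] ExtLimit R i, φ m ≠ 0 := by
  by_contra! h
  let S := FinLen.of (Submodule.span R {m}) (hM.of_injective (Submodule.subtype_injective _))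
  have h1 : Subsingleton (S.obj →ₗ[R] ExtLimit R i) := by
    refine ⟨fun φ ψ => ?_⟩
    suffices ∀ φ : S.obj →ₗ[R] ExtLimit R i, φ = 0 by rw [this φ, this ψ]
    intro φ
    obtain ⟨ψ, rfl⟩ := exists_extLimit_extension i hM (Submodule.span R {m}).subtype
      (Submodule.subtype_injective _) φ
    refine LinearMap.ext fun x => ?_
    obtain ⟨r, hr⟩ := Submodule.mem_span_singleton.1 x.2
    change ψ x.1 = 0
    rw [← hr, map_smul, h, smul_zero]
  rw [← Module.length_eq_zero_iff (R := R), length_extLimit_dual, Module.length_eq_zero_iff] at h1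
  exact hm (congrArg Subtype.val
    (h1.elim ⟨m, Submodule.mem_span_singleton_self m⟩ 0))

end ExtEvalBijective

/-! ### The exact category with duality and its uniqueness -/

section ExtDuality

open Abelian IsLocalRing Opposite

theorem LinearMap.surjective_of_injective_of_length_eq {R M N : Type*} [Ring R]
    [AddCommGroup M] [Module R M]
    [AddCommGroup N] [Module R N] (f : M →ₗ[R] N) (hf : Function.Injective f)
    (hN : IsFiniteLength R N) (h : Module.length R M = Module.length R N) :
    Function.Surjective f := by
  have h1 := Module.length_eq_add_of_exact f (LinearMap.range f).mkQ hf
    (Submodule.mkQ_surjective _) (LinearMap.exact_map_mkQ_range f)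
  rw [h] at h1
  have h2 : Module.length R (N ⧸ LinearMap.range f) = 0 := by
    have h3 : Module.length R N + 0 =
        Module.length R N + Module.length R (N ⧸ LinearMap.range f) := by
      rw [add_zero]; exact h1
    exact (ENat.add_right_injective_of_ne_top (Module.length_ne_top_iff.2 hN) h3).symm
  rw [Module.length_eq_zero_iff, Submodule.Quotient.subsingleton_iff] at h2
  exact LinearMap.range_eq_top.1 h2

namespace FinLen

variable {R : Type u} [CommRing R]

instance : (finLenProp R).ι.PreservesHomology where
  preservesKernels _ _ f := ObjectProperty.preservesKernels_ι _ f
  preservesCokernels _ _ f := ObjectProperty.preservesCokernels_ι _ f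

/-- The inclusion into all modules preserves homology and is faithful, so exactness can be tested on
elements. -/
theorem shortExact_iff (S : ShortComplex (FinLen R)) :
    S.ShortExact ↔ Function.Injective S.f.hom.hom ∧ Function.Surjective S.g.hom.hom ∧
      ∀ b, S.g.hom.hom b = 0 → ∃ a, S.f.hom.hom a = b := by
  have := (finLenProp R).preservesMonomorphisms_ι_of_isNormalEpiCategory
  have := (finLenProp R).preservesEpimorphisms_ι_of_isNormalMonoCategory
  constructor
  · intro h
    have := h.mono_f
    have := h.epi_g
    have := ModuleCat.ShortExact.elements (h.map (finLenProp R).ι)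
    exact ⟨(injective_iff_map_eq_zero _).2 this.1, this.2.2, this.2.1⟩
  · rintro ⟨h1, h2, h3⟩
    have h := ModuleCat.shortExact_of_elements S.f.hom S.g.hom (congrArg (fun f => f.hom) S.zero)
      ((injective_iff_map_eq_zero _).1 h1) h3 h2
    have := h.mono_f
    have := h.epi_g
    exact { exact := (S.exact_map_iff_of_faithful (finLenProp R).ι).1 h.exact
            mono_f := (finLenProp R).ι.mono_of_mono_map (f := S.f) h.mono_f
            epi_g := (finLenProp R).ι.epi_of_epi_map (f := S.g) h.epi_g }

/-- The isomorphism of `FinLen R` given by a linear equivalence. -/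
def isoOfLinearEquiv {M N : FinLen R} (e : M.obj ≃ₗ[R] N.obj) : M ≅ N where
  hom := ObjectProperty.homMk (ModuleCat.ofHom e.toLinearMap)
  inv := ObjectProperty.homMk (ModuleCat.ofHom e.symm.toLinearMap)
  hom_inv_id := by ext x; exact e.symm_apply_apply x
  inv_hom_id := by ext x; exact e.apply_symm_apply x

/-- The linear equivalence given by an isomorphism of `FinLen R`. -/
def linearEquivOfIso {M N : FinLen R} (e : M ≅ N) : M.obj ≃ₗ[R] N.obj :=
  ((finLenProp R).ι.mapIso e).toLinearEquiv

end FinLen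

variable {R : Type u} [CommRing R] [IsLocalRing R] [IsNoetherianRing R] {i : ℕ}

instance : (extDual R i).Additive where
  map_add {M N f g} := by
    ext e
    exact extPull_add f.unop.hom g.unop.hom e

variable (i) in
/-- `Ext^i(M, R)` as an object of the category of modules of finite length. -/
abbrev extDualObj (M : FinLen R) : FinLen R :=
  ⟨ModuleCat.of R (Ext M.obj (ModuleCat.of R R) i),
    isFiniteLength_ext R M.obj (ModuleCat.of R R) M.property i⟩

variable [hR : HasExtDuality R i]

theorem extDual_shortExact (S : ShortComplex (FinLen R)ᵒᵖ) (hS : S.ShortExact) :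
    (S.map (extDual R i)).ShortExact := by
  have h := (FinLen.shortExact_iff _).1 hS.unop
  refine (FinLen.shortExact_iff _).2 ⟨?_, ?_, ?_⟩
  · exact extPull_injective S.unop.X₂.property S.unop.g.hom h.2.1
  · exact extPull_surjective S.unop.X₂.property S.unop.f.hom h.1
  · exact fun e he => exists_extPull_eq S.unop.f.hom S.unop.g.hom
      (congrArg (fun f => f.hom) S.unop.zero) h.1 h.2.1 h.2.2 e he

variable (i) in
/-- The biduality map `M → Ext^i(Ext^i(M, R), R)`, the adjoint of the evaluation. -/
def bidual (M : FinLen R) : M.obj →ₗ[R] Ext (extDualObj i M).obj (ModuleCat.of R R) i :=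
  (extEvalEquiv i (extDualObj i M)).symm.toLinearMap ∘ₗ (extEval M).flip

theorem extEval_bidual (M : FinLen R) (m : M.obj) (e : Ext M.obj (ModuleCat.of R R) i) :
    extEval (extDualObj i M) (bidual i M m) e = extEval M e m :=
  LinearMap.congr_fun ((extEvalEquiv i (extDualObj i M)).apply_symm_apply ((extEval M).flip m)) e

theorem bidual_injective (M : FinLen R) : Function.Injective (bidual i M) := by
  refine (injective_iff_map_eq_zero _).2 fun m hm => ?_
  by_contra h
  obtain ⟨φ, hφ⟩ := exists_extLimit_dual_ne_zero (i := i) M.property h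
  obtain ⟨e, rfl⟩ := extEval_surjective M φ
  rw [← extEval_bidual, hm, map_zero] at hφ
  exact hφ rfl

theorem length_ext (M : FinLen R) :
    Module.length R (Ext M.obj (ModuleCat.of R R) i) = Module.length R M.obj := by
  rw [(extEvalEquiv i M).length_eq, length_extLimit_dual]

/-- Injectivity holds because maps to the dualizing module separate elements; surjectivity follows
since two dualizations preserve length. -/
theorem bidual_bijective (M : FinLen R) : Function.Bijective (bidual i M) :=
  ⟨bidual_injective M, LinearMap.surjective_of_injective_of_length_eq _ (bidual_injective M)
    (isFiniteLength_ext R _ _ (extDualObj i M).property i) (by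
      rw [length_ext (extDualObj i M)]
      exact (length_ext M).symm)⟩

/-- The biduality isomorphism on modules of finite length. -/
def bidualIso (M : FinLen R) : M ≅ (extDual R i).obj (op ((extDual R i).obj (op M))) :=
  FinLen.isoOfLinearEquiv (N := extDualObj i (extDualObj i M))
    (LinearEquiv.ofBijective _ (bidual_bijective M))

/-- As with the triangle identity below, evaluation is injective, so both sides may be evaluated,
after which `extEval_bidual` and `extEval_extPull` give the same value. -/
theorem bidual_naturality {M N : FinLen R} (f : M.obj ⟶ N.obj) (m : M.obj) :
    extPull i (M := (extDualObj i N).obj) (N := (extDualObj i M).obj)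
      (ModuleCat.ofHom (extPull i f)) (bidual i M m) = bidual i N (f.hom m) :=
  extEval_injective (extDualObj i N) (LinearMap.ext fun e =>
    (extEval_extPull (M := extDualObj i N) (N := extDualObj i M) _ _ e).trans
      ((extEval_bidual M m _).trans ((extEval_extPull f e m).trans (extEval_bidual N _ e).symm)))

theorem extPull_bidual (M : FinLen R) (e : Ext M.obj (ModuleCat.of R R) i) :
    extPull i (M := M.obj) (N := (extDualObj i (extDualObj i M)).obj)
      (ModuleCat.ofHom (bidual i M)) (bidual i (extDualObj i M) e) = e :=
  extEval_injective M (LinearMap.ext fun m =>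
    (extEval_extPull (M := M) (N := extDualObj i (extDualObj i M)) _ _ m).trans
      ((extEval_bidual (extDualObj i M) e _).trans (extEval_bidual M m e)))

variable (R i) in
/-- The duality `Ext^i(-, R)` on modules of finite length. -/
def extDuality : ExactDuality (extDual R i) where
  additive := inferInstance
  preservesFiniteLimits :=
    ((List.TFAE.out (n₁ := 0) (n₂ := 3) (extDual R i).exact_tfae rfl rfl).1 extDual_shortExact).1
  preservesFiniteColimits :=
    ((List.TFAE.out (n₁ := 0) (n₂ := 3) (extDual R i).exact_tfae rfl rfl).1 extDual_shortExact).2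
  η := NatIso.ofComponents bidualIso fun {M N} f => by
    ext m
    exact (bidual_naturality f.hom m).symm
  triangle M := by
    ext e
    exact extPull_bidual M e

theorem extPull_bidual_eq (M : FinLen R) (I : Ideal R) (f : ModuleCat.of R (R ⧸ I) ⟶ M.obj)
    (g : ModuleCat.of R (R ⧸ I) ⟶ (extDualObj i M).obj) :
    extPull i g (bidual i M (f.hom (1 : R ⧸ I))) = extPull i f (g.hom (1 : R ⧸ I)) := by
  obtain ⟨n₁, h₁⟩ := exists_pow_smul_eq_zero M.property
  obtain ⟨n₂, h₂⟩ := exists_pow_smul_eq_zero (extDualObj i M).property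
  -- The module R/I need not have finite length. Both maps factor through R/J, which does, and there
  -- injectivity of the evaluation applies.
  let J : Ideal R := I ⊔ maximalIdeal R ^ max n₁ n₂
  have hI : ∀ {N : ModuleCat.{u} R} (h : ModuleCat.of R (R ⧸ I) ⟶ N) (r : R), r ∈ I →
      r • h.hom (1 : R ⧸ I) = 0 := fun h r hr => by
    rw [← map_smul, quotient_smul_one_eq_zero le_rfl r hr, map_zero]
  have hm : ∀ r ∈ J, r • f.hom (1 : R ⧸ I) = 0 := by
    intro r hr
    obtain ⟨a, ha, b, hb, rfl⟩ := Submodule.mem_sup.1 hr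
    rw [add_smul, hI f a ha, h₁ b (Ideal.pow_le_pow_right (le_max_left _ _) hb), add_zero]
  have he : ∀ r ∈ J, r • g.hom (1 : R ⧸ I) = 0 := by
    intro r hr
    obtain ⟨a, ha, b, hb, rfl⟩ := Submodule.mem_sup.1 hr
    rw [add_smul, hI g a ha, h₂ b (Ideal.pow_le_pow_right (le_max_right _ _) hb), add_zero]
  have hQ : IsFiniteLength R (R ⧸ J) := by
    refine (isFiniteLength_quotient_pow (R := R) (max n₁ n₂)).of_surjective
      (f := Submodule.factor (le_sup_right : maximalIdeal R ^ max n₁ n₂ ≤ J))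
      (Submodule.factor_surjective _)
  have hf : f = quotientMap le_sup_left ≫ elementMap J _ hm := by
    rw [quotientMap_comp_elementMap]
    exact quotient_hom_ext (elementMap_one _ _ _).symm
  have hg : g = quotientMap le_sup_left ≫ elementMap J _ he := by
    rw [quotientMap_comp_elementMap]
    exact quotient_hom_ext (elementMap_one _ _ _).symm
  have key : extPull i (elementMap J _ he) (bidual i M (f.hom (1 : R ⧸ I))) =
      extPull i (elementMap J _ hm) (g.hom (1 : R ⧸ I)) := by
    refine extEval_injective (FinLen.of (R ⧸ J) hQ) (LinearMap.ext fun x => ?_)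
    obtain ⟨r, rfl⟩ := Ideal.Quotient.mk_surjective x
    rw [extEval_extPull (M := FinLen.of (R ⧸ J) hQ) (N := extDualObj i M),
      extEval_extPull (M := FinLen.of (R ⧸ J) hQ) (N := M), extEval_bidual, elementMap_mk]
    refine Eq.trans ?_ (map_smul _ r _).symm
    exact LinearMap.congr_fun (map_smul (extEval (i := i) M) r _) _
  have h3 := congrArg (extPull i (quotientMap (le_sup_left : I ≤ J))) key
  rw [extPull_extPull, extPull_extPull, ← hf, ← hg] at h3
  exact h3

/-- With I a power of 𝔪 that kills M and its dual, the condition prescribes all values of the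
evaluation of ϖ(m), which determine it. -/
theorem isCanonical_iff (𝒟 : ExactDuality (extDual R i)) : 𝒟.IsCanonical ↔
    ∀ (M : FinLen R) (m : M.obj), (𝒟.η.hom.app M).hom.hom m = bidual i M m := by
  constructor
  · intro h M m
    refine extEval_injective (extDualObj i M) (LinearMap.ext fun e => ?_)
    obtain ⟨n₁, h₁⟩ := exists_pow_smul_eq_zero M.property
    obtain ⟨n₂, h₂⟩ := exists_pow_smul_eq_zero (extDualObj i M).property
    have hm : ∀ r ∈ maximalIdeal R ^ max n₁ n₂, r • m = 0 := fun r hr =>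
      h₁ r (Ideal.pow_le_pow_right (le_max_left _ _) hr) m
    have he : ∀ r ∈ maximalIdeal R ^ max n₁ n₂, r • e = 0 := fun r hr =>
      h₂ r (Ideal.pow_le_pow_right (le_max_right _ _) hr) e
    let f := elementMap _ m hm
    let g := elementMap (M := (extDualObj i M).obj) _ e he
    have h1 : extPull i g ((𝒟.η.hom.app M).hom.hom (f.hom (1 : R ⧸ maximalIdeal R ^ max n₁ n₂))) =
        extPull i f (g.hom (1 : R ⧸ maximalIdeal R ^ max n₁ n₂)) := h M _ f g
    rw [elementMap_one, elementMap_one] at h1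
    rw [extEval_bidual, extEval_apply M e m _ hm, ← h1]
    exact extEval_apply (extDualObj i M) _ e _ he
  · intro h M I f g
    have := extPull_bidual_eq M I f g
    rw [← h M] at this
    exact this

theorem existsUnique_isCanonical : ∃! 𝒟 : ExactDuality (extDual R i), 𝒟.IsCanonical := by
  refine ⟨extDuality R i, (isCanonical_iff _).2 fun M m => rfl, fun 𝒟 h𝒟 => ?_⟩
  have h : 𝒟.η = (extDuality R i).η := by
    ext M m
    exact (isCanonical_iff 𝒟).1 h𝒟 M m
  cases 𝒟
  dsimp only at h
  subst h
  rfl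

end ExtDuality

/-! ### Symmetric forms with values in a dualizing module, and Witt equivalence -/

section FormSpaces

/-- A module `E` over `R` such that `Hom(-, E)` is a duality on modules of finite length. -/
class IsDualizingModule (R : Type u) [CommRing R] (E : Type u) [AddCommGroup E] [Module R E] :
    Prop where
  exists_ne_zero {M : Type u} [AddCommGroup M] [Module R M] (hM : IsFiniteLength R M) {m : M}
    (hm : m ≠ 0) : ∃ φ : M →ₗ[R] E, φ m ≠ 0
  exists_extension {M N : Type u} [AddCommGroup M] [Module R M] [AddCommGroup N] [Module R N]
    (hN : IsFiniteLength R N) (f : M →ₗ[R] N) (hf : Function.Injective f) (φ : M →ₗ[R] E) :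
    ∃ ψ : N →ₗ[R] E, ψ ∘ₗ f = φ
  length_dual {M : Type u} [AddCommGroup M] [Module R M] (hM : IsFiniteLength R M) :
    Module.length R (M →ₗ[R] E) = Module.length R M

variable (R : Type u) [CommRing R] (E : Type u) [AddCommGroup E] [Module R E]

/-- A module of finite length with a nondegenerate symmetric bilinear form with values in `E`. -/
structure FormSpace where
  carrier : Type u
  [addCommGroup : AddCommGroup carrier]
  [module : Module R carrier]
  isFiniteLength : IsFiniteLength R carrier
  form : carrier →ₗ[R] carrier →ₗ[R] E
  symm : ∀ x y, form x y = form y x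
  nondeg : ∀ x, (∀ y, form x y = 0) → x = 0

namespace FormSpace

variable {R E}

instance : CoeSort (FormSpace R E) (Type u) := ⟨carrier⟩

attribute [instance] addCommGroup module

variable (S T U V : FormSpace R E)

/-- The orthogonal complement of a submodule. -/
def perp (L : Submodule R S) : Submodule R S where
  carrier := {x | ∀ y ∈ L, S.form x y = 0}
  add_mem' hx hy z hz := by rw [map_add, LinearMap.add_apply, hx z hz, hy z hz, add_zero]
  zero_mem' z _ := by rw [map_zero, LinearMap.zero_apply]
  smul_mem' r x hx z hz := by rw [map_smul, LinearMap.smul_apply, hx z hz, smul_zero]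

variable {S T U V}

theorem perp_anti {L L' : Submodule R S} (h : L ≤ L') : S.perp L' ≤ S.perp L :=
  fun _ hx y hy => hx y (h hy)

theorem le_perp_perp (L : Submodule R S) : L ≤ S.perp (S.perp L) :=
  fun x hx y hy => by rw [S.symm]; exact hy x hx

theorem perp_sup (L L' : Submodule R S) : S.perp (L ⊔ L') = S.perp L ⊓ S.perp L' := by
  refine le_antisymm (le_inf (perp_anti le_sup_left) (perp_anti le_sup_right)) ?_
  rintro x ⟨h1, h2⟩ y hy
  obtain ⟨a, ha, b, hb, rfl⟩ := Submodule.mem_sup.1 hy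
  rw [map_add, h1 a ha, h2 b hb, add_zero]

section

variable [IsDualizingModule R E]

variable (S) in
theorem form_surjective (φ : S →ₗ[R] E) : ∃ x, S.form x = φ :=
  LinearMap.surjective_of_injective_of_length_eq S.form
    ((injective_iff_map_eq_zero _).2 fun x hx => S.nondeg x fun y => by rw [hx]; rfl)
    (by rw [← Module.length_ne_top_iff, IsDualizingModule.length_dual S.isFiniteLength]
        exact Module.length_ne_top_iff.2 S.isFiniteLength)
    (IsDualizingModule.length_dual S.isFiniteLength).symm φ

/-- The map S → Hom(L, E) given by the form is onto, because maps on L extend to S and the form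
represents every map. Its kernel is L^⊥, and Hom(L, E) has the length of L. -/
theorem length_perp (L : Submodule R S) :
    Module.length R (S.perp L) + Module.length R L = Module.length R S := by
  have h := Module.length_eq_add_of_exact (S.perp L).subtype
    (L.subtype.lcomp R E ∘ₗ S.form) (Submodule.subtype_injective _) (fun φ => ?_) (fun x => ?_)
  · rw [h, IsDualizingModule.length_dual
      (S.isFiniteLength.of_injective (Submodule.subtype_injective L))]
  · obtain ⟨ψ, rfl⟩ := IsDualizingModule.exists_extension S.isFiniteLength L.subtype
      (Submodule.subtype_injective L) φ
    obtain ⟨x, rfl⟩ := S.form_surjective ψ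
    exact ⟨x, rfl⟩
  · constructor
    · intro hx
      exact ⟨⟨x, fun y hy => LinearMap.congr_fun hx ⟨y, hy⟩⟩, rfl⟩
    · rintro ⟨x, rfl⟩
      exact LinearMap.ext fun y => x.2 y.1 y.2

theorem perp_perp (L : Submodule R S) : S.perp (S.perp L) = L := by
  refine le_antisymm ?_ (le_perp_perp L)
  have hfin : ∀ N : Submodule R S, IsFiniteLength R N := fun N =>
    S.isFiniteLength.of_injective (Submodule.subtype_injective N)
  have h1 : Module.length R (S.perp L) + Module.length R L =
      Module.length R (S.perp L) + Module.length R (S.perp (S.perp L)) := by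
    rw [length_perp, add_comm, length_perp]
  have h2 := ENat.add_right_injective_of_ne_top (Module.length_ne_top_iff.2 (hfin _)) h1
  have h3 := LinearMap.surjective_of_injective_of_length_eq (Submodule.inclusion (le_perp_perp L))
    (Submodule.inclusion_injective _) (hfin _) h2
  intro x hx
  obtain ⟨y, hy⟩ := h3 ⟨x, hx⟩
  obtain rfl : y.1 = x := congrArg Subtype.val hy
  exact y.2

theorem perp_inf (L L' : Submodule R S) : S.perp (L ⊓ L') = S.perp L ⊔ S.perp L' := by
  rw [← perp_perp (S.perp L ⊔ S.perp L'), perp_sup, perp_perp, perp_perp]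

end

/-- A space is metabolic if it has a Lagrangian. -/
def IsMetabolic (S : FormSpace R E) : Prop := ∃ L : Submodule R S, S.perp L = L

/-- Descent of Lagrangians along `S ← K → V`, where `K → V` is onto and compatible with the forms
and the orthogonal complement of the image of `K` in `S` comes from the kernel of `K → V`. -/
theorem IsMetabolic.of_span [IsDualizingModule R E] (hS : S.IsMetabolic) {K : Type*}
    [AddCommGroup K] [Module R K] (j : K →ₗ[R] S) (p : K →ₗ[R] V) (hp : Function.Surjective p)
    (hform : ∀ x y, V.form (p x) (p y) = S.form (j x) (j y))
    (hj : ∀ s, (∀ k, S.form s (j k) = 0) → ∃ k, j k = s ∧ p k = 0) : V.IsMetabolic := by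
  obtain ⟨L, hL⟩ := hS
  refine ⟨(L.comap j).map p, le_antisymm ?_ ?_⟩
  · intro v hv
    obtain ⟨k, rfl⟩ := hp v
    -- This complement is L + (im j)^⊥. The second part is the image of elements killed by p, so k
    -- can be corrected by one of them, without changing p k, to have its image in L.
    have h1 : j k ∈ S.perp (L ⊓ LinearMap.range j) := by
      rintro _ ⟨h2, k', rfl⟩
      rw [← hform]
      exact hv _ ⟨k', h2, rfl⟩
    rw [perp_inf, hL] at h1
    obtain ⟨l, hl, s, hs, h3⟩ := Submodule.mem_sup.1 h1
    obtain ⟨k', rfl, hk'⟩ := hj s fun k => hs _ ⟨k, rfl⟩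
    refine ⟨k - k', ?_, by rw [map_sub, hk', sub_zero]⟩
    change j (k - k') ∈ L
    rwa [map_sub, ← h3, add_sub_cancel_right]
  · rintro _ ⟨x, hx, rfl⟩ _ ⟨y, hy, rfl⟩
    rw [hform]
    have hx' : j x ∈ L := hx
    rw [← hL] at hx'
    exact hx' _ hy

/-- Isometry of spaces. -/
def Isom (S T : FormSpace R E) : Prop :=
  ∃ f : S ≃ₗ[R] T, ∀ x y, T.form (f x) (f y) = S.form x y

theorem Isom.refl (S : FormSpace R E) : S.Isom S := ⟨LinearEquiv.refl R S, fun _ _ => rfl⟩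

theorem Isom.symm (h : S.Isom T) : T.Isom S := by
  obtain ⟨f, hf⟩ := h
  exact ⟨f.symm, fun x y => by rw [← hf, f.apply_symm_apply, f.apply_symm_apply]⟩

theorem Isom.trans (h : S.Isom T) (h' : T.Isom U) : S.Isom U := by
  obtain ⟨f, hf⟩ := h
  obtain ⟨g, hg⟩ := h'
  exact ⟨f.trans g, fun x y => by
    rw [LinearEquiv.trans_apply, LinearEquiv.trans_apply, hg, hf]⟩

theorem Isom.length_eq (h : S.Isom T) : Module.length R S = Module.length R T := by
  obtain ⟨f, -⟩ := h
  exact f.length_eq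

theorem IsMetabolic.of_isom (hS : S.IsMetabolic) (h : S.Isom T) : T.IsMetabolic := by
  obtain ⟨L, hL⟩ := hS
  obtain ⟨f, hf⟩ := h
  refine ⟨L.map f.toLinearMap, ?_⟩
  ext x
  obtain ⟨x, rfl⟩ := f.surjective x
  have h1 : f x ∈ L.map f.toLinearMap ↔ x ∈ L :=
    ⟨by rintro ⟨y, hy, h⟩; rwa [← f.injective h], fun h => ⟨x, h, rfl⟩⟩
  rw [h1]
  conv_rhs => rw [← hL]
  refine ⟨fun h y hy => ?_, ?_⟩
  · rw [← hf]
    exact h _ ⟨y, hy, rfl⟩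
  · rintro h _ ⟨y, hy, rfl⟩
    exact (hf x y).trans (h y hy)

/-- The orthogonal sum. -/
abbrev orth (S T : FormSpace R E) : FormSpace R E where
  carrier := S × T
  isFiniteLength := S.isFiniteLength.prod' R T.isFiniteLength
  form := LinearMap.mk₂ R (fun x y => S.form x.1 y.1 + T.form x.2 y.2)
    (fun x y z => by
      simp only [Prod.fst_add, Prod.snd_add, map_add, LinearMap.add_apply]
      abel)
    (fun r x y => by simp only [Prod.smul_fst, Prod.smul_snd, map_smul, LinearMap.smul_apply,
      smul_add])
    (fun x y z => by
      simp only [Prod.fst_add, Prod.snd_add, map_add]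
      abel)
    (fun r x y => by simp only [Prod.smul_fst, Prod.smul_snd, map_smul, smul_add])
  symm x y := by
    simp only [LinearMap.mk₂_apply, S.symm x.1, T.symm x.2]
  nondeg x hx := by
    refine Prod.ext (S.nondeg _ fun y => ?_) (T.nondeg _ fun y => ?_)
    · simpa using hx (y, 0)
    · simpa using hx (0, y)

theorem orth_form (x y : S.orth T) : (S.orth T).form x y = S.form x.1 y.1 + T.form x.2 y.2 := rfl

theorem orth_length : Module.length R (S.orth T) = Module.length R S + Module.length R T :=
  Module.length_prod ..

/-- The space with the opposite form. -/
abbrev neg (S : FormSpace R E) : FormSpace R E where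
  carrier := S
  isFiniteLength := S.isFiniteLength
  form := -S.form
  symm x y := by rw [LinearMap.neg_apply, LinearMap.neg_apply, LinearMap.neg_apply,
    LinearMap.neg_apply, S.symm]
  nondeg x hx := S.nondeg x fun y => neg_eq_zero.1 (hx y)

variable (R E) in
/-- The zero space. -/
abbrev zero : FormSpace R E where
  carrier := PUnit
  isFiniteLength := .of_subsingleton
  form := 0
  symm _ _ := rfl
  nondeg _ _ := rfl

theorem Isom.orth_congr {S' T' : FormSpace R E} (h : S.Isom S') (h' : T.Isom T') :
    (S.orth T).Isom (S'.orth T') := by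
  obtain ⟨f, hf⟩ := h
  obtain ⟨g, hg⟩ := h'
  refine ⟨LinearEquiv.prodCongr f g, fun x y => ?_⟩
  rw [orth_form, orth_form, ← hf, ← hg]
  rfl

theorem Isom.neg_congr (h : S.Isom T) : S.neg.Isom T.neg := by
  obtain ⟨f, hf⟩ := h
  exact ⟨f, fun x y => congrArg Neg.neg (hf x y)⟩

theorem orth_comm_isom (S T : FormSpace R E) : (S.orth T).Isom (T.orth S) :=
  ⟨LinearEquiv.prodComm R S T, fun x y => by
    rw [orth_form, orth_form, add_comm]
    rfl⟩

theorem orth_assoc_isom (S T U : FormSpace R E) :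
    ((S.orth T).orth U).Isom (S.orth (T.orth U)) :=
  ⟨LinearEquiv.prodAssoc R S T U, fun _ _ => (add_assoc _ _ _).symm⟩

theorem orth_zero_isom (S : FormSpace R E) : (S.orth (zero R E)).Isom S :=
  ⟨(LinearEquiv.prodUnique : (S × PUnit.{u + 1}) ≃ₗ[R] S), fun x y =>
    (add_zero (S.form x.1 y.1)).symm⟩

theorem neg_orth_isom (S T : FormSpace R E) : (S.orth T).neg.Isom (S.neg.orth T.neg) :=
  ⟨LinearEquiv.refl R _, fun _ _ => (neg_add _ _).symm⟩

theorem neg_neg_isom (S : FormSpace R E) : S.neg.neg.Isom S :=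
  ⟨LinearEquiv.refl R _, fun x y => (neg_neg (S.form x y)).symm⟩

theorem orth_orth_comm_isom (S T U V : FormSpace R E) :
    ((S.orth T).orth (U.orth V)).Isom ((S.orth U).orth (T.orth V)) :=
  ⟨LinearEquiv.prodProdProdComm R S T U V, fun _ _ => add_add_add_comm _ _ _ _⟩

/-- A pair (x, y) is orthogonal to the diagonal exactly when x - y is in the radical, which is zero.
-/
theorem perp_diagonal (S : FormSpace R E) : (S.orth S.neg).perp
    (LinearMap.range (LinearMap.prod LinearMap.id LinearMap.id : S →ₗ[R] S × S)) =
      LinearMap.range (LinearMap.prod LinearMap.id LinearMap.id : S →ₗ[R] S × S) := by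
  ext ⟨x, y⟩
  constructor
  · intro h
    have h1 : (x - y : S) = 0 := S.nondeg _ fun z => by
      have : S.form x z + -S.form y z = 0 := h (z, z) ⟨z, rfl⟩
      rw [map_sub, LinearMap.sub_apply, sub_eq_add_neg]
      exact this
    exact ⟨x, Prod.ext rfl (sub_eq_zero.1 h1)⟩
  · rintro ⟨z, hz⟩ _ ⟨w, rfl⟩
    rw [← hz]
    exact add_neg_cancel _

theorem isMetabolic_orth_neg (S : FormSpace R E) : (S.orth S.neg).IsMetabolic :=
  ⟨_, perp_diagonal S⟩

theorem perp_prod (L : Submodule R S) (P : Submodule R T) :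
    (S.orth T).perp (L.prod P) = (S.perp L).prod (T.perp P) := by
  ext ⟨x, y⟩
  constructor
  · intro h
    refine ⟨fun z hz => ?_, fun z hz => ?_⟩
    · have : S.form x z + T.form y 0 = 0 := h (z, 0) ⟨hz, P.zero_mem⟩
      simpa using this
    · have : S.form x 0 + T.form y z = 0 := h (0, z) ⟨L.zero_mem, hz⟩
      simpa using this
  · rintro ⟨hx, hy⟩ z ⟨hz1, hz2⟩
    exact (congrArg₂ (· + ·) (hx _ hz1) (hy _ hz2)).trans (add_zero 0)

theorem IsMetabolic.orth (hS : S.IsMetabolic) (hT : T.IsMetabolic) : (S.orth T).IsMetabolic := by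
  obtain ⟨L, hL⟩ := hS
  obtain ⟨P, hP⟩ := hT
  exact ⟨L.prod P, by rw [perp_prod, hL, hP]⟩

theorem IsMetabolic.neg (hS : S.IsMetabolic) : S.neg.IsMetabolic := by
  obtain ⟨L, hL⟩ := hS
  refine ⟨L, Eq.trans ?_ hL⟩
  ext x
  exact ⟨fun h y hy => neg_eq_zero.1 (h y hy), fun h y hy => neg_eq_zero.2 (h y hy)⟩

variable [IsDualizingModule R E]

/-- Descent along V × P → V for a Lagrangian P of S: the orthogonal complement of V × P is 0 × P,
which is the kernel of the projection. -/
theorem IsMetabolic.cancel (h : (V.orth S).IsMetabolic) (hS : S.IsMetabolic) : V.IsMetabolic := by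
  obtain ⟨P, hP⟩ := hS
  refine h.of_span (K := V × P) (LinearMap.prodMap LinearMap.id P.subtype) (LinearMap.fst R V P)
    LinearMap.fst_surjective (fun x y => ?_) (fun s hs => ?_)
  · rw [orth_form]
    have hx : x.2.1 ∈ S.perp P := hP.ge x.2.2
    exact ((congrArg (_ + ·) (hx _ y.2.2)).trans (add_zero _)).symm
  · have h1 : s.1 = 0 := V.nondeg _ fun y => by
      have : V.form s.1 y + S.form s.2 0 = 0 := hs (y, 0)
      simpa using this
    have h2 : s.2 ∈ P := by
      rw [← hP]
      intro y hy
      have : V.form s.1 0 + S.form s.2 y = 0 := hs (0, ⟨y, hy⟩)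
      simpa using this
    exact ⟨(0, ⟨s.2, h2⟩), Prod.ext h1.symm rfl, rfl⟩

/-- Witt equivalence of spaces. -/
def WittEquiv (S T : FormSpace R E) : Prop := (S.orth T.neg).IsMetabolic

omit [IsDualizingModule R E] in
theorem WittEquiv.of_isom (h : S.Isom T) : S.WittEquiv T :=
  (isMetabolic_orth_neg S).of_isom ((Isom.refl S).orth_congr h.neg_congr)

omit [IsDualizingModule R E] in
theorem WittEquiv.symm (h : S.WittEquiv T) : T.WittEquiv S :=
  h.neg.of_isom ((neg_orth_isom S T.neg).trans
    ((orth_comm_isom _ _).trans ((neg_neg_isom T).orth_congr (Isom.refl _))))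

/-- Descent along S × T × U → S × U, where T is placed diagonally in -T ⊥ T. The orthogonal
complement of the image is that diagonal. -/
theorem WittEquiv.trans (h : S.WittEquiv T) (h' : T.WittEquiv U) : S.WittEquiv U := by
  refine (h.orth h').of_span (K := S × T × U)
    (LinearMap.prod (LinearMap.prodMap LinearMap.id (LinearMap.fst R T U)) (LinearMap.snd R S _))
    (LinearMap.prodMap LinearMap.id (LinearMap.snd R T U))
    (fun x => ⟨(x.1, 0, x.2), rfl⟩) (fun x y => ?_) (fun s hs => ?_)
  · change S.form x.1 y.1 + -U.form x.2.2 y.2.2 =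
      S.form x.1 y.1 + -T.form x.2.1 y.2.1 + (T.form x.2.1 y.2.1 + -U.form x.2.2 y.2.2)
    abel
  · obtain ⟨⟨s, t⟩, ⟨t', w⟩⟩ := s
    have hs' : ∀ (a : S) (b : T) (c : U),
        S.form s a + -T.form t b + (T.form t' b + -U.form w c) = 0 := fun a b c => hs (a, b, c)
    have h1 : s = 0 := S.nondeg _ fun y => by simpa using hs' y 0 0
    have h2 : w = 0 := U.nondeg _ fun y => by simpa using hs' 0 0 y
    have h3 : t' - t = 0 := T.nondeg _ fun y => by
      rw [map_sub, LinearMap.sub_apply, sub_eq_neg_add]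
      simpa using hs' 0 y 0
    obtain rfl := sub_eq_zero.1 h3
    exact ⟨(s, t', w), rfl, Prod.ext h1 h2⟩

omit [IsDualizingModule R E] in
theorem WittEquiv.orth_congr {S' T' : FormSpace R E} (h : S.WittEquiv S') (h' : T.WittEquiv T') :
    (S.orth T).WittEquiv (S'.orth T') :=
  (h.orth h').of_isom ((orth_orth_comm_isom S S'.neg T T'.neg).trans
    ((Isom.refl _).orth_congr (neg_orth_isom S' T').symm))

theorem WittEquiv.isMetabolic (h : S.WittEquiv T) (hT : T.IsMetabolic) : S.IsMetabolic :=
  h.cancel hT.neg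

omit [IsDualizingModule R E] in
theorem WittEquiv.orth_of_isMetabolic (S : FormSpace R E) (hT : T.IsMetabolic) :
    S.WittEquiv (S.orth T) :=
  ((isMetabolic_orth_neg S).orth hT.neg).of_isom
    ((orth_assoc_isom _ _ _).trans ((Isom.refl S).orth_congr (neg_orth_isom S T).symm))

section Reduction

variable (S) (L : Submodule R S)

-- An element of L ∩ L^⊥ is orthogonal to L^⊥, so the form on the quotient is well defined without
-- assuming L isotropic.
omit [IsDualizingModule R E] in
theorem form_eq_of_mkQ_eq {x x' y y' : S.perp L}
    (hx : (L.submoduleOf (S.perp L)).mkQ x = (L.submoduleOf (S.perp L)).mkQ x')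
    (hy : (L.submoduleOf (S.perp L)).mkQ y = (L.submoduleOf (S.perp L)).mkQ y') :
    S.form x y = S.form x' y' := by
  have h1 : x - x' ∈ L.submoduleOf (S.perp L) := (Submodule.Quotient.eq _).1 hx
  have h2 : y - y' ∈ L.submoduleOf (S.perp L) := (Submodule.Quotient.eq _).1 hy
  have h3 := y.2 _ h1
  have h4 := x'.2 _ h2
  dsimp only [Submodule.subtype_apply] at h3 h4
  rw [S.symm, AddSubgroupClass.coe_sub, map_sub, LinearMap.sub_apply, sub_eq_zero] at h3
  rw [AddSubgroupClass.coe_sub, map_sub, sub_eq_zero] at h4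
  rw [h3, h4]

/-- The space `L^⊥ ⧸ L` for an isotropic submodule `L`. -/
def reduction : FormSpace R E where
  carrier := S.perp L ⧸ L.submoduleOf (S.perp L)
  isFiniteLength := (S.isFiniteLength.of_injective
    (Submodule.subtype_injective (S.perp L))).of_surjective (Submodule.mkQ_surjective _)
  form := LinearMap.mk₂ R (fun x y => S.form x.out.1 y.out.1)
    (fun x y z => by
      rw [← LinearMap.add_apply, ← map_add]
      exact form_eq_of_mkQ_eq S L (y := z.out) (x' := x.out + y.out) (by simp) rfl)
    (fun r x y => by
      rw [← LinearMap.smul_apply, ← map_smul]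
      exact form_eq_of_mkQ_eq S L (y := y.out) (x' := r • x.out) (by simp) rfl)
    (fun x y z => by
      rw [← map_add]
      exact form_eq_of_mkQ_eq S L (x := x.out) (y' := y.out + z.out) rfl (by simp))
    (fun r x y => by
      rw [← map_smul]
      exact form_eq_of_mkQ_eq S L (x := x.out) (y' := r • y.out) rfl (by simp))
  symm x y := S.symm _ _
  nondeg x hx := by
    obtain ⟨k, rfl⟩ := Submodule.mkQ_surjective _ x
    refine (Submodule.Quotient.mk_eq_zero _).2 ?_
    change k.1 ∈ L
    refine (perp_perp L).le fun y hy => ?_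
    exact (form_eq_of_mkQ_eq S L (y := ⟨y, hy⟩) (x' := Quotient.out _)
      (by simp) (by simp)).trans (hx ((L.submoduleOf (S.perp L)).mkQ ⟨y, hy⟩))

theorem reduction_form (x y : S.perp L) :
    (S.reduction L).form ((L.submoduleOf (S.perp L)).mkQ x) ((L.submoduleOf (S.perp L)).mkQ y) =
      S.form x y :=
  form_eq_of_mkQ_eq S L (by simp) (by simp)

/-- The graph of L^⊥ → L^⊥/L is a Lagrangian of S ⊥ -(L^⊥/L). -/
theorem wittEquiv_reduction (hL : L ≤ S.perp L) : S.WittEquiv (S.reduction L) := by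
  refine ⟨LinearMap.range (LinearMap.prod (S.perp L).subtype (L.submoduleOf (S.perp L)).mkQ), ?_⟩
  ext ⟨x, y⟩
  obtain ⟨y, rfl⟩ := Submodule.mkQ_surjective _ y
  constructor
  · intro h
    have h1 : x - y.1 ∈ L := by
      refine (perp_perp L).le fun z hz => ?_
      have h2 : S.form x z + -(S.reduction L).form ((L.submoduleOf (S.perp L)).mkQ y)
        ((L.submoduleOf (S.perp L)).mkQ ⟨z, hz⟩) = 0 := h (z, _) ⟨⟨z, hz⟩, rfl⟩
      rw [reduction_form] at h2
      rw [map_sub, LinearMap.sub_apply, sub_eq_add_neg]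
      exact h2
    have h2 : x ∈ S.perp L := by
      have := (S.perp L).add_mem (hL h1) y.2
      rwa [sub_add_cancel] at this
    refine ⟨⟨x, h2⟩, Prod.ext rfl ?_⟩
    exact (Submodule.Quotient.eq _).2 h1
  · rintro ⟨z, hz⟩ _ ⟨w, rfl⟩
    rw [← hz]
    change S.form z w + -(S.reduction L).form ((L.submoduleOf (S.perp L)).mkQ z)
      ((L.submoduleOf (S.perp L)).mkQ w) = 0
    rw [reduction_form, add_neg_cancel]

theorem length_reduction (hL : L ≤ S.perp L) :
    Module.length R (S.reduction L) + Module.length R L + Module.length R L =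
      Module.length R S := by
  have h := Module.length_eq_add_of_exact (L.submoduleOf (S.perp L)).subtype
    (L.submoduleOf (S.perp L)).mkQ (Submodule.subtype_injective _) (Submodule.mkQ_surjective _)
    (LinearMap.exact_subtype_mkQ _)
  rw [(Submodule.submoduleOfEquivOfLe hL).length_eq] at h
  rw [← length_perp L, h, add_comm (Module.length R L)]
  rfl

end Reduction

/-- The restriction of the form to a submodule that meets its orthogonal complement trivially. -/
def restrict (S : FormSpace R E) (L : Submodule R S) (hL : L ⊓ S.perp L = ⊥) : FormSpace R E where
  carrier := L
  isFiniteLength := S.isFiniteLength.of_injective (Submodule.subtype_injective L)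
  form := (S.form.comp L.subtype).compl₂ L.subtype
  symm x y := S.symm _ _
  nondeg x hx := Subtype.ext <| (Submodule.mem_bot R).1 <| by
    rw [← hL]
    exact ⟨x.2, fun y hy => hx ⟨y, hy⟩⟩

-- A map compatible with nondegenerate forms is automatically injective, so equal lengths make it
-- bijective.
omit [IsDualizingModule R E] in
theorem Isom.of_length_eq (f : S →ₗ[R] T) (hf : ∀ x y, T.form (f x) (f y) = S.form x y)
    (h : Module.length R S = Module.length R T) : S.Isom T := by
  have hinj : Function.Injective f := (injective_iff_map_eq_zero f).2 fun x hx =>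
    S.nondeg x fun y => by rw [← hf, hx, map_zero, LinearMap.zero_apply]
  exact ⟨LinearEquiv.ofBijective f
    ⟨hinj, LinearMap.surjective_of_injective_of_length_eq f hinj T.isFiniteLength h⟩, hf⟩

end FormSpace

section Diagonal

open IsLocalRing

variable [IsLocalRing R]

/-- An isomorphism of the residue field with the socle of `E`. -/
structure SocleIso where
  map : ResidueField R →ₗ[R] E
  injective : Function.Injective map
  exists_of_smul_eq_zero : ∀ e, (∀ r ∈ maximalIdeal R, r • e = 0) → ∃ t, map t = e

namespace FormSpace

variable {R E} (ε : SocleIso R E)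

/-- The one-dimensional form `⟨a⟩`. -/
def line (a : (ResidueField R)ˣ) : FormSpace R E where
  carrier := ResidueField R
  addCommGroup := NonUnitalNonAssocRing.toAddCommGroup
  module := Algebra.toModule
  isFiniteLength := (residueObj R).property
  form := LinearMap.mk₂ R (fun x y => ε.map (a * x * y))
    (fun x y z => by rw [mul_add, add_mul, map_add])
    (fun r x y => by rw [← map_smul, mul_smul_comm, smul_mul_assoc])
    (fun x y z => by rw [mul_add, map_add])
    (fun r x y => by rw [← map_smul, mul_smul_comm])
  symm x y := by simp only [LinearMap.mk₂_apply]; rw [mul_right_comm]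
  nondeg x hx := by
    have := (injective_iff_map_eq_zero ε.map).1 ε.injective _ (hx 1)
    simpa using this

theorem line_length (a : (ResidueField R)ˣ) : Module.length R (line ε a) = 1 :=
  Module.length_eq_one R (residueObj R).obj

theorem line_neg_isom (a : (ResidueField R)ˣ) : (line ε (-a)).Isom (line ε a).neg :=
  ⟨LinearEquiv.refl R (ResidueField R), fun (x y : ResidueField R) => by
    change -ε.map (a * x * y) = ε.map ((-a : (ResidueField R)ˣ) * x * y)
    rw [← map_neg, Units.val_neg, neg_mul, neg_mul]⟩

theorem isMetabolic_line_neg (a : (ResidueField R)ˣ) :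
    ((line ε a).orth (line ε (-a))).IsMetabolic :=
  (isMetabolic_orth_neg (line ε a)).of_isom ((Isom.refl _).orth_congr (line_neg_isom ε a).symm)

/-- The diagonal form `⟨a₁, …, aₙ⟩`. -/
def diag : List (ResidueField R)ˣ → FormSpace R E
  | [] => zero R E
  | a :: l => (line ε a).orth (diag l)

theorem diag_length (l : List (ResidueField R)ˣ) : Module.length R (diag ε l) = l.length := by
  induction l with
  | nil => exact Module.length_eq_zero (M := PUnit.{u + 1})
  | cons a l ih =>
    rw [diag, orth_length, line_length, ih, List.length_cons, Nat.cast_succ, add_comm]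

theorem diag_append_isom (l l' : List (ResidueField R)ˣ) :
    (diag ε (l ++ l')).Isom ((diag ε l).orth (diag ε l')) := by
  induction l with
  | nil => exact ((orth_comm_isom _ _).trans (orth_zero_isom _)).symm
  | cons a l ih => exact ((Isom.refl _).orth_congr ih).trans (orth_assoc_isom _ _ _).symm

theorem diag_perm_isom {l l' : List (ResidueField R)ˣ} (h : l.Perm l') :
    (diag ε l).Isom (diag ε l') := by
  induction h with
  | nil => exact Isom.refl _
  | cons a _ ih => exact (Isom.refl _).orth_congr ih
  | swap a b l =>
    exact (orth_assoc_isom _ _ _).symm.trans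
      (((orth_comm_isom _ _).orth_congr (Isom.refl _)).trans (orth_assoc_isom _ _ _))
  | trans _ _ h h' => exact h.trans h'

theorem diag_neg_isom (l : List (ResidueField R)ˣ) :
    (diag ε (l.map Neg.neg)).Isom (diag ε l).neg := by
  induction l with
  | nil => exact ⟨LinearEquiv.refl R _, fun x y => neg_zero⟩
  | cons a l ih => exact ((line_neg_isom ε a).orth_congr ih).trans (neg_orth_isom _ _).symm

theorem exists_simple {M : Type u} [AddCommGroup M] [Module R M] (hM : IsFiniteLength R M)
    [Nontrivial M] : ∃ s : M, (∀ r : R, r • s = 0 ↔ r ∈ maximalIdeal R) := by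
  obtain ⟨_, _⟩ := isFiniteLength_iff_isNoetherian_isArtinian.1 hM
  obtain ⟨P, hP, -⟩ :=
    (IsAtomic.eq_bot_or_exists_atom_le (⊤ : Submodule R M)).resolve_left top_ne_bot
  have : IsSimpleModule R P := isSimpleModule_iff_isAtom.2 hP
  obtain ⟨I, hI, ⟨φ⟩⟩ := isSimpleModule_iff_quot_maximal.1 this
  obtain rfl := eq_maximalIdeal hI
  obtain ⟨s, hs, -⟩ := exists_generator_of_equiv_residueObj φ
  exact ⟨s, fun r => by rw [← hs r, ← Submodule.coe_smul, Submodule.coe_eq_zero]⟩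

/-- The map from the residue field to a module given by an element killed by the maximal ideal. -/
def residueMap {M : Type u} [AddCommGroup M] [Module R M] (s : M)
    (h : ∀ r : R, r • s = 0 ↔ r ∈ maximalIdeal R) : ResidueField R →ₗ[R] M :=
  Submodule.liftQ (maximalIdeal R) (LinearMap.toSpanSingleton R M s) fun r hr => (h r).2 hr

theorem length_span_singleton {M : Type u} [AddCommGroup M] [Module R M] (s : M)
    (h : ∀ r : R, r • s = 0 ↔ r ∈ maximalIdeal R) :
    Module.length R (Submodule.span R {s}) = 1 := by
  have h1 : LinearMap.ker (LinearMap.toSpanSingleton R M s) = maximalIdeal R := by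
    ext r
    exact h r
  rw [← LinearMap.range_toSpanSingleton,
    ← (LinearMap.quotKerEquivRange (LinearMap.toSpanSingleton R M s)).length_eq, h1]
  exact Module.length_eq_one R (residueObj R).obj

variable [IsDualizingModule R E]

/-- Every space is Witt equivalent to a diagonal form of the same length. -/
theorem exists_wittEquiv_diag (S : FormSpace R E) :
    ∃ l : List (ResidueField R)ˣ, S.WittEquiv (diag ε l) ∧ Module.length R S = l.length := by
  obtain ⟨n, hn⟩ := ENat.ne_top_iff_exists.1 (Module.length_ne_top_iff.2 S.isFiniteLength)
  induction n using Nat.strong_induction_on generalizing S with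
  | _ n ih =>
  rcases subsingleton_or_nontrivial S with hS | hS
  · refine ⟨[], WittEquiv.of_isom (Isom.of_length_eq 0 (fun x y => ?_) ?_),
      Module.length_eq_zero⟩
    · rw [Subsingleton.elim x 0, map_zero, map_zero, map_zero, LinearMap.zero_apply,
        LinearMap.zero_apply]
    · exact Module.length_eq_zero.trans (Module.length_eq_zero (M := PUnit.{u + 1})).symm
  obtain ⟨s, hs⟩ := exists_simple S.isFiniteLength
  let P := Submodule.span R {s}
  have hP : Module.length R P = 1 := length_span_singleton s hs
  -- If the simple submodule P is isotropic, P^⊥/P is shorter by two and ⟨1⟩ ⊥ ⟨-1⟩, which is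
  -- metabolic, restores the length. Otherwise P is an orthogonal summand.
  by_cases hss : S.form s s = 0
  · have hPP : P ≤ S.perp P := by
      rw [Submodule.span_singleton_le_iff_mem]
      intro y hy
      obtain ⟨r, rfl⟩ := Submodule.mem_span_singleton.1 hy
      rw [map_smul, hss, smul_zero]
    have h1 := length_reduction S P hPP
    rw [hP, ← hn] at h1
    obtain ⟨m, hm⟩ := ENat.ne_top_iff_exists.1
      (Module.length_ne_top_iff.2 (S.reduction P).isFiniteLength)
    rw [← hm] at h1
    have h2 : m + 1 + 1 = n := by exact_mod_cast h1
    obtain ⟨l, hl, hlen⟩ := ih m (by lia) (S.reduction P) hm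
    refine ⟨1 :: -1 :: l, (S.wittEquiv_reduction P hPP).trans (hl.trans
      ((WittEquiv.orth_of_isMetabolic (diag ε l) (isMetabolic_line_neg ε 1)).trans
        (WittEquiv.of_isom ((orth_comm_isom _ _).trans (orth_assoc_isom _ _ _))))), ?_⟩
    rw [← hm] at hlen
    rw [← hn, ← h2, List.length_cons, List.length_cons]
    norm_cast at hlen ⊢
    rw [hlen]
  -- The value lies in the socle because 𝔪 kills s; its preimage t in the residue field is the
  -- diagonal entry.
  · obtain ⟨t, ht⟩ := ε.exists_of_smul_eq_zero (S.form s s) fun r hr => by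
      rw [← map_smul, (hs r).2 hr, map_zero]
    have ht0 : t ≠ 0 := by
      rintro rfl
      exact hss (by rw [← ht, map_zero])
    have hres : ∀ r : R, r • S.form s s = 0 → r • s = 0 := by
      intro r hr
      rw [← ht, ← map_smul] at hr
      have := (injective_iff_map_eq_zero ε.map).1 ε.injective _ hr
      rw [Algebra.smul_def, mul_eq_zero, or_iff_left ht0] at this
      exact (hs r).2 ((residue_eq_zero_iff r).1 this)
    have hinf : S.perp P ⊓ S.perp (S.perp P) = ⊥ := by
      rw [perp_perp, eq_bot_iff]
      rintro x ⟨hx, hxP⟩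
      obtain ⟨r, rfl⟩ := Submodule.mem_span_singleton.1 hxP
      have := hx s (Submodule.mem_span_singleton_self s)
      rw [map_smul, LinearMap.smul_apply] at this
      exact (Submodule.mem_bot R).2 (hres r this)
    let T := S.restrict (S.perp P) hinf
    have h1 := length_perp P
    rw [hP, ← hn] at h1
    obtain ⟨m, hm⟩ := ENat.ne_top_iff_exists.1 (Module.length_ne_top_iff.2 T.isFiniteLength)
    have h2 : m + 1 = n := by
      have : (m : ℕ∞) + 1 = n := by rw [← h1, hm]; rfl
      exact_mod_cast this
    obtain ⟨l, hl, hlen⟩ := ih m (by lia) T hm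
    have hiso : ((line ε (Units.mk0 t ht0)).orth T).Isom S := by
      refine Isom.of_length_eq
        (LinearMap.coprod (residueMap s hs) (S.perp P).subtype) ?_ ?_
      · rintro ⟨x, y⟩ ⟨x', y'⟩
        obtain ⟨r, rfl⟩ := residue_surjective (R := R) x
        obtain ⟨r', rfl⟩ := residue_surjective (R := R) x'
        change S.form (r • s + y.1) (r' • s + y'.1) =
          ε.map (t * residue R r * residue R r') + S.form y.1 y'.1
        have h3 : S.form y.1 s = 0 := y.2 s (Submodule.mem_span_singleton_self s)
        have h4 : S.form s y'.1 = 0 := by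
          rw [S.symm]; exact y'.2 s (Submodule.mem_span_singleton_self s)
        have h5 : t * residue R r * residue R r' = (r * r') • t := by
          rw [Algebra.smul_def, ResidueField.algebraMap_eq, map_mul]
          ring
        rw [h5, map_smul, ht]
        simp only [map_add, map_smul, LinearMap.add_apply, LinearMap.smul_apply, h3, h4, smul_zero,
          add_zero, zero_add, mul_smul]
        rw [smul_comm]
      · rw [orth_length, line_length, ← hm, ← hn, ← h2, add_comm]
        norm_cast
    refine ⟨Units.mk0 t ht0 :: l, (WittEquiv.of_isom hiso.symm).trans
      (((WittEquiv.of_isom (Isom.refl _)).orth_congr hl)), ?_⟩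
    rw [← hm] at hlen
    rw [← hn, ← h2, List.length_cons]
    norm_cast at hlen ⊢
    rw [hlen]

end FormSpace

end Diagonal

end FormSpaces

/-! ### Additive invariants of diagonal forms -/

section DiagonalRelations

open IsLocalRing FormSpace

variable {R : Type u} [CommRing R] [IsLocalRing R] {E : Type u} [AddCommGroup E] [Module R E]
  (ε : SocleIso R E)

/-- A function on the units of a field that satisfies the relations between the classes of
one-dimensional forms in the Grothendieck-Witt group. -/
structure IsFormInvariant {F A : Type*} [Field F] [AddCommGroup A] (f : Fˣ → A) : Prop where
  mul_sq (a b : Fˣ) : f (a * b ^ 2) = f a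
  add_eq (a b c : Fˣ) (h : (c : F) = a + b) : f a + f b = f c + f (a * b * c)
  add_neg (a : Fˣ) : f a + f (-a) = f 1 + f (-1)

namespace FormSpace

theorem line_mul_sq_isom (a b : (ResidueField R)ˣ) : (line ε a).Isom (line ε (a * b ^ 2)) := by
  refine Isom.symm
    ⟨(LinearEquiv.smulOfUnit b : ResidueField R ≃ₗ[ResidueField R] _).restrictScalars R,
    fun (x y : ResidueField R) => ?_⟩
  change ε.map (a * (b * x) * (b * y)) = ε.map ((a * b ^ 2 : (ResidueField R)ˣ) * x * y)
  congr 1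
  push_cast
  ring

/-- The change of basis is (x, y) ↦ (x + b y, x - a y): its columns (1, 1) and (b, -a) are
orthogonal for ⟨a, b⟩, with values a + b and a b (a + b). -/
theorem line_orth_isom (a b c : (ResidueField R)ˣ) (h : (c : ResidueField R) = a + b) :
    ((line ε c).orth (line ε (a * b * c))).Isom ((line ε a).orth (line ε b)) := by
  refine Isom.of_length_eq (LinearMap.prod
    (LinearMap.coprod LinearMap.id
      ((LinearMap.mulLeft (ResidueField R) (b : ResidueField R)).restrictScalars R))
    (LinearMap.coprod LinearMap.id
      ((LinearMap.mulLeft (ResidueField R) (-a : ResidueField R)).restrictScalars R))) ?_ ?_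
  · rintro ⟨(x : ResidueField R), (y : ResidueField R)⟩
      ⟨(x' : ResidueField R), (y' : ResidueField R)⟩
    change ε.map (a * (x + b * y) * (x' + b * y')) + ε.map (b * (x + -a * y) * (x' + -a * y')) =
      ε.map (c * x * x') + ε.map ((a * b * c : (ResidueField R)ˣ) * y * y')
    rw [← map_add, ← map_add]
    congr 1
    push_cast
    rw [h]
    ring
  · exact (orth_length (S := line ε c)).trans (by
      rw [orth_length, line_length, line_length, line_length, line_length])

/-- Each vector of a diagonal form gives a change of basis after which its nonzero coordinates
are equal to one. -/
theorem exists_diag_isom_of_vector {A : Type*} [AddCommGroup A]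
    {f : (ResidueField R)ˣ → A} (hf : IsFormInvariant f) (l : List (ResidueField R)ˣ)
    (v : diag ε l) : ∃ t z : List (ResidueField R)ˣ, (diag ε l).Isom (diag ε (t ++ z)) ∧
      (l.map f).sum = (t.map f).sum + (z.map f).sum ∧ l.length = t.length + z.length ∧
      (diag ε l).form v v = ε.map (t.map Units.val).sum ∧ (t = [] → v = 0) := by
  induction l with
  | nil => exact ⟨[], [], Isom.refl _, by simp, rfl, (map_zero ε.map).symm, fun _ => rfl⟩
  | cons a l ih =>
    obtain ⟨(x : ResidueField R), w⟩ := v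
    obtain ⟨t, z, h1, h2, h3, h4, h5⟩ := ih w
    have hform : (diag ε (a :: l)).form (x, w) (x, w) =
        ε.map (a * x * x) + ε.map (t.map Units.val).sum :=
      congrArg (ε.map (a * x * x) + ·) h4
    -- Entries where v has coordinate zero go to z; the others go to t, multiplied by the square of
    -- the coordinate.
    by_cases hx : x = 0
    · subst hx
      refine ⟨t, a :: z, ?_, ?_, ?_, ?_, ?_⟩
      · exact ((Isom.refl (line ε a)).orth_congr h1).trans
          (diag_perm_isom ε (List.perm_middle (l₁ := t) (l₂ := z) (a := a)).symm)
      · rw [List.map_cons, List.sum_cons, List.map_cons, List.sum_cons, h2]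
        abel
      · simp only [List.length_cons, h3]
        ring
      · rw [hform, mul_zero, map_zero, zero_add]
      · intro h
        exact Prod.ext rfl (h5 h)
    · refine ⟨(a * (Units.mk0 x hx) ^ 2) :: t, z, ?_, ?_, ?_, ?_, fun h => nomatch h⟩
      · exact (line_mul_sq_isom ε a (Units.mk0 x hx)).orth_congr h1
      · rw [List.map_cons, List.sum_cons, List.map_cons, List.sum_cons, h2, hf.mul_sq, add_assoc]
      · simp only [List.length_cons, h3]
        ring
      · rw [hform, List.map_cons, List.sum_cons, ← map_add]
        congr 2
        push_cast
        rw [Units.val_mk0]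
        ring

variable [IsDualizingModule R E]

theorem IsMetabolic.of_diag_cons_neg {a : (ResidueField R)ˣ} {l : List (ResidueField R)ˣ}
    (h : (diag ε (a :: -a :: l)).IsMetabolic) : (diag ε l).IsMetabolic :=
  IsMetabolic.cancel (h.of_isom ((orth_assoc_isom _ _ _).symm.trans (orth_comm_isom _ _)))
    (isMetabolic_line_neg ε a)

/-- The value of a form invariant on a metabolic diagonal form with a decomposition of an
isotropic vector. -/
theorem sum_eq_of_isMetabolic_append {A : Type*} [AddCommGroup A]
    {f : (ResidueField R)ˣ → A} (hf : IsFormInvariant f) (n : ℕ)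
    (ih : ∀ l : List (ResidueField R)ˣ, l.length < n → (diag ε l).IsMetabolic →
      ∃ k, l.length = 2 * k ∧ (l.map f).sum = k • (f 1 + f (-1)))
    (t z : List (ResidueField R)ˣ) (ht : t ≠ []) (hlen : t.length + z.length = n)
    (hsum : (t.map Units.val).sum = 0) (h : (diag ε (t ++ z)).IsMetabolic) :
    ∃ k, n = 2 * k ∧ (t.map f).sum + (z.map f).sum = k • (f 1 + f (-1)) := by
  induction hm : t.length generalizing t z with
  | zero => exact absurd (List.length_eq_zero_iff.1 hm) ht
  | succ m ihm =>
    match t, ht with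
    | [a], _ => simp at hsum
    | a :: b :: t, _ =>
      -- If a + b = 0, the plane ⟨a⟩ ⊥ ⟨-a⟩ cancels and the induction on the rank applies.
      by_cases hab : (a : ResidueField R) + b = 0
      · obtain rfl : b = -a := Units.ext (eq_neg_of_add_eq_zero_right hab)
        obtain ⟨k, hk, hk'⟩ := ih (t ++ z) (by
          simp only [List.length_cons] at hlen; rw [List.length_append]; lia)
          (IsMetabolic.of_diag_cons_neg ε h)
        refine ⟨k + 1, ?_, ?_⟩
        · rw [List.length_append] at hk
          simp only [List.length_cons] at hlen
          lia
        · rw [List.map_append, List.sum_append] at hk'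
          simp only [List.map_cons, List.sum_cons]
          rw [succ_nsmul, ← hk', ← hf.add_neg a]
          abel
      -- Otherwise ⟨a, b⟩ is replaced by ⟨c, abc⟩ with c = a + b. The sum of the entries of t is
      -- unchanged, t becomes shorter, and abc joins z.
      · let c := Units.mk0 _ hab
        have hc : (c : ResidueField R) = a + b := rfl
        have h1 : (diag ε ((c :: t) ++ (a * b * c :: z))).IsMetabolic := by
          refine h.of_isom (Isom.trans ?_ (diag_perm_isom ε
            ((List.perm_middle (l₁ := t) (l₂ := z) (a := a * b * c)).symm.cons c)))
          exact (orth_assoc_isom _ _ _).symm.trans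
            (((line_orth_isom ε a b c hc).symm.orth_congr (Isom.refl _)).trans
              (orth_assoc_isom _ _ _))
        obtain ⟨k, hk, hk'⟩ := ihm (c :: t) (a * b * c :: z) (List.cons_ne_nil _ _)
          (by simp only [List.length_cons] at hlen ⊢; lia)
          (by simpa [hc, add_assoc] using hsum) h1 (by simpa using hm)
        refine ⟨k, hk, ?_⟩
        rw [← hk']
        simp only [List.map_cons, List.sum_cons]
        have := hf.add_eq a b c hc
        rw [← add_assoc, this]
        abel

/-- A form invariant takes on a metabolic diagonal form the same value as on the sum of
hyperbolic planes of that rank. -/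
theorem exists_sum_eq_of_isMetabolic {A : Type*} [AddCommGroup A]
    {f : (ResidueField R)ˣ → A} (hf : IsFormInvariant f) (l : List (ResidueField R)ˣ)
    (h : (diag ε l).IsMetabolic) :
    ∃ k, l.length = 2 * k ∧ (l.map f).sum = k • (f 1 + f (-1)) := by
  induction hn : l.length using Nat.strong_induction_on generalizing l with
  | _ n ih =>
    rcases l with _ | ⟨a, l⟩
    · exact ⟨0, hn.symm, by simp⟩
    obtain ⟨L, hL⟩ := h
    -- A Lagrangian of a nonzero space is nonzero, since the orthogonal complement of 0 is
    -- everything. Each of its vectors is isotropic.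
    obtain ⟨v, hv, hv0⟩ : ∃ v ∈ L, v ≠ 0 := by
      by_contra! h0
      have h1 : L = ⊥ := (Submodule.eq_bot_iff L).2 h0
      have h2 : (diag ε (a :: l)).perp ⊥ = ⊤ := by
        rw [eq_top_iff]
        rintro x - y hy
        rw [(Submodule.mem_bot R).1 hy, map_zero]
      rw [h1, h2] at hL
      have h3 : ((1, 0) : ResidueField R × diag ε l) = 0 :=
        (Submodule.mem_bot R).1
          (hL.le (Submodule.mem_top (x := ((1, 0) : ResidueField R × diag ε l))))
      exact one_ne_zero (congrArg Prod.fst h3)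
    obtain ⟨t, z, h1, h2, h3, h4, h5⟩ := exists_diag_isom_of_vector ε hf (a :: l) v
    have h6 : (diag ε (a :: l)).form v v = 0 := hL.ge hv v hv
    rw [h4] at h6
    obtain ⟨k, hk, hk'⟩ := sum_eq_of_isMetabolic_append ε hf n
      (fun l' hl' hmet => ih _ hl' l' hmet rfl) t z (fun h => hv0 (h5 h)) (by rw [← h3, hn])
      ((injective_iff_map_eq_zero ε.map).1 ε.injective _ h6) (IsMetabolic.of_isom ⟨L, hL⟩ h1)
    exact ⟨k, hk, by rw [h2, hk']⟩

/-- The form l ⊥ -l' is metabolic, so f takes on it the value of a sum of hyperbolic planes. On l' ⊥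
-l' it takes the same value by ⟨a⟩ + ⟨-a⟩ = ⟨1⟩ + ⟨-1⟩; cancel -l'. -/
theorem sum_eq_of_wittEquiv {A : Type*} [AddCommGroup A]
    {f : (ResidueField R)ˣ → A} (hf : IsFormInvariant f) {l l' : List (ResidueField R)ˣ}
    (hl : l.length = l'.length) (h : (diag ε l).WittEquiv (diag ε l')) :
    (l.map f).sum = (l'.map f).sum := by
  have h1 : (diag ε (l ++ l'.map Neg.neg)).IsMetabolic :=
    IsMetabolic.of_isom h (((Isom.refl _).orth_congr (diag_neg_isom ε l').symm).trans
      (diag_append_isom ε _ _).symm)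
  obtain ⟨k, hk, hk'⟩ := exists_sum_eq_of_isMetabolic ε hf _ h1
  have h2 : ∀ l : List (ResidueField R)ˣ,
      (l.map f).sum + ((l.map Neg.neg).map f).sum = l.length • (f 1 + f (-1)) := by
    intro l
    induction l with
    | nil => simp
    | cons a l ih =>
      rw [List.length_cons, succ_nsmul, ← ih, ← hf.add_neg a]
      simp only [List.map_cons, List.sum_cons]
      abel
  rw [List.length_append, List.length_map, ← hl, ← two_mul] at hk
  obtain rfl : k = l.length := by lia
  rw [List.map_append, List.sum_append, hl, ← h2 l'] at hk'
  exact add_right_cancel hk'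

end FormSpace

end DiagonalRelations

/-! ### Consequences of the Grothendieck-Witt relations -/

section GWInvariants

open IsLocalRing FormSpace

variable {R : Type u} [CommRing R] {E : Type u} [AddCommGroup E] [Module R E]

/-- A function `G` on spaces with values in an abelian group that satisfies the relations of the
Grothendieck-Witt group, where `H M` is the class of the hyperbolic space of `M`. -/
structure IsGWInvariant {A : Type*} [AddCommGroup A] (G : FormSpace R E → A) (H : FinLen R → A) :
    Prop where
  isom {S T : FormSpace R E} (h : S.Isom T) : G S = G T
  orth (S T : FormSpace R E) : G (S.orth T) = G S + G T
  metabolic (S : FormSpace R E) (L : Submodule R S) (hL : S.perp L = L) (M : FinLen R)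
    (e : M.obj ≃ₗ[R] L) : G S = H M

namespace FormSpace

/-- The maps to `E` that vanish on a submodule. -/
def annihilatorDual (E : Type u) [AddCommGroup E] [Module R E] {M : Type u} [AddCommGroup M]
    [Module R M] (L : Submodule R M) : Submodule R (M →ₗ[R] E) :=
  LinearMap.ker (L.subtype.lcomp R E)

theorem mem_annihilatorDual {M : Type u} [AddCommGroup M] [Module R M] {L : Submodule R M}
    {φ : M →ₗ[R] E} : φ ∈ annihilatorDual E L ↔ ∀ x ∈ L, φ x = 0 :=
  ⟨fun h x hx => LinearMap.congr_fun h ⟨x, hx⟩, fun h => LinearMap.ext fun x => h x.1 x.2⟩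

/-- The maps that vanish on `L` are the maps on the quotient by `L`. -/
def annihilatorDualEquiv (E : Type u) [AddCommGroup E] [Module R E] {M : Type u} [AddCommGroup M]
    [Module R M] (L : Submodule R M) : ((M ⧸ L) →ₗ[R] E) ≃ₗ[R] annihilatorDual E L :=
  LinearEquiv.ofBijective
    ((L.mkQ.lcomp R E).codRestrict _ fun φ => mem_annihilatorDual.2 fun x hx => by
      rw [LinearMap.lcomp_apply, Submodule.mkQ_apply, (Submodule.Quotient.mk_eq_zero L).2 hx,
        map_zero])
    ⟨fun φ ψ h => Submodule.linearMap_qext L (congrArg Subtype.val h),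
      fun φ => ⟨L.liftQ φ.1 (mem_annihilatorDual.1 φ.2),
        Subtype.ext (L.liftQ_mkQ _ (mem_annihilatorDual.1 φ.2))⟩⟩

instance {M : Type u} [AddCommGroup M] [Module R M] :
    Subsingleton (annihilatorDual E (⊤ : Submodule R M)) :=
  ⟨fun φ ψ => Subtype.ext (LinearMap.ext fun x => by
    rw [mem_annihilatorDual.1 φ.2 x Submodule.mem_top,
      mem_annihilatorDual.1 ψ.2 x Submodule.mem_top])⟩

/-- A product of submodules, in an orthogonal sum, as a module. -/
def prodEquiv {S T : FormSpace R E} (L : Submodule R S) (L' : Submodule R T) :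
    (L × L') ≃ₗ[R] (L.prod L' : Submodule R (S.orth T)) where
  toFun x := ⟨(x.1.1, x.2.1), x.1.2, x.2.2⟩
  invFun x := (⟨x.1.1, x.2.1⟩, ⟨x.1.2, x.2.2⟩)
  map_add' _ _ := rfl
  map_smul' _ _ := rfl

section Hyperbolic

variable [IsDualizingModule R E]

theorem isFiniteLength_dual {M : Type u} [AddCommGroup M] [Module R M] (hM : IsFiniteLength R M) :
    IsFiniteLength R (M →ₗ[R] E) := by
  rw [← Module.length_ne_top_iff, IsDualizingModule.length_dual hM]
  exact Module.length_ne_top_iff.2 hM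

variable (E) in
/-- The hyperbolic form on `M × Hom(M, E)`. -/
def hyperbolicForm (M : FinLen R) : FormSpace R E where
  carrier := M.obj × (M.obj →ₗ[R] E)
  isFiniteLength := M.property.prod' R (isFiniteLength_dual M.property)
  form := LinearMap.mk₂ R (fun x y => x.2 y.1 + y.2 x.1)
    (fun x y z => by
      simp only [Prod.fst_add, Prod.snd_add, map_add, LinearMap.add_apply]
      abel)
    (fun r x y => by simp only [Prod.smul_fst, Prod.smul_snd, map_smul, LinearMap.smul_apply,
      smul_add])
    (fun x y z => by
      simp only [Prod.fst_add, Prod.snd_add, map_add, LinearMap.add_apply]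
      abel)
    (fun r x y => by simp only [Prod.smul_fst, Prod.smul_snd, map_smul, LinearMap.smul_apply,
      smul_add])
  symm x y := by
    simp only [LinearMap.mk₂_apply, add_comm]
  nondeg x hx := by
    refine Prod.ext ?_ (LinearMap.ext fun m => ?_)
    · by_contra h
      obtain ⟨φ, hφ⟩ := IsDualizingModule.exists_ne_zero (E := E) M.property h
      exact hφ (by simpa using hx (0, φ))
    · simpa using hx (m, 0)

variable (E) in
/-- The Lagrangian `L × L^⊥` of the hyperbolic form. -/
def hyperbolicLagrangian (M : FinLen R) (L : Submodule R M.obj) :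
    Submodule R (hyperbolicForm E M) :=
  L.prod (annihilatorDual E L)

variable (E) in
/-- The Lagrangian `L × L^⊥` as a module. -/
def hyperbolicLagrangianEquiv (M : FinLen R) (L : Submodule R M.obj) :
    (L × annihilatorDual E L) ≃ₗ[R] hyperbolicLagrangian E M L where
  toFun x := ⟨(x.1.1, x.2.1), x.1.2, x.2.2⟩
  invFun x := (⟨x.1.1, x.2.1⟩, ⟨x.1.2, x.2.2⟩)
  map_add' _ _ := rfl
  map_smul' _ _ := rfl

theorem perp_hyperbolicForm (M : FinLen R) (L : Submodule R M.obj) :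
    (hyperbolicForm E M).perp (hyperbolicLagrangian E M L) = hyperbolicLagrangian E M L := by
  ext ⟨m, f⟩
  constructor
  · intro h
    refine ⟨?_, mem_annihilatorDual.2 fun x hx => ?_⟩
    · by_contra hm
      change m ∉ L at hm
      rw [← Submodule.Quotient.mk_eq_zero] at hm
      obtain ⟨φ, hφ⟩ := IsDualizingModule.exists_ne_zero (E := E)
        (M.property.of_surjective (Submodule.mkQ_surjective L)) hm
      have : f 0 + φ (L.mkQ m) = 0 := h (0, φ ∘ₗ L.mkQ)
        ⟨L.zero_mem, mem_annihilatorDual.2 fun x hx => by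
          rw [LinearMap.comp_apply, Submodule.mkQ_apply, (Submodule.Quotient.mk_eq_zero L).2 hx,
            map_zero]⟩
      rw [map_zero, zero_add] at this
      exact hφ this
    · have : f x + (0 : M.obj →ₗ[R] E) m = 0 := h (x, 0) ⟨hx, Submodule.zero_mem _⟩
      simpa using this
  · rintro ⟨h1, h2⟩ ⟨m', f'⟩ ⟨h3, h4⟩
    change f m' + f' m = 0
    rw [mem_annihilatorDual.1 h2 _ h3, mem_annihilatorDual.1 h4 _ h1, add_zero]

end Hyperbolic

end FormSpace

namespace IsGWInvariant

variable {A : Type*} [AddCommGroup A] {G : FormSpace R E → A} {H : FinLen R → A}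
  (h : IsGWInvariant G H)

include h

theorem zero_eq : G (zero R E) = 0 := by
  have := h.orth (zero R E) (zero R E)
  rw [h.isom (orth_zero_isom (zero R E))] at this
  exact left_eq_add.1 this

theorem add_neg (S : FormSpace R E) : G S + G S.neg = H (FinLen.of S S.isFiniteLength) := by
  rw [← h.orth]
  refine h.metabolic _ _ (perp_diagonal S) _ (LinearEquiv.ofInjective _ fun x y hxy => ?_)
  exact congrArg Prod.fst hxy

variable [IsDualizingModule R E]

/-- The hyperbolic form of M has one Lagrangian L × L^⊥ for each submodule L of M. Comparing the
resulting expressions for a single class yields all the relations between the H(M) below. -/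
theorem hyperbolic_eq (M : FinLen R) (L : Submodule R M.obj) (N : FinLen R)
    (e : N.obj ≃ₗ[R] L × annihilatorDual E L) : G (hyperbolicForm E M) = H N :=
  h.metabolic _ _ (perp_hyperbolicForm M L) N (e.trans (hyperbolicLagrangianEquiv E M L))

theorem hyperbolic_eq_self {M N : FinLen R} (e : M.obj ≃ₗ[R] N.obj) :
    G (hyperbolicForm E M) = H N := by
  let : Unique (annihilatorDual E (⊤ : Submodule R M.obj)) := Unique.mk' _
  exact h.hyperbolic_eq M ⊤ N
    (e.symm.trans (Submodule.topEquiv.symm.trans LinearEquiv.prodUnique.symm))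

theorem hyperbolic_congr {M N : FinLen R} (e : M.obj ≃ₗ[R] N.obj) : H M = H N :=
  (h.hyperbolic_eq_self (LinearEquiv.refl R _)).symm.trans (h.hyperbolic_eq_self e)

theorem hyperbolic_dual (M : FinLen R) :
    H (FinLen.of (M.obj →ₗ[R] E) (isFiniteLength_dual M.property)) = H M := by
  rw [← h.hyperbolic_eq_self (LinearEquiv.refl R M.obj)]
  refine (h.hyperbolic_eq M ⊥ _ ?_).symm
  have : annihilatorDual E (⊥ : Submodule R M.obj) = ⊤ := by
    rw [eq_top_iff]
    rintro φ -
    exact mem_annihilatorDual.2 fun x hx => by rw [(Submodule.mem_bot R).1 hx, map_zero]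
  rw [this]
  exact Submodule.topEquiv.symm.trans LinearEquiv.uniqueProd.symm

theorem hyperbolic_prod {M N P : FinLen R} (e : P.obj ≃ₗ[R] M.obj × N.obj) :
    H P = H M + H N := by
  have h1 : ∀ M : FinLen R, ∃ L : Submodule R (hyperbolicForm E M),
      (hyperbolicForm E M).perp L = L ∧
      Nonempty (M.obj ≃ₗ[R] L) := fun M => by
    let : Unique (annihilatorDual E (⊤ : Submodule R M.obj)) := Unique.mk' _
    exact ⟨_, perp_hyperbolicForm M ⊤, ⟨Submodule.topEquiv.symm.trans
      (LinearEquiv.prodUnique.symm.trans (hyperbolicLagrangianEquiv E M ⊤))⟩⟩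
  obtain ⟨L, hL, ⟨f⟩⟩ := h1 M
  obtain ⟨L', hL', ⟨f'⟩⟩ := h1 N
  rw [← h.metabolic _ L hL M f, ← h.metabolic _ L' hL' N f', ← h.orth]
  exact (h.metabolic _ (L.prod L') (by rw [perp_prod, hL, hL']) P
    (e.trans ((f.prodCongr f').trans
      (prodEquiv L L')))).symm

/-- The annihilator of L is the dual of M/L, and H does not distinguish a module from its dual. -/
theorem hyperbolic_submodule (M : FinLen R) (L : Submodule R M.obj) {N P : FinLen R}
    (e : N.obj ≃ₗ[R] L) (e' : P.obj ≃ₗ[R] M.obj ⧸ L) : H M = H N + H P := by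
  rw [← h.hyperbolic_dual P, ← h.hyperbolic_eq_self (LinearEquiv.refl R M.obj),
    ← h.hyperbolic_prod (P := FinLen.of (N.obj × (P.obj →ₗ[R] E))
      (N.property.prod' R (isFiniteLength_dual P.property))) (LinearEquiv.refl R _)]
  exact h.hyperbolic_eq M L _ (e.prodCongr ((LinearEquiv.congrLeft E R e').trans
    (annihilatorDualEquiv E L)))

theorem hyperbolic_zero {M : FinLen R} (hM : Subsingleton M.obj) : H M = 0 := by
  let : Unique M.obj := ⟨⟨0⟩, fun _ => Subsingleton.elim _ _⟩
  have := h.hyperbolic_prod (M := M) (N := M) (P := M) LinearEquiv.prodUnique.symm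
  exact left_eq_add.1 this

variable [IsLocalRing R]

/-- H is additive in short exact sequences, so a composition series reduces it to the residue field.
-/
theorem hyperbolic_length (M : FinLen R) (n : ℕ) (hn : Module.length R M.obj = n) :
    H M = n • H (residueObj R) := by
  revert n
  refine FinLen.devissage (fun M => ∀ n : ℕ, Module.length R M.obj = n →
    H M = n • H (residueObj R)) ?_ ?_ ?_ M
  · intro M hM n hn
    rw [Module.length_eq_zero] at hn
    obtain rfl : n = 0 := by exact_mod_cast hn.symm
    rw [zero_smul, h.hyperbolic_zero hM]
  · rintro M ⟨e⟩ n hn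
    rw [e.length_eq, Module.length_eq_one] at hn
    obtain rfl : n = 1 := by exact_mod_cast hn.symm
    rw [one_smul, h.hyperbolic_congr e]
  · intro A M C f g w hf hg hfg hA hC n hn
    have hker : LinearMap.ker g.hom = LinearMap.range f.hom := by
      ext b
      refine ⟨hfg b, ?_⟩
      rintro ⟨a, rfl⟩
      exact congrArg (fun f => f.hom a) w
    have h1 := Module.length_eq_add_of_exact f.hom g.hom hf hg
      (LinearMap.exact_iff.2 hker)
    obtain ⟨a, ha⟩ := ENat.ne_top_iff_exists.1 (Module.length_ne_top_iff.2 A.property)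
    obtain ⟨c, hc⟩ := ENat.ne_top_iff_exists.1 (Module.length_ne_top_iff.2 C.property)
    have h2 : n = a + c := by
      rw [hn, ← ha, ← hc] at h1
      exact_mod_cast h1
    rw [h.hyperbolic_submodule M (LinearMap.ker g.hom) (N := A) (P := C)
      ((LinearEquiv.ofInjective _ hf).trans (LinearEquiv.ofEq _ _ hker.symm))
      (g.hom.quotKerEquivOfSurjective hg).symm, hA a ha.symm, hC c hc.symm, h2, add_smul]

/-- Both S ⊥ -T and T ⊥ -T have Lagrangians of length n, the common length of S and T, so both have
class n H(κ). Cancel the class of -T. -/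
theorem eq_of_wittEquiv {S T : FormSpace R E} (hST : S.WittEquiv T)
    (hlen : Module.length R S = Module.length R T) : G S = G T := by
  obtain ⟨L, hL⟩ := hST
  obtain ⟨n, hn⟩ := ENat.ne_top_iff_exists.1 (Module.length_ne_top_iff.2 S.isFiniteLength)
  have h1 := length_perp L
  rw [hL, orth_length] at h1
  have hfin : IsFiniteLength R L :=
    (S.orth T.neg).isFiniteLength.of_injective (Submodule.subtype_injective L)
  obtain ⟨m, hm⟩ := ENat.ne_top_iff_exists.1 (Module.length_ne_top_iff.2 hfin)
  have h2 : m = n := by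
    have h3 : Module.length R L + Module.length R L = Module.length R S + Module.length R T := h1
    rw [← hlen, ← hm, ← hn] at h3
    have : m + m = n + n := by exact_mod_cast h3
    lia
  have h4 : G S + G T.neg = n • H (residueObj R) := by
    rw [← h.orth, h.metabolic _ L hL (FinLen.of L hfin) (LinearEquiv.refl R L), ← h2]
    exact h.hyperbolic_length _ m hm.symm
  have h5 : G T + G T.neg = n • H (residueObj R) := by
    rw [h.add_neg, ← h.hyperbolic_length (FinLen.of T T.isFiniteLength) n (hlen ▸ hn.symm)]
  exact add_right_cancel (h4.trans h5.symm)

omit [IsDualizingModule R E] in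
theorem diag_eq (ε : SocleIso R E) (l : List (ResidueField R)ˣ) :
    G (diag ε l) = (l.map fun a => G (line ε a)).sum := by
  induction l with
  | nil => exact h.zero_eq
  | cons a l ih => rw [List.map_cons, List.sum_cons, ← ih]; exact h.orth _ _

theorem isFormInvariant (ε : SocleIso R E) : IsFormInvariant fun a => G (line ε a) where
  mul_sq a b := h.isom (line_mul_sq_isom ε a b).symm
  add_eq a b c habc := by
    rw [← h.orth, ← h.orth, h.isom (line_orth_isom ε a b c habc)]
  add_neg a := by
    have : ∀ a, G (line ε a) + G (line ε (-a)) = H (residueObj R) := fun a => by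
      rw [h.isom (line_neg_isom ε a), h.add_neg]
      exact h.hyperbolic_congr (LinearEquiv.refl R (ResidueField R))
    rw [this, this]

end IsGWInvariant

end GWInvariants

/-! ### Extension of an invariant from one-dimensional forms to all spaces -/

section DiagInvariant

open IsLocalRing FormSpace

variable {R : Type u} [CommRing R] [IsLocalRing R] {E : Type u} [AddCommGroup E] [Module R E]
  [IsDualizingModule R E] (ε : SocleIso R E) {A : Type*} [AddCommGroup A]
  {f : (ResidueField R)ˣ → A}

/-- The extension of a function on one-dimensional forms to all spaces: the sum of its values on the
entries of a Witt equivalent diagonal form of the same length. -/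
def diagInvariant (f : (ResidueField R)ˣ → A) (S : FormSpace R E) : A :=
  ((exists_wittEquiv_diag ε S).choose.map f).sum

theorem IsFormInvariant.diagInvariant_eq (hf : IsFormInvariant f) {S : FormSpace R E}
    {l : List (ResidueField R)ˣ} (h : S.WittEquiv (diag ε l))
    (hl : Module.length R S = l.length) : diagInvariant ε f S = (l.map f).sum := by
  obtain ⟨h1, h2⟩ := (exists_wittEquiv_diag ε S).choose_spec
  refine sum_eq_of_wittEquiv ε hf ?_ (h1.symm.trans h)
  exact_mod_cast h2.symm.trans hl

theorem IsFormInvariant.diagInvariant_line (hf : IsFormInvariant f) (a : (ResidueField R)ˣ) :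
    diagInvariant ε f (line ε a) = f a := by
  rw [hf.diagInvariant_eq ε (l := [a]) (WittEquiv.of_isom (orth_zero_isom _).symm)
    (line_length ε a), List.map_singleton, List.sum_singleton]

theorem IsFormInvariant.isGWInvariant (hf : IsFormInvariant f) :
    IsGWInvariant (diagInvariant ε f)
      (fun M : FinLen R => (Module.length R M.obj).toNat • (f 1 + f (-1))) where
  isom {S T} h := by
    obtain ⟨l, hl, hlen⟩ := exists_wittEquiv_diag ε T
    rw [hf.diagInvariant_eq ε hl hlen, hf.diagInvariant_eq ε ((WittEquiv.of_isom h).trans hl)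
      (h.length_eq.trans hlen)]
  orth S T := by
    obtain ⟨l, hl, hlen⟩ := exists_wittEquiv_diag ε S
    obtain ⟨l', hl', hlen'⟩ := exists_wittEquiv_diag ε T
    rw [hf.diagInvariant_eq ε hl hlen, hf.diagInvariant_eq ε hl' hlen', ← List.sum_append,
      ← List.map_append]
    refine hf.diagInvariant_eq ε ((hl.orth_congr hl').trans
      (WittEquiv.of_isom (diag_append_isom ε l l').symm)) ?_
    rw [orth_length, hlen, hlen', List.length_append, Nat.cast_add]
  metabolic S L hL M e := by
    obtain ⟨l, hl, hlen⟩ := exists_wittEquiv_diag ε S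
    -- A diagonal form Witt equivalent to a metabolic space is itself metabolic, so its value is
    -- hyperbolic; its rank is twice the length of the Lagrangian.
    obtain ⟨k, hk, hsum⟩ := exists_sum_eq_of_isMetabolic ε hf l (hl.symm.isMetabolic ⟨L, hL⟩)
    obtain ⟨m, hm⟩ := ENat.ne_top_iff_exists.1 (Module.length_ne_top_iff.2 M.property)
    have h1 := length_perp L
    rw [hL, ← e.length_eq, ← hm, hlen, hk] at h1
    have h2 : m + m = 2 * k := by exact_mod_cast h1
    obtain rfl : m = k := by lia
    rw [hf.diagInvariant_eq ε hl hlen, hsum, ← hm, ENat.toNat_natCast]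

end DiagInvariant

/-! ### Symmetric spaces as modules with a form -/

section SymmetricSpaces

open IsLocalRing Abelian Opposite

section Lift

variable {C : Type*} [Category C] [Abelian C] {D : Cᵒᵖ ⥤ C} {𝒟 : ExactDuality D}

theorem GW.of_eq_of_isometric {S T : SymmetricSpace 𝒟} (h : S.Isometric T) :
    GW.of S = GW.of T :=
  QuotientAddGroup.eq_iff_sub_mem.2 (AddSubgroup.subset_closure (GWRel.isometric S T h))

theorem GW.of_orthSum (S T : SymmetricSpace 𝒟) : GW.of (S.orthSum T) = GW.of S + GW.of T :=
  QuotientAddGroup.eq_iff_sub_mem.2 (AddSubgroup.subset_closure (GWRel.orthSum S T))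

theorem GW.of_eq_hyperbolic {S : SymmetricSpace 𝒟} {L : C} (i : L ⟶ S.X)
    (h : S.IsLagrangian i) : GW.of S = GW.of (SymmetricSpace.hyperbolic 𝒟 L) :=
  QuotientAddGroup.eq_iff_sub_mem.2 (AddSubgroup.subset_closure (GWRel.metabolic S L i h))

/-- The homomorphism from the Grothendieck-Witt group given by a function on symmetric spaces that
satisfies the relations. -/
def GW.lift {A : Type*} [AddCommGroup A] (g : SymmetricSpace 𝒟 → A)
    (isometric : ∀ S T : SymmetricSpace 𝒟, S.Isometric T → g S = g T)
    (orthSum : ∀ S T : SymmetricSpace 𝒟, g (S.orthSum T) = g S + g T)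
    (metabolic : ∀ (S : SymmetricSpace 𝒟) (L : C) (i : L ⟶ S.X), S.IsLagrangian i →
      g S = g (SymmetricSpace.hyperbolic 𝒟 L)) : GW 𝒟 →+ A :=
  QuotientAddGroup.lift _ (FreeAbelianGroup.lift g) <| by
    rw [AddSubgroup.closure_le]
    rintro _ (⟨S, T, h⟩ | ⟨S, T⟩ | ⟨S, L, i, h⟩)
    · change FreeAbelianGroup.lift g _ = 0
      rw [map_sub, FreeAbelianGroup.lift_apply_of, FreeAbelianGroup.lift_apply_of,
        isometric S T h, sub_self]
    · change FreeAbelianGroup.lift g _ = 0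
      rw [map_sub, map_add, FreeAbelianGroup.lift_apply_of, FreeAbelianGroup.lift_apply_of,
        FreeAbelianGroup.lift_apply_of, orthSum, sub_self]
    · change FreeAbelianGroup.lift g _ = 0
      rw [map_sub, FreeAbelianGroup.lift_apply_of, FreeAbelianGroup.lift_apply_of,
        metabolic S L i h, sub_self]

theorem GW.hom_ext {A : Type*} [AddCommGroup A] {f g : GW 𝒟 →+ A}
    (h : ∀ S, f (GW.of S) = g (GW.of S)) : f = g :=
  QuotientAddGroup.addMonoidHom_ext _ (FreeAbelianGroup.lift_ext _ _ h)

theorem SymmetricSpace.isLagrangian_hyperbolic (L : C) :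
    (hyperbolic 𝒟 L).IsLagrangian (biprod.inl : L ⟶ L ⊞ D.obj (op L)) := by
  have := 𝒟.additive
  have h : ∀ η : L ⟶ D.obj (op (D.obj (op L))),
      (biprod.snd ≫ D.map (biprod.fst : L ⊞ D.obj (op L) ⟶ L).op + biprod.fst ≫
        η ≫ D.map (biprod.snd : L ⊞ D.obj (op L) ⟶ D.obj (op L)).op) ≫
          D.map (biprod.inl : L ⟶ L ⊞ D.obj (op L)).op =
      (biprod.snd : L ⊞ D.obj (op L) ⟶ D.obj (op L)) := fun η => by
    rw [Preadditive.add_comp, Category.assoc, Category.assoc, Category.assoc, map_fst_inl,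
      map_snd_inl, comp_zero, comp_zero, add_zero, Category.comp_id]
  have h2 : ∀ p : L ⊞ D.obj (op L) ⟶ D.obj (op L), p = biprod.snd →
      ∃ w : (biprod.inl : L ⟶ L ⊞ D.obj (op L)) ≫ p = 0,
        (ShortComplex.mk biprod.inl p w).ShortExact := by
    rintro _ rfl
    exact ⟨biprod.inl_snd, (ShortComplex.Splitting.ofHasBinaryBiproduct L _).shortExact⟩
  exact h2 _ (h (𝒟.η.hom.app L))

end Lift

variable {R : Type u} [CommRing R] [IsLocalRing R] [IsNoetherianRing R] {i : ℕ}
  [HasExtDuality R i]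

instance : IsDualizingModule R (ExtLimit R i) where
  exists_ne_zero hM _ hm := exists_extLimit_dual_ne_zero hM hm
  exists_extension hN f hf φ := exists_extLimit_extension i hN f hf φ
  length_dual hM := length_extLimit_dual (FinLen.of _ hM)

omit [IsNoetherianRing R] [HasExtDuality R i] in
theorem extEval_zero (M : FinLen R) (x : M.obj) : extEval (i := i) M 0 x = 0 := by
  rw [map_zero, LinearMap.zero_apply]

omit [IsLocalRing R] [IsNoetherianRing R] [HasExtDuality R i] in
theorem isoHom_bijective {M N : FinLen R} (φ : M ≅ N) : Function.Bijective φ.hom.hom.hom :=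
  (FinLen.linearEquivOfIso φ).bijective

namespace ExactDuality.IsCanonical

variable {𝒟 : ExactDuality (extDual R i)} (h𝒟 : 𝒟.IsCanonical)

-- Under evaluation the dual of φ composed with ϖ becomes the form with its arguments exchanged.
include h𝒟 in
theorem symm_iff {M : FinLen R} (φ : M ⟶ (extDual R i).obj (op M)) :
    𝒟.η.hom.app M ≫ (extDual R i).map φ.op = φ ↔
      ∀ x y : M.obj, extEval M (φ.hom.hom x) y = extEval M (φ.hom.hom y) x := by
  have h : ∀ x y : M.obj, extEval M ((𝒟.η.hom.app M ≫ (extDual R i).map φ.op).hom.hom x) y =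
      extEval M (φ.hom.hom y) x := by
    intro x y
    refine (extEval_extPull (M := M) (N := extDualObj i M) φ.hom _ y).trans ?_
    exact (congrArg (fun e => extEval (extDualObj i M) e (φ.hom.hom y))
      ((isCanonical_iff 𝒟).1 h𝒟 M x)).trans (extEval_bidual M x _)
  constructor
  · intro hφ x y
    rw [← h, hφ]
  · intro hφ
    ext x
    refine extEval_injective (i := i) M (LinearMap.ext fun y => ?_)
    exact (h x y).trans (hφ x y).symm

/-- The form on the module of a symmetric space, with values in the dualizing module. -/
def toForm (S : SymmetricSpace 𝒟) : FormSpace R (ExtLimit R i) where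
  carrier := S.X.obj
  isFiniteLength := S.X.property
  form := extEval S.X ∘ₗ S.φ.hom.hom.hom
  symm := (h𝒟.symm_iff S.φ.hom).1 S.symm
  nondeg _ hx := (isoHom_bijective S.φ).1 <| extEval_injective S.X <| LinearMap.ext fun y =>
    (hx y).trans ((congrArg (fun e => extEval S.X e y) (map_zero S.φ.hom.hom.hom)).trans
      (extEval_zero S.X y)).symm

/-- The symmetric space of a form with values in the dualizing module. -/
def ofForm (S : FormSpace R (ExtLimit R i)) : SymmetricSpace 𝒟 where
  X := FinLen.of S S.isFiniteLength
  φ := FinLen.isoOfLinearEquiv (N := extDualObj i (FinLen.of S S.isFiniteLength))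
    ((LinearEquiv.ofBijective S.form ⟨(injective_iff_map_eq_zero _).2 fun x hx =>
      S.nondeg x fun y => LinearMap.congr_fun hx y, S.form_surjective⟩).trans
      (extEvalEquiv i (FinLen.of S S.isFiniteLength)).symm)
  symm := (h𝒟.symm_iff _).2 fun x y => by
    have h : ∀ x y : S, extEval (FinLen.of S S.isFiniteLength)
        ((extEvalEquiv i (FinLen.of S S.isFiniteLength)).symm (S.form x)) y = S.form x y :=
      fun x y => LinearMap.congr_fun
        ((extEvalEquiv i (FinLen.of S S.isFiniteLength)).apply_symm_apply (S.form x)) y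
    exact (h x y).trans ((S.symm x y).trans (h y x).symm)

theorem toForm_ofForm (S : FormSpace R (ExtLimit R i)) (x y : S) :
    (h𝒟.toForm (h𝒟.ofForm S)).form x y = S.form x y :=
  LinearMap.congr_fun
    ((extEvalEquiv i (FinLen.of S S.isFiniteLength)).apply_symm_apply (S.form x)) y

theorem toForm_ofForm_isom (S : FormSpace R (ExtLimit R i)) :
    (h𝒟.toForm (h𝒟.ofForm S)).Isom S :=
  ⟨LinearEquiv.refl R S, fun x y => (h𝒟.toForm_ofForm S x y).symm⟩

theorem isometric_iff (S T : SymmetricSpace 𝒟) :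
    S.Isometric T ↔ (h𝒟.toForm S).Isom (h𝒟.toForm T) := by
  have h : ∀ (f : S.X ⟶ T.X) (x y : S.X.obj),
      extEval S.X ((f ≫ T.φ.hom ≫ (extDual R i).map f.op).hom.hom x) y =
        (h𝒟.toForm T).form (f.hom.hom x) (f.hom.hom y) := fun f x y =>
    extEval_extPull (M := S.X) (N := T.X) f.hom _ y
  constructor
  · rintro ⟨f, hf⟩
    refine ⟨FinLen.linearEquivOfIso f, fun (x y : S.X.obj) => (h f.hom x y).symm.trans ?_⟩
    rw [hf]
    rfl
  · rintro ⟨f, hf⟩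
    refine ⟨FinLen.isoOfLinearEquiv f, ?_⟩
    ext x
    refine extEval_injective (i := i) S.X (LinearMap.ext fun y => ?_)
    exact (h _ x y).trans (hf x y)

theorem toForm_orthSum_isom (S T : SymmetricSpace 𝒟) :
    (h𝒟.toForm (S.orthSum T)).Isom ((h𝒟.toForm S).orth (h𝒟.toForm T)) := by
  -- The biproduct of the category is abstract; its four structure maps identify the underlying
  -- module with the product.
  let p : (S.X ⊞ T.X).obj →ₗ[R] S.X.obj := (biprod.fst : S.X ⊞ T.X ⟶ S.X).hom.hom
  let q : (S.X ⊞ T.X).obj →ₗ[R] T.X.obj := (biprod.snd : S.X ⊞ T.X ⟶ T.X).hom.hom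
  let j : S.X.obj →ₗ[R] (S.X ⊞ T.X).obj := (biprod.inl : S.X ⟶ S.X ⊞ T.X).hom.hom
  let k : T.X.obj →ₗ[R] (S.X ⊞ T.X).obj := (biprod.inr : T.X ⟶ S.X ⊞ T.X).hom.hom
  have h1 : ∀ x, p (j x) = x := fun x =>
    congrArg (fun f : S.X ⟶ S.X => f.hom.hom x) biprod.inl_fst
  have h2 : ∀ x, q (j x) = 0 := fun x =>
    congrArg (fun f : S.X ⟶ T.X => f.hom.hom x) biprod.inl_snd
  have h3 : ∀ x, p (k x) = 0 := fun x =>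
    congrArg (fun f : T.X ⟶ S.X => f.hom.hom x) biprod.inr_fst
  have h4 : ∀ x, q (k x) = x := fun x =>
    congrArg (fun f : T.X ⟶ T.X => f.hom.hom x) biprod.inr_snd
  have h5 : ∀ x, j (p x) + k (q x) = x := fun x =>
    congrArg (fun f : S.X ⊞ T.X ⟶ S.X ⊞ T.X => f.hom.hom x) biprod.total
  refine ⟨LinearEquiv.ofLinearMap (p.prod q) (j.coprod k) ?_ ?_, fun (x y : (S.X ⊞ T.X).obj) => ?_⟩
  · have h6 : ∀ x y, p (j x + k y) = x := fun x y => by rw [map_add, h1, h3, add_zero]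
    have h7 : ∀ x y, q (j x + k y) = y := fun x y => by rw [map_add, h2, h4, zero_add]
    exact LinearMap.ext fun x => Prod.ext (h6 x.1 x.2) (h7 x.1 x.2)
  · exact LinearMap.ext h5
  · have h6 : ∀ (e : Ext S.X.obj (ModuleCat.of R R) i) (e' : Ext T.X.obj (ModuleCat.of R R) i),
        extEval S.X e (p y) + extEval T.X e' (q y) =
          extEval (S.X ⊞ T.X) (extPull i (biprod.fst : S.X ⊞ T.X ⟶ S.X).hom e +
            extPull i (biprod.snd : S.X ⊞ T.X ⟶ T.X).hom e') y := fun e e' => by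
      rw [map_add, LinearMap.add_apply, extEval_extPull, extEval_extPull]
    exact h6 _ _

theorem perp_range_of_isLagrangian (S : SymmetricSpace 𝒟) {L : FinLen R} (j : L ⟶ S.X)
    (h : S.IsLagrangian j) : (h𝒟.toForm S).perp (LinearMap.range j.hom.hom) =
      LinearMap.range j.hom.hom := by
  obtain ⟨w, h⟩ := h
  obtain ⟨-, -, h⟩ := (FinLen.shortExact_iff _).1 h
  ext (x : S.X.obj)
  constructor
  · intro hx
    refine h x (extEval_injective (i := i) L (LinearMap.ext fun y => ?_))
    refine (extEval_extPull (M := L) (N := S.X) j.hom _ y).trans ?_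
    exact (hx _ ⟨y, rfl⟩).trans (extEval_zero L y).symm
  · rintro ⟨x, rfl⟩ _ ⟨y, rfl⟩
    refine (extEval_extPull (M := L) (N := S.X) j.hom _ y).symm.trans ?_
    have h0 : (j ≫ S.φ.hom ≫ (extDual R i).map j.op).hom.hom x = 0 := by rw [w]; rfl
    exact (congrArg (fun e => extEval L e y) h0).trans (extEval_zero L y)

omit [IsLocalRing R] [HasExtDuality R i] in
theorem injective_of_isLagrangian {S : SymmetricSpace 𝒟} {L : FinLen R} {j : L ⟶ S.X}
    (h : S.IsLagrangian j) : Function.Injective j.hom.hom :=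
  ((FinLen.shortExact_iff _).1 h.choose_spec).1

theorem isLagrangian_of_perp (S : SymmetricSpace 𝒟) {L : FinLen R} (j : L ⟶ S.X)
    (hj : Function.Injective j.hom.hom)
    (h : (h𝒟.toForm S).perp (LinearMap.range j.hom.hom) = LinearMap.range j.hom.hom) :
    S.IsLagrangian j := by
  -- The orthogonal complement of L is the kernel of X → L^♯, so L = L^⊥ amounts to exactness in the
  -- middle.
  have key : ∀ x : S.X.obj, (∀ y, (h𝒟.toForm S).form x (j.hom.hom y) = 0) ↔
      extPull i j.hom (S.φ.hom.hom.hom x) = 0 := by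
    intro x
    constructor
    · intro hx
      refine extEval_injective (i := i) L (LinearMap.ext fun y => ?_)
      exact (extEval_extPull (M := L) (N := S.X) j.hom _ y).trans
        ((hx y).trans (extEval_zero L y).symm)
    · intro hx y
      exact (extEval_extPull (M := L) (N := S.X) j.hom _ y).symm.trans
        ((congrArg (fun e => extEval L e y) hx).trans (extEval_zero L y))
  have w : j ≫ S.φ.hom ≫ (extDual R i).map j.op = 0 := by
    ext x
    refine (key (j.hom.hom x)).1 fun y => ?_
    have : j.hom.hom x ∈ (h𝒟.toForm S).perp (LinearMap.range j.hom.hom) := h.ge ⟨x, rfl⟩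
    exact this _ ⟨y, rfl⟩
  refine ⟨w, (FinLen.shortExact_iff _).2 ⟨hj, fun e => ?_, fun x hx => ?_⟩⟩
  · obtain ⟨e', he'⟩ := extPull_surjective S.X.property j.hom hj e
    obtain ⟨x, hx⟩ := (isoHom_bijective S.φ).2 e'
    refine ⟨x, Eq.trans ?_ he'⟩
    rw [← hx]
    rfl
  · refine h.le ?_
    rintro _ ⟨y, rfl⟩
    exact (key x).2 hx y

theorem isGWInvariant_of_ofForm :
    IsGWInvariant (fun S => (GW.of (h𝒟.ofForm S) : GW 𝒟))
      (fun M => GW.of (SymmetricSpace.hyperbolic 𝒟 M)) where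
  isom {S T} h := GW.of_eq_of_isometric <| (h𝒟.isometric_iff _ _).2 <|
    (h𝒟.toForm_ofForm_isom S).trans (h.trans (h𝒟.toForm_ofForm_isom T).symm)
  orth S T := by
    rw [← GW.of_orthSum]
    refine GW.of_eq_of_isometric ((h𝒟.isometric_iff _ _).2 ?_)
    exact (h𝒟.toForm_ofForm_isom _).trans (((h𝒟.toForm_ofForm_isom S).symm.orth_congr
      (h𝒟.toForm_ofForm_isom T).symm).trans (h𝒟.toForm_orthSum_isom _ _).symm)
  metabolic S L hL M e := by
    let j : M ⟶ (h𝒟.ofForm S).X :=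
      ObjectProperty.homMk (ModuleCat.ofHom (L.subtype ∘ₗ e.toLinearMap))
    have hr : LinearMap.range (L.subtype ∘ₗ e.toLinearMap) = L := by
      rw [LinearMap.range_comp, LinearEquiv.range, Submodule.map_top, Submodule.range_subtype]
    refine GW.of_eq_hyperbolic j (h𝒟.isLagrangian_of_perp _ j
      (L.subtype_injective.comp e.injective) ?_)
    have hperp : (h𝒟.toForm (h𝒟.ofForm S)).perp L = L := by
      refine Eq.trans ?_ hL
      ext x
      exact ⟨fun h y hy => (h𝒟.toForm_ofForm S x y).symm.trans (h y hy),
        fun h y hy => (h𝒟.toForm_ofForm S x y).trans (h y hy)⟩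
    rw [← hr] at hperp
    exact hperp

theorem of_ofForm_toForm (S : SymmetricSpace 𝒟) : GW.of (h𝒟.ofForm (h𝒟.toForm S)) = GW.of S :=
  GW.of_eq_of_isometric ((h𝒟.isometric_iff _ _).2 (h𝒟.toForm_ofForm_isom _))

/-- The homomorphism from the Grothendieck-Witt group given by an invariant of forms. -/
def gwLift {A : Type*} [AddCommGroup A] {G : FormSpace R (ExtLimit R i) → A} {H : FinLen R → A}
    (hG : IsGWInvariant G H) : GW 𝒟 →+ A :=
  have metabolic : ∀ (S : SymmetricSpace 𝒟) (L : FinLen R) (j : L ⟶ S.X), S.IsLagrangian j →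
      G (h𝒟.toForm S) = H L := fun S L j h =>
    hG.metabolic _ _ (h𝒟.perp_range_of_isLagrangian S j h) L
      (LinearEquiv.ofInjective j.hom.hom (injective_of_isLagrangian h))
  GW.lift (fun S => G (h𝒟.toForm S)) (fun S T h => hG.isom ((h𝒟.isometric_iff S T).1 h))
    (fun S T => (hG.isom (h𝒟.toForm_orthSum_isom S T)).trans (hG.orth _ _))
    -- A space with Lagrangian L and the hyperbolic space on L, where L is again a Lagrangian, both
    -- have the value H L.
    (fun S L j h => (metabolic S L j h).trans
      (metabolic _ L _ (SymmetricSpace.isLagrangian_hyperbolic L)).symm)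

theorem gwLift_of {A : Type*} [AddCommGroup A] {G : FormSpace R (ExtLimit R i) → A}
    {H : FinLen R → A} (hG : IsGWInvariant G H) (S : SymmetricSpace 𝒟) :
    h𝒟.gwLift hG (GW.of S) = G (h𝒟.toForm S) :=
  FreeAbelianGroup.lift_apply_of _ S

end ExactDuality.IsCanonical

end SymmetricSpaces

/-! ### Generators and relations for K^MW_0 of a field -/

section MilnorWitt

/-- The additive extension of a function to the free abelian group on its source. -/
def MonoidAlgebra.sumHom {H A : Type*} [AddCommGroup A] (f : H → A) : MonoidAlgebra ℤ H →+ A :=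
  (Finsupp.liftAddHom fun h => zmultiplesHom A (f h)).comp
    (MonoidAlgebra.coeffAddEquiv (R := ℤ) (M := H)).toAddMonoidHom

theorem MonoidAlgebra.sumHom_single {H A : Type*} [AddCommGroup A] (f : H → A) (h : H) (n : ℤ) :
    sumHom f (single h n) = n • f h :=
  Finsupp.liftAddHom_apply_single (fun h => zmultiplesHom A (f h)) h n

theorem MonoidAlgebra.int_addHom_ext {H A : Type*} [AddCommGroup A] {f g : MonoidAlgebra ℤ H →+ A}
    (h : ∀ x, f (single x 1) = g (single x 1)) : f = g := by
  refine MonoidAlgebra.addMonoidHom_ext fun x n => ?_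
  have : single x n = n • single x (1 : ℤ) := by
    rw [MonoidAlgebra.smul_single, smul_eq_mul, mul_one]
  rw [this, map_zsmul, map_zsmul, h]

section FormRelations

variable {F : Type u} [Field F] {Q : Type*} [Ring Q] (q : Fˣ →* Q)

/-- Multiplicative maps that satisfy the defining relations of the Grothendieck-Witt ring satisfy
the relations of additive invariants of one-dimensional forms. -/
theorem isFormInvariant_of_monoidHom
    (h1 : ∀ a b : Fˣ, (a : F) + b = 1 → (q a - 1) * (q b - 1) = 0)
    (h2 : ∀ a, (1 + q (-1)) * (q a - 1) = 0) : IsFormInvariant q := by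
  have hneg : ∀ a, q a + q (-a) = q 1 + q (-1) := fun a => by
    have := h2 a
    rw [mul_sub, mul_one, add_mul, one_mul, ← map_mul, neg_one_mul, sub_eq_zero] at this
    rw [this, map_one]
  -- The usual argument that [a][-a] vanishes: write -a = (1 - a)/(1 - a⁻¹) and use the Steinberg
  -- relation for a and for a⁻¹.
  have hneg2 : ∀ a, (q a - 1) * (q (-a) - 1) = 0 := fun a => by
    by_cases ha : a = 1
    · rw [ha, map_one, sub_self, zero_mul]
    have h3 : (1 : F) - a ≠ 0 := sub_ne_zero.2 fun h => ha (Units.ext h.symm)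
    have h4 : (1 : F) - (a⁻¹ : Fˣ) ≠ 0 := sub_ne_zero.2 fun h =>
      ha (inv_eq_one.1 (Units.ext h.symm))
    obtain ⟨b, hb⟩ : ∃ b : Fˣ, (b : F) = 1 - a := ⟨Units.mk0 _ h3, rfl⟩
    obtain ⟨c, hc⟩ : ∃ c : Fˣ, (c : F) = 1 - (a⁻¹ : Fˣ) := ⟨Units.mk0 _ h4, rfl⟩
    have h5 : -a * c = b := Units.ext <| by
      rw [Units.val_mul, Units.val_neg, hc, hb, mul_sub, neg_mul, neg_mul, Units.mul_inv]
      ring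
    have h6 : (q a - 1) * q b = q a - 1 := by
      have := h1 a b (by rw [hb]; ring)
      rwa [mul_sub, mul_one, sub_eq_zero] at this
    have h7 : (q a - 1) * q c = q a - 1 := by
      have h8 := h1 a⁻¹ c (by rw [hc]; ring)
      have h9 : (q a - 1) * (q c - 1) = -(q a * ((q a⁻¹ - 1) * (q c - 1))) := by
        rw [← mul_assoc, mul_sub (q a), ← map_mul, mul_inv_cancel, map_one, mul_one, ← neg_mul,
          neg_sub]
      rw [h8, mul_zero, neg_zero, mul_sub, mul_one, sub_eq_zero] at h9
      exact h9
    rw [mul_sub, mul_one, sub_eq_zero]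
    calc (q a - 1) * q (-a) = (q a - 1) * q c * q (-a) := by rw [h7]
      _ = (q a - 1) * q b := by rw [mul_assoc, ← map_mul, mul_comm c, h5]
      _ = q a - 1 := h6
  -- Expanding the previous relation gives q(-a²) = q(a) + q(-a) - 1 = q(-1); multiply by q(-1).
  have hsq : ∀ a, q (a ^ 2) = 1 := fun a => by
    have h3 : q (-(a ^ 2)) = q (-1) := by
      have h4 := hneg2 a
      have h5 : (q a - 1) * (q (-a) - 1) = q (a * -a) - (q a + q (-a)) + 1 := by
        rw [map_mul]
        noncomm_ring
      rw [h5, hneg, map_one] at h4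
      rw [show -(a ^ 2) = a * -a by rw [mul_neg, sq]]
      rw [← sub_eq_zero, ← h4]
      abel
    have h4 : q (-1 * -(a ^ 2)) = q (-1 * -1) := by rw [map_mul, h3, ← map_mul]
    simpa using h4
  refine ⟨fun a b => by rw [map_mul, hsq, mul_one], fun a b c habc => ?_, hneg⟩
  -- The Steinberg relation for a/c and b/c, whose sum is 1; multiplying by q(c) gives the relation
  -- up to a square.
  have h3 : q (a * c⁻¹) + q (b * c⁻¹) = 1 + q (a * c⁻¹ * (b * c⁻¹)) := by
    have := h1 (a * c⁻¹) (b * c⁻¹) (by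
      rw [Units.val_mul, Units.val_mul, ← add_mul, ← habc, Units.mul_inv])
    rw [map_mul q (a * c⁻¹) (b * c⁻¹), ← sub_eq_zero, ← neg_eq_zero, ← this]
    noncomm_ring
  have h4 := congrArg (· * q c) h3
  simp only [add_mul, one_mul, ← map_mul] at h4
  rw [inv_mul_cancel_right, inv_mul_cancel_right,
    show a * c⁻¹ * (b * c⁻¹) * c = a * b * c * (c⁻¹) ^ 2 by
      rw [sq, mul_assoc (a * b), mul_inv_cancel_left, mul_mul_mul_comm, mul_assoc (a * b),
        mul_assoc c⁻¹, inv_mul_cancel, mul_one], map_mul q _ (c⁻¹ ^ 2), hsq, mul_one] at h4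
  exact h4

end FormRelations

namespace KMW

variable {F : Type u} [Field F]

/-- The homomorphism from Milnor-Witt K-theory given by images of the generators. -/
def lift {S : Type*} [Ring S] (s : Fˣ → S) (t : S)
    (steinberg : ∀ a b : Fˣ, (a : F) + b = 1 → s a * s b = 0)
    (sym_mul : ∀ a b, s (a * b) = s a + s b + t * s a * s b)
    (eta_comm : ∀ a, t * s a = s a * t) (eta_hyp : t * (t * s (-1) + 2) = 0) : KMW F →+* S :=
  RingQuot.lift ⟨(FreeAlgebra.lift ℤ fun g : KMWGen F =>
      KMWGen.rec (motive := fun _ => S) s t g : KMWFree F →ₐ[ℤ] S).toRingHom, by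
    have hs : ∀ a, (FreeAlgebra.lift ℤ fun g : KMWGen F =>
      KMWGen.rec (motive := fun _ => S) s t g) (KMWFree.sym a) = s a :=
      fun a => FreeAlgebra.lift_ι_apply _ _
    have ht : (FreeAlgebra.lift ℤ fun g : KMWGen F =>
      KMWGen.rec (motive := fun _ => S) s t g) (KMWFree.eta F) = t :=
      FreeAlgebra.lift_ι_apply _ _
    rintro _ _ (⟨a, b, h⟩ | ⟨a, b⟩ | a | _) <;>
      simp only [AlgHom.toRingHom_eq_coe, RingHom.coe_coe, map_mul, map_add, map_zero, hs, ht,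
        map_ofNat]
    exacts [steinberg a b h, sym_mul a b, eta_comm a, eta_hyp]⟩

section Lift

variable {S : Type*} [Ring S] (s : Fˣ → S) (t : S) (h₁ h₂ h₃ h₄)

theorem lift_mk (x : KMWFree F) : lift s t h₁ h₂ h₃ h₄ (mk F x) =
    FreeAlgebra.lift ℤ (fun g : KMWGen F => KMWGen.rec (motive := fun _ => S) s t g) x :=
  RingQuot.lift_mkRingHom_apply _ _ _

theorem lift_form (a : Fˣ) : lift s t h₁ h₂ h₃ h₄ (form a) = 1 + t * s a := by
  rw [form, map_add, map_one, map_mul, eta, sym, lift_mk, lift_mk]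
  exact congrArg₂ (fun x y => 1 + x * y) (FreeAlgebra.lift_ι_apply _ _)
    (FreeAlgebra.lift_ι_apply _ _)

end Lift

theorem sym_mul_sym {a b : Fˣ} (h : (a : F) + b = 1) : sym a * sym b = 0 := by
  simpa only [sym, map_mul, map_zero] using mk_rel (KMWRel.steinberg a b h)

theorem form_sub_one (a : Fˣ) : form a - 1 = eta F * sym a := add_sub_cancel_left _ _

theorem isFormInvariant_form : IsFormInvariant (form : Fˣ → KMW F) := by
  refine isFormInvariant_of_monoidHom (formHom F) (fun a b h => ?_) (fun a => ?_)
  · change (form a - 1) * (form b - 1) = 0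
    rw [form_sub_one, form_sub_one, mul_assoc, ← mul_assoc (sym a), ← eta_comm a,
      mul_assoc (eta F) (sym a), sym_mul_sym h, mul_zero, mul_zero]
  · change (1 + form (-1)) * (form a - 1) = 0
    have h1 : (eta F * sym (-1) + 2) * eta F = 0 := by
      rw [← eta_hyp (F := F), add_mul, mul_add, mul_assoc, ← eta_comm, two_mul, mul_two]
    rw [form_sub_one, ← mul_assoc, form, ← add_assoc, one_add_one_eq_two, add_comm, h1, zero_mul]

theorem isFormInvariant_form₀ : IsFormInvariant (form₀ : Fˣ → piece F 0) where
  mul_sq a b := Subtype.ext (isFormInvariant_form.mul_sq a b)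
  add_eq a b c h := Subtype.ext (isFormInvariant_form.add_eq a b c h)
  add_neg a := Subtype.ext (isFormInvariant_form.add_neg a)

variable (F) in
/-- The homomorphism `ℤ[Fˣ] → K^MW_*(F)`. -/
def formRingHom : MonoidAlgebra ℤ Fˣ →ₐ[ℤ] KMW F := MonoidAlgebra.lift ℤ (KMW F) Fˣ (formHom F)

theorem formRingHom_single (a : Fˣ) : formRingHom F (MonoidAlgebra.single a 1) = form a :=
  MonoidAlgebra.lift_of (formHom F) a

theorem word_cons (g : KMWGen F) (w : List (KMWGen F)) :
    word (g :: w) = mk F (FreeAlgebra.ι ℤ g) * word w := by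
  rw [word, List.map_cons, List.prod_cons]
  rfl

/-- Since η commutes with the symbols, all its occurrences can be moved to the left. -/
theorem exists_word_eq (w : List (KMWGen F)) : ∃ (n : ℕ) (l : List Fˣ),
    word w = eta F ^ n * (l.map sym).prod ∧ wordDeg w = l.length - n := by
  induction w with
  | nil => exact ⟨0, [], by simp [word], by simp [wordDeg]⟩
  | cons g w ih =>
    obtain ⟨n, l, h, hdeg⟩ := ih
    have hd : wordDeg (g :: w) = g.deg + wordDeg w := by
      rw [wordDeg, List.map_cons, List.sum_cons]
      rfl
    rw [word_cons, hd, h, hdeg]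
    cases g with
    | sym a =>
      refine ⟨n, a :: l, ?_, ?_⟩
      · rw [List.map_cons, List.prod_cons, ← mul_assoc, ← mul_assoc]
        congr 1
        exact (Commute.pow_left (eta_comm a) n).eq.symm
      · rw [List.length_cons, KMWGen.deg]
        push_cast
        ring
    | eta =>
      refine ⟨n + 1, l, ?_, ?_⟩
      · rw [pow_succ', mul_assoc]
        rfl
      · rw [KMWGen.deg]
        push_cast
        ring

/-- Each symbol absorbs one η, and η[a] = ⟨a⟩ - 1. Words of degree zero are thus polynomials in the
⟨a⟩. -/
theorem eta_pow_mul_mem_range (l : List Fˣ) :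
    eta F ^ l.length * (l.map sym).prod ∈ (formRingHom F).range := by
  induction l with
  | nil =>
    rw [List.length_nil, pow_zero, List.map_nil, List.prod_nil, one_mul]
    exact one_mem _
  | cons a l ih =>
    have h : eta F ^ (a :: l).length * ((a :: l).map sym).prod =
        (form a - 1) * (eta F ^ l.length * (l.map sym).prod) := by
      rw [form_sub_one, List.map_cons, List.prod_cons, List.length_cons, pow_succ', mul_assoc,
        mul_assoc, ← mul_assoc (sym a), ← mul_assoc (eta F ^ l.length)]
      congr 2
      exact (Commute.pow_left (eta_comm a) l.length).eq
    rw [h]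
    exact mul_mem (sub_mem ⟨_, formRingHom_single a⟩ (one_mem _)) ih

theorem mem_range_of_mem_piece {x : KMW F} (hx : x ∈ piece F 0) : x ∈ (formRingHom F).range := by
  change x ∈ AddSubgroup.closure {y : KMW F | ∃ w, wordDeg w = 0 ∧ word w = y} at hx
  induction hx using AddSubgroup.closure_induction with
  | mem x hx =>
    obtain ⟨w, hw, rfl⟩ := hx
    obtain ⟨n, l, h, hdeg⟩ := exists_word_eq w
    rw [hw] at hdeg
    obtain rfl : n = l.length := by lia
    rw [h]
    exact eta_pow_mul_mem_range l
  | zero => exact zero_mem _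
  | add x y _ _ hx hy => exact add_mem hx hy
  | neg x _ hx => exact neg_mem hx

variable (F) in
/-- The additive homomorphism `ℤ[Fˣ] → K^MW_0(F)`. -/
def formSum : MonoidAlgebra ℤ Fˣ →+ piece F 0 := MonoidAlgebra.sumHom form₀

theorem formSum_single (a : Fˣ) : formSum F (MonoidAlgebra.single a 1) = form₀ a :=
  (MonoidAlgebra.sumHom_single form₀ a 1).trans (one_smul ℤ _)

theorem coe_formSum (r : MonoidAlgebra ℤ Fˣ) : (formSum F r : KMW F) = formRingHom F r := by
  refine DFunLike.congr_fun (f := (piece F 0).subtype.toAddMonoidHom.comp (formSum F))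
    (g := (formRingHom F : MonoidAlgebra ℤ Fˣ →+ KMW F))
    (MonoidAlgebra.int_addHom_ext fun a => ?_) r
  exact (congrArg Subtype.val (formSum_single a)).trans (formRingHom_single a).symm

theorem formSum_surjective : Function.Surjective (formSum F) := fun x => by
  obtain ⟨r, hr⟩ := mem_range_of_mem_piece x.2
  exact ⟨r, Subtype.ext ((coe_formSum r).trans hr)⟩

section Universal

open MonoidAlgebra

variable {A : Type*} [AddCommGroup A] {f : Fˣ → A} (hf : IsFormInvariant f)

/-- The augmentation `ℤ[Fˣ] → ℤ`. -/
def augmentation (F : Type u) [Field F] : MonoidAlgebra ℤ Fˣ →ₐ[ℤ] ℤ := MonoidAlgebra.lift ℤ ℤ Fˣ 1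

theorem augmentation_single (a : Fˣ) : augmentation F (single a 1) = 1 :=
  MonoidAlgebra.lift_of _ a

/-- The largest ideal of augmentation zero in the kernel of the additive extension of `f`. -/
def kernelIdeal (f : Fˣ → A) : Ideal (MonoidAlgebra ℤ Fˣ) where
  carrier := {r | augmentation F r = 0 ∧ ∀ s, sumHom f (s * r) = 0}
  add_mem' hr hr' := ⟨by rw [map_add, hr.1, hr'.1, add_zero],
    fun s => by rw [mul_add, map_add, hr.2, hr'.2, add_zero]⟩
  zero_mem' := ⟨map_zero _, fun s => by rw [mul_zero, map_zero]⟩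
  smul_mem' t r hr := ⟨by rw [smul_eq_mul, map_mul, hr.1, mul_zero],
    fun s => by rw [smul_eq_mul, ← mul_assoc, hr.2]⟩

theorem mem_kernelIdeal {r : MonoidAlgebra ℤ Fˣ} (h : augmentation F r = 0)
    (h' : ∀ a, sumHom f (single a 1 * r) = 0) : r ∈ kernelIdeal f := by
  refine ⟨h, fun s => ?_⟩
  exact DFunLike.congr_fun (f := (sumHom f).comp (AddMonoidHom.mulRight r)) (g := 0)
    (MonoidAlgebra.int_addHom_ext h') s

theorem sumHom_single_mul_single (f : Fˣ → A) (a b : Fˣ) :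
    sumHom f (single a 1 * single b 1) = f (a * b) := by
  rw [single_mul_single, sumHom_single, mul_one, one_smul]

include hf in
theorem steinberg_mem {a b : Fˣ} (h : (a : F) + b = 1) :
    (single a 1 - 1) * (single b 1 - 1) ∈ kernelIdeal f := by
  have h1 : ((single a 1 - 1) * (single b 1 - 1) : MonoidAlgebra ℤ Fˣ) =
      single (a * b) 1 + single 1 1 - single a 1 - single b 1 := by
    rw [sub_mul, mul_sub, mul_sub, single_mul_single, mul_one, mul_one, one_mul, one_mul, one_def]
    abel
  rw [h1]
  refine mem_kernelIdeal ?_ fun c => ?_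
  · rw [map_sub, map_sub, map_add]
    simp only [augmentation_single]
    norm_num
  · rw [mul_sub, mul_sub, mul_add, map_sub, map_sub, map_add]
    simp only [sumHom_single_mul_single, mul_one]
    have h2 := hf.add_eq (c * a) (c * b) c (by push_cast; rw [← mul_add, h, mul_one])
    rw [show c * a * (c * b) * c = c * (a * b) * c ^ 2 from Units.ext (by push_cast; ring),
      hf.mul_sq] at h2
    rw [sub_sub, h2]
    abel

include hf in
theorem hyperbolic_mul_mem (a : Fˣ) :
    (1 + single (-1) 1) * (single a 1 - 1) ∈ kernelIdeal f := by
  have h1 : ((1 + single (-1) 1) * (single a 1 - 1) : MonoidAlgebra ℤ Fˣ) =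
      single a 1 + single (-a) 1 - single 1 1 - single (-1) 1 := by
    rw [add_mul, mul_sub, mul_sub, single_mul_single]
    simp only [mul_one, one_mul, neg_one_mul]
    rw [one_def]
    abel
  rw [h1]
  refine mem_kernelIdeal ?_ fun c => ?_
  · rw [map_sub, map_sub, map_add]
    simp only [augmentation_single]
    norm_num
  · rw [mul_sub, mul_sub, mul_add, map_sub, map_sub, map_add]
    simp only [sumHom_single_mul_single, mul_one, mul_neg]
    rw [hf.add_neg (c * a), ← hf.add_neg c]
    abel

-- Modulo the kernel ideal every ⟨a⟩ fixes the hyperbolic element 1 + ⟨-1⟩, so group ring elements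
-- act on it through their augmentation.
include hf in
theorem mul_hyperbolic_sub_mem (s : MonoidAlgebra ℤ Fˣ) :
    s * (1 + single (-1) 1) - augmentation F s • (1 + single (-1) 1) ∈ kernelIdeal f := by
  induction s using MonoidAlgebra.induction_on with
  | of a =>
    rw [of_apply, augmentation_single, one_smul, mul_comm]
    convert hyperbolic_mul_mem hf a using 1
    rw [mul_sub, mul_one]
  | add s t hs ht =>
    rw [add_mul, map_add, add_smul, add_sub_add_comm]
    exact add_mem hs ht
  | smul n s hs =>
    rw [map_smul, smul_mul_assoc, smul_eq_mul, mul_smul, ← smul_sub]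
    exact zsmul_mem hs n

-- The assignment η ↦ 1, [a] ↦ ⟨a⟩ - 1 respects the relations only after 1 + ⟨-1⟩ is killed, so it
-- shows merely that r = x + s (1 + ⟨-1⟩) with x in the kernel ideal. The rank homomorphism, with η
-- and all [a] sent to 0, gives augmentation zero for r, hence 2 ε(s) = 0 for the augmentation ε. So
-- ε(s) = 0 and s (1 + ⟨-1⟩) lies in the kernel ideal too.
include hf in
theorem sumHom_eq_zero_of_formRingHom_eq_zero {r : MonoidAlgebra ℤ Fˣ}
    (hr : formRingHom F r = 0) : sumHom f r = 0 := by
  let J : Ideal (MonoidAlgebra ℤ Fˣ) := kernelIdeal f ⊔ Ideal.span {1 + single (-1) 1}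
  let φ : KMW F →+* MonoidAlgebra ℤ Fˣ ⧸ J := lift (fun a => Ideal.Quotient.mk J (single a 1 - 1)) 1
    (fun a b h => by
      rw [← map_mul]
      exact Ideal.Quotient.eq_zero_iff_mem.2 (Ideal.mem_sup_left (steinberg_mem hf h)))
    (fun a b => by
      rw [one_mul, ← map_mul, ← map_add, ← map_add]
      congr 1
      rw [← one_mul (1 : ℤ), ← single_mul_single, one_mul]
      ring)
    (fun a => by rw [one_mul, mul_one])
    (by
      rw [one_mul, one_mul, ← map_ofNat (Ideal.Quotient.mk J), ← map_add]
      refine Ideal.Quotient.eq_zero_iff_mem.2 (Ideal.mem_sup_right ?_)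
      rw [show (single (-1) 1 - 1 + 2 : MonoidAlgebra ℤ Fˣ) = 1 + single (-1) 1 by ring]
      exact Ideal.mem_span_singleton_self _)
  let ρ : KMW F →+* ℤ := lift (fun _ => 0) 0 (by simp) (by simp) (by simp) (by simp)
  have hφ : φ (formRingHom F r) = Ideal.Quotient.mk J r := by
    refine DFunLike.congr_fun (f := (φ : KMW F →+ _).comp (formRingHom F : MonoidAlgebra ℤ Fˣ →+ _))
      (g := (Ideal.Quotient.mk J).toAddMonoidHom) (MonoidAlgebra.int_addHom_ext fun a => ?_) r
    change φ (formRingHom F (single a 1)) = Ideal.Quotient.mk J (single a 1)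
    rw [formRingHom_single, lift_form, one_mul, ← map_one (Ideal.Quotient.mk J), ← map_add,
      add_sub_cancel]
  have hρ : ρ (formRingHom F r) = augmentation F r := by
    refine DFunLike.congr_fun (f := (ρ : KMW F →+ _).comp (formRingHom F : MonoidAlgebra ℤ Fˣ →+ _))
      (g := (augmentation F : MonoidAlgebra ℤ Fˣ →+ ℤ)) (MonoidAlgebra.int_addHom_ext fun a => ?_) r
    change ρ (formRingHom F (single a 1)) = augmentation F (single a 1)
    rw [formRingHom_single, lift_form, augmentation_single, zero_mul, add_zero]
  rw [hr, map_zero] at hφ hρ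
  obtain ⟨x, hx, y, hy, rfl⟩ := Submodule.mem_sup.1 (Ideal.Quotient.eq_zero_iff_mem.1 hφ.symm)
  obtain ⟨s, rfl⟩ := Ideal.mem_span_singleton'.1 hy
  have h1 := mul_hyperbolic_sub_mem hf s
  have h2 : augmentation F s = 0 := by
    rw [map_add, hx.1, zero_add, map_mul, map_add, map_one, augmentation_single] at hρ
    lia
  rw [h2, zero_smul, sub_zero] at h1
  have h3 := (add_mem hx h1).2 1
  rwa [one_mul] at h3

/-- The homomorphism `K^MW_0(F) → A`, `⟨a⟩ ↦ f a`, given by an invariant of one-dimensional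
forms. -/
def pieceLift : piece F 0 →+ A :=
  (formSum F).liftOfSurjective formSum_surjective ⟨sumHom f, fun r hr =>
    sumHom_eq_zero_of_formRingHom_eq_zero hf ((coe_formSum r).symm.trans (congrArg Subtype.val hr))⟩

theorem pieceLift_form₀ (a : Fˣ) : pieceLift hf (form₀ a) = f a := by
  have := (formSum F).liftOfRightInverse_comp_apply _
    (Function.rightInverse_surjInv formSum_surjective)
    ⟨sumHom f, fun r hr => sumHom_eq_zero_of_formRingHom_eq_zero hf
      ((coe_formSum r).symm.trans (congrArg Subtype.val hr))⟩ (single a 1)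
  rw [formSum_single] at this
  exact this.trans ((sumHom_single f a 1).trans (one_smul ℤ _))

theorem piece_hom_ext {g g' : piece F 0 →+ A} (h : ∀ a, g (form₀ a) = g' (form₀ a)) : g = g' := by
  have : g.comp (formSum F) = g'.comp (formSum F) :=
    MonoidAlgebra.int_addHom_ext fun a => by
      rw [AddMonoidHom.comp_apply, AddMonoidHom.comp_apply, formSum_single, h]
  ext x
  obtain ⟨r, rfl⟩ := formSum_surjective x
  exact DFunLike.congr_fun this r

end Universal

end KMW

end MilnorWitt

/-! ### Twisting by a graded line -/

section Twisted

open MonoidAlgebra TensorProduct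

namespace GradedLine

variable {F : Type u} [Field F] (L : GradedLine F)

theorem nonempty_nonzero : Nonempty L.nonzero := by
  have : Nontrivial L.line := Module.nontrivial_of_finrank_pos (R := F)
    (by rw [L.finrank_eq_one]; exact one_pos)
  obtain ⟨l, hl⟩ := exists_ne (0 : L.line)
  exact ⟨⟨l, hl⟩⟩

variable {L}

theorem exists_smul_eq (l : L.nonzero) (x : L.line) : ∃ t : F, t • l.1 = x :=
  (finrank_eq_one_iff_of_nonzero' l.1 l.2).1 L.finrank_eq_one x

theorem exists_units_smul_eq (l l' : L.nonzero) : ∃ u : Fˣ, u • l = l' := by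
  obtain ⟨t, ht⟩ := exists_smul_eq l l'.1
  have ht0 : t ≠ 0 := by
    rintro rfl
    exact l'.2 (by rw [← ht, zero_smul])
  exact ⟨Units.mk0 t ht0, Subtype.ext ht⟩

variable (L)

theorem of_smul_single (u : Fˣ) (l : L.nonzero) : of ℤ Fˣ u • L.single l = L.single (u • l) := by
  rw [single, single, ← Representation.asModuleEquiv_symm_map_rho,
    Representation.ofMulAction_single]

theorem freeModule_hom_ext {A : Type*} [AddCommGroup A] {f g : L.freeModule →+ A}
    (h : ∀ l, f (L.single l) = g (L.single l)) : f = g := by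
  let θ : MonoidAlgebra ℤ L.nonzero ≃+ L.freeModule :=
    (Representation.ofMulAction ℤ Fˣ L.nonzero).asModuleEquiv.symm.toAddEquiv
  have : f.comp θ.toAddMonoidHom = g.comp θ.toAddMonoidHom := int_addHom_ext h
  ext x
  obtain ⟨y, rfl⟩ := θ.surjective x
  exact DFunLike.congr_fun this y

/-- The additive homomorphism from `ℤ[L⁰]` given by the images of the basis elements. -/
def freeLift {A : Type*} [AddCommGroup A] (g : L.nonzero → A) : L.freeModule →+ A :=
  (sumHom g).comp
    (Representation.ofMulAction ℤ Fˣ L.nonzero).asModuleEquiv.toAddEquiv.toAddMonoidHom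

theorem freeLift_single {A : Type*} [AddCommGroup A] (g : L.nonzero → A) (l : L.nonzero) :
    L.freeLift g (L.single l) = g l :=
  (congrArg (sumHom g) (LinearEquiv.apply_symm_apply _ _)).trans
    ((sumHom_single g l 1).trans (one_smul ℤ _))

end GradedLine

namespace KMW

variable {F : Type u} [Field F]

theorem of_smul_form₀ (u a : Fˣ) : of ℤ Fˣ u • (form₀ a : piece F 0) = form₀ (u * a) := by
  refine Subtype.ext ?_
  change of ℤ Fˣ u • form a = form (u * a)
  rw [smul_def, lift_of, form_mul]
  rfl

end KMW

namespace TwistedKMW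

variable {F : Type u} [Field F] {L : GradedLine F} {A : Type*} [AddCommGroup A]

/-- The tensor product is over the group ring, so a scalar moves from the line to the form. -/
theorem form_smul (u a : Fˣ) (l : L.nonzero) : form a (u • l) = form (u * a) l := by
  rw [form, form, ← L.of_smul_single, ← KMW.of_smul_form₀, TensorProduct.tmul_smul,
    TensorProduct.smul_tmul']

theorem isFormInvariant_form (l : L.nonzero) : IsFormInvariant fun a => form a l where
  mul_sq a b := congrArg (· ⊗ₜ[MonoidAlgebra ℤ Fˣ] L.single l)
    (KMW.isFormInvariant_form₀.mul_sq a b)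
  add_eq a b c h := by
    simp only [form]
    rw [← TensorProduct.add_tmul, ← TensorProduct.add_tmul,
      KMW.isFormInvariant_form₀.add_eq a b c h]
  add_neg a := by
    simp only [form]
    rw [← TensorProduct.add_tmul, ← TensorProduct.add_tmul, KMW.isFormInvariant_form₀.add_neg a]

theorem hom_ext {f g : TwistedKMW F 0 L →+ A} (h : ∀ a l, f (form a l) = g (form a l)) :
    f = g := by
  have key : ∀ (m : KMW.piece F 0) (n : L.freeModule),
      f (m ⊗ₜ[MonoidAlgebra ℤ Fˣ] n) = g (m ⊗ₜ[MonoidAlgebra ℤ Fˣ] n) := by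
    intro m n
    let T : KMW.piece F 0 →+ L.freeModule →+ TwistedKMW F 0 L :=
      { toFun := fun m => (TensorProduct.mk (MonoidAlgebra ℤ Fˣ) _ _ m).toAddMonoidHom
        map_zero' := by ext; exact TensorProduct.zero_tmul _ _
        map_add' := fun m m' => by ext; exact TensorProduct.add_tmul _ _ _ }
    have h1 : ∀ a, f.comp (T (KMW.form₀ a)) = g.comp (T (KMW.form₀ a)) := fun a =>
      L.freeModule_hom_ext fun l => h a l
    have h2 : f.comp (T.flip n) = g.comp (T.flip n) :=
      KMW.piece_hom_ext fun a => DFunLike.congr_fun (h1 a) n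
    exact DFunLike.congr_fun h2 m
  ext x
  induction x using TensorProduct.induction_on with
  | zero => rw [map_zero, map_zero]
  | tmul m n => exact key m n
  | add x y hx hy => rw [map_add, map_add, hx, hy]

variable (g : Fˣ → L.nonzero → A) (hg : ∀ l, IsFormInvariant fun a => g a l)

/-- The biadditive map given by invariants of one-dimensional forms indexed by `L⁰`. -/
def pairing : KMW.piece F 0 →+ L.freeModule →+ A :=
  (L.freeLift fun l => KMW.pieceLift (hg l)).flip

theorem pairing_form₀ (a : Fˣ) (l : L.nonzero) :
    pairing g hg (KMW.form₀ a) (L.single l) = g a l := by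
  rw [pairing, AddMonoidHom.flip_apply, GradedLine.freeLift_single, KMW.pieceLift_form₀]

variable (hsmul : ∀ u a l, g a (u • l) = g (u * a) l)

-- This balance condition lets the pairing descend to the tensor product over the group ring; it is
-- checked on generators in both variables.
include hsmul in
theorem pairing_smul (r : MonoidAlgebra ℤ Fˣ) (m : KMW.piece F 0) (n : L.freeModule) :
    pairing g hg (r • m) n = pairing g hg m (r • n) := by
  induction r using MonoidAlgebra.induction_on with
  | of u =>
    have h1 : ∀ a, pairing g hg (of ℤ Fˣ u • KMW.form₀ a) = (pairing g hg (KMW.form₀ a)).comp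
        (DistribSMul.toAddMonoidHom L.freeModule (of ℤ Fˣ u)) := fun a =>
      L.freeModule_hom_ext fun l => by
        rw [AddMonoidHom.comp_apply, DistribSMul.toAddMonoidHom_apply, L.of_smul_single,
          KMW.of_smul_form₀, pairing_form₀, pairing_form₀, hsmul]
    have h2 : ((pairing g hg).flip n).comp
        (DistribSMul.toAddMonoidHom (KMW.piece F 0) (of ℤ Fˣ u)) =
        (pairing g hg).flip (of ℤ Fˣ u • n) :=
      KMW.piece_hom_ext fun a => DFunLike.congr_fun (h1 a) n
    exact DFunLike.congr_fun h2 m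
  | add r s hr hs =>
    rw [add_smul, add_smul, map_add, map_add, AddMonoidHom.add_apply, hr, hs]
  | smul k r hr =>
    rw [smul_assoc, smul_assoc, map_zsmul, map_zsmul, AddMonoidHom.zsmul_apply, hr]

/-- The homomorphism `K^MW_0(F, L) → A` given by invariants of one-dimensional forms indexed
by `L⁰`. -/
def lift : TwistedKMW F 0 L →+ A :=
  TensorProduct.liftAddHom (pairing g hg) (pairing_smul g hg hsmul)

theorem lift_form (a : Fˣ) (l : L.nonzero) : lift g hg hsmul (form a l) = g a l :=
  pairing_form₀ g hg a l

end TwistedKMW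

end Twisted

/-! ### The isomorphism between twisted K^MW_0 and the Grothendieck-Witt group -/

section LocalMultiplication

open IsLocalRing Abelian Opposite FormSpace

variable {R : Type u} [CommRing R] [IsLocalRing R] [IsNoetherianRing R] {i : ℕ}
  [HasExtDuality R i] {L : GradedLine (ResidueField R)}
  (c : L.line ≃+ Ext (residueObj R).obj (ModuleCat.of R R) i)
  (hc : ∀ (r : R) (l : L.line), c (residue R r • l) = r • c l)

include hc in
omit [IsNoetherianRing R] [HasExtDuality R i] in
theorem extEval_smul_residue (t : ResidueField R) (l : L.line) (x : ResidueField R) :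
    extEval (residueObj R) (c (t • l)) x =
      extEval (residueObj R) (c l) (t * x : ResidueField R) := by
  obtain ⟨r, rfl⟩ := residue_surjective t
  rw [hc]
  exact (LinearMap.congr_fun (map_smul (extEval (residueObj R)) r (c l)) x).trans
    ((map_smul (extEval (residueObj R) (c l)) r x).symm.trans
      (congrArg (extEval (residueObj R) (c l)) (Algebra.smul_def r x)))

/-- The identification of the residue field with the socle of `ExtLimit R i` given by a nonzero
element of `Ext^i(κ, R)`. -/
def extSocleIso (l : L.nonzero) : SocleIso R (ExtLimit R i) where
  map := extEval (residueObj R) (c l.1)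
  injective := by
    refine (injective_iff_map_eq_zero _).2 fun (x : ResidueField R) hx => ?_
    by_contra hx0
    -- A nonzero element of κ generates κ over R, so a class whose evaluation vanishes there has
    -- zero evaluation everywhere.
    have h0 : c l.1 = 0 := extEval_injective (residueObj R) <|
        LinearMap.ext fun (y : ResidueField R) => by
      obtain ⟨r, hr⟩ := residue_surjective (R := R) (y * x⁻¹ : ResidueField R)
      have : y = r • x := by
        change y = algebraMap R (ResidueField R) r * x
        rw [ResidueField.algebraMap_eq, hr, inv_mul_cancel_right₀ hx0]
      rw [this]
      exact (map_smul (extEval (residueObj R) (c l.1)) r x).trans ((congrArg (r • ·) hx).trans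
        ((smul_zero r).trans (extEval_zero (residueObj R) (r • x : ResidueField R)).symm))
    exact l.2 ((map_eq_zero_iff c c.injective).1 h0)
  exists_of_smul_eq_zero e he := by
    let ψ : ResidueField R →ₗ[R] ExtLimit R i :=
      Submodule.liftQ (maximalIdeal R) (LinearMap.toSpanSingleton R _ e) he
    obtain ⟨y, hy⟩ := extEval_surjective (residueObj R) ψ
    obtain ⟨x, rfl⟩ := c.surjective y
    obtain ⟨t, rfl⟩ := GradedLine.exists_smul_eq l x
    refine ⟨t, ?_⟩
    have h1 : ψ 1 = e := one_smul R e
    rw [← h1, ← hy]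
    exact ((extEval_smul_residue c hc t l.1 1).trans
      (congrArg (extEval (residueObj R) (c l.1)) (mul_one t))).symm

/-- Replacing l by u l rescales the identification of κ with the socle by u, which amounts to
rescaling the form. -/
theorem extSocleIso_smul_isom (u a : (ResidueField R)ˣ) (l : L.nonzero) :
    (line (extSocleIso c hc (u • l)) a).Isom (line (extSocleIso c hc l) (u * a)) :=
  ⟨LinearEquiv.refl R (ResidueField R), fun (x y : ResidueField R) => by
    refine Eq.trans ?_ (extEval_smul_residue c hc u l.1 (a * x * y)).symm
    change extEval (residueObj R) (c l.1) ((u * a : (ResidueField R)ˣ) * x * y : ResidueField R) = _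
    rw [Units.val_mul, mul_assoc, mul_assoc, mul_assoc]⟩

variable {𝒟 : ExactDuality (extDual R i)} (h𝒟 : 𝒟.IsCanonical)

/-- The class of the space `(κ, φ)` with `φ(1) = c(a l)`. -/
def lineClass (a : (ResidueField R)ˣ) (l : L.nonzero) : GW 𝒟 :=
  GW.of (h𝒟.ofForm (line (extSocleIso c hc l) a))

theorem isFormInvariant_lineClass (l : L.nonzero) :
    IsFormInvariant fun a => lineClass c hc h𝒟 a l :=
  h𝒟.isGWInvariant_of_ofForm.isFormInvariant (extSocleIso c hc l)

theorem lineClass_smul (u a : (ResidueField R)ˣ) (l : L.nonzero) :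
    lineClass c hc h𝒟 a (u • l) = lineClass c hc h𝒟 (u * a) l :=
  h𝒟.isGWInvariant_of_ofForm.isom (extSocleIso_smul_isom c hc u a l)

theorem exists_lineClass_eq (a : (ResidueField R)ˣ) (l : L.nonzero) :
    ∃ (φ : residueObj R ≅ (extDual R i).obj (op (residueObj R)))
      (hφ : 𝒟.η.hom.app (residueObj R) ≫ (extDual R i).map φ.hom.op = φ.hom),
      (φ.hom.hom.hom (1 : ResidueField R) : Ext (residueObj R).obj (ModuleCat.of R R) i) =
        c ((a : ResidueField R) • l.1) ∧
      lineClass c hc h𝒟 a l = GW.of { X := residueObj R, φ := φ, symm := hφ } := by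
  refine ⟨(h𝒟.ofForm (line (extSocleIso c hc l) a)).φ,
    (h𝒟.ofForm (line (extSocleIso c hc l) a)).symm, ?_, rfl⟩
  refine extEval_injective (residueObj R) (LinearMap.ext fun (y : ResidueField R) => ?_)
  refine (h𝒟.toForm_ofForm (line (extSocleIso c hc l) a) (1 : ResidueField R) y).trans ?_
  refine Eq.trans ?_ (extEval_smul_residue c hc a l.1 y).symm
  change extEval (residueObj R) (c l.1) ((a : ResidueField R) * 1 * y : ResidueField R) = _
  rw [mul_one]

omit [IsNoetherianRing R] [HasExtDuality R i] in
theorem residueObj_hom_ext {M : FinLen R} {φ ψ : residueObj R ⟶ M}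
    (h : φ.hom.hom (1 : ResidueField R) = ψ.hom.hom (1 : ResidueField R)) : φ = ψ := by
  ext (x : ResidueField R)
  obtain ⟨r, rfl⟩ := residue_surjective x
  rw [residue_eq_smul_one]
  exact (map_smul φ.hom.hom r (1 : ResidueField R)).trans
    ((congrArg (r • ·) h).trans (map_smul ψ.hom.hom r (1 : ResidueField R)).symm)

/-- The homomorphism `K^MW_0(κ, L) → GW^fl(R)`, `⟨a⟩ ⊗ l ↦ [κ, φ]` with `φ(1) = c(a l)`. -/
def twistedToGW : TwistedKMW (ResidueField R) 0 L →+ GW 𝒟 :=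
  TwistedKMW.lift (lineClass c hc h𝒟) (isFormInvariant_lineClass c hc h𝒟)
    (lineClass_smul c hc h𝒟)

theorem twistedToGW_form (a : (ResidueField R)ˣ) (l : L.nonzero) :
    twistedToGW c hc h𝒟 (TwistedKMW.form a l) = lineClass c hc h𝒟 a l :=
  TwistedKMW.lift_form _ _ _ a l

/-- The homomorphism `GW^fl(R) → K^MW_0(κ, L)` given by diagonalization. -/
def gwToTwisted (l : L.nonzero) : GW 𝒟 →+ TwistedKMW (ResidueField R) 0 L :=
  h𝒟.gwLift ((TwistedKMW.isFormInvariant_form l).isGWInvariant (extSocleIso c hc l))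

theorem gwToTwisted_lineClass (a : (ResidueField R)ˣ) (l : L.nonzero) :
    gwToTwisted c hc h𝒟 l (lineClass c hc h𝒟 a l) = TwistedKMW.form a l := by
  have hf := TwistedKMW.isFormInvariant_form l
  rw [gwToTwisted, lineClass, h𝒟.gwLift_of,
    (hf.isGWInvariant (extSocleIso c hc l)).isom (h𝒟.toForm_ofForm_isom _), hf.diagInvariant_line]

/-- Every nonzero vector of the line is u l for some unit u, and ⟨a⟩ ⊗ u l = ⟨ua⟩ ⊗ l, so only the
fixed l has to be considered. -/
theorem gwToTwisted_comp_twistedToGW (l : L.nonzero) :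
    (gwToTwisted c hc h𝒟 l).comp (twistedToGW c hc h𝒟) =
      AddMonoidHom.id (TwistedKMW (ResidueField R) 0 L) :=
  TwistedKMW.hom_ext (A := TwistedKMW (ResidueField R) 0 L) fun a l' => by
    obtain ⟨u, rfl⟩ := GradedLine.exists_units_smul_eq l l'
    rw [TwistedKMW.form_smul]
    exact (congrArg (gwToTwisted c hc h𝒟 l) (twistedToGW_form c hc h𝒟 (u * a) l)).trans
      (gwToTwisted_lineClass c hc h𝒟 (u * a) l)

/-- The image of a space is computed from a Witt equivalent diagonal form of the same length, and
such a form has the same class in the Grothendieck-Witt group. -/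
theorem twistedToGW_comp_gwToTwisted (l : L.nonzero) :
    (twistedToGW c hc h𝒟).comp (gwToTwisted c hc h𝒟 l) = AddMonoidHom.id (GW 𝒟) :=
  GW.hom_ext fun S => by
    obtain ⟨s, hs, hlen⟩ := exists_wittEquiv_diag (extSocleIso c hc l) (h𝒟.toForm S)
    rw [AddMonoidHom.comp_apply, gwToTwisted, h𝒟.gwLift_of,
      (TwistedKMW.isFormInvariant_form l).diagInvariant_eq _ hs hlen, map_list_sum, List.map_map,
      AddMonoidHom.id_apply, ← h𝒟.of_ofForm_toForm S]
    refine Eq.trans ?_ (h𝒟.isGWInvariant_of_ofForm.eq_of_wittEquiv hs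
      (hlen.trans (diag_length _ s).symm)).symm
    rw [h𝒟.isGWInvariant_of_ofForm.diag_eq]
    exact congrArg List.sum (List.map_congr_left fun a _ => twistedToGW_form c hc h𝒟 a l)

/-- The isomorphism `K^MW_0(κ, L) ≅ GW^fl(R)`. -/
def twistedEquivGW (l : L.nonzero) : TwistedKMW (ResidueField R) 0 L ≃+ GW 𝒟 :=
  AddMonoidHom.toAddEquiv (twistedToGW c hc h𝒟) (gwToTwisted c hc h𝒟 l)
    (gwToTwisted_comp_twistedToGW c hc h𝒟 l) (twistedToGW_comp_gwToTwisted c hc h𝒟 l)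

theorem existsUnique_isLocalMultIso {𝒟 : ExactDuality (extDual R i)} (h𝒟 : 𝒟.IsCanonical)
    (c : (conormalTwist R).line ≃+ Ext (residueObj R).obj (ModuleCat.of R R) i)
    (hc : ∀ (r : R) (l : (conormalTwist R).line), c (residue R r • l) = r • c l) :
    ∃! e : TwistedKMW (ResidueField R) 0 (conormalTwist R) ≃+ GW 𝒟, IsLocalMultIso 𝒟 c e := by
  obtain ⟨l₀⟩ := (conormalTwist R).nonempty_nonzero
  refine ⟨twistedEquivGW c hc h𝒟 l₀, fun a l => ?_, fun e he => ?_⟩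
  · obtain ⟨φ, hφ, h1, h2⟩ := exists_lineClass_eq c hc h𝒟 a l
    exact ⟨φ, hφ, h1, (twistedToGW_form c hc h𝒟 a l).trans h2⟩
  · refine AddEquiv.toAddMonoidHom_injective (TwistedKMW.hom_ext fun a l => ?_)
    obtain ⟨φ, hφ, h1, h2⟩ := exists_lineClass_eq c hc h𝒟 a l
    obtain ⟨ψ, hψ, h3, h4⟩ := he a l
    -- A map out of κ is determined by the image of 1, so the prescribed space is unique and e is
    -- determined on the generators ⟨a⟩ ⊗ l.
    obtain rfl : φ = ψ := Iso.ext (residueObj_hom_ext (h1.trans h3.symm))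
    exact h4.trans (h2.symm.trans (twistedToGW_form c hc h𝒟 a l).symm)

end LocalMultiplication

end

open AlgebraicGeometry IsLocalRing in
theorem mainTheorem5 {k : Type u} [Field k] [PerfectField k] {X : Scheme.{u}}
    [IsLocallyNoetherian X] (f : X ⟶ Spec (CommRingCat.of k)) (hf : IsEssentiallySmooth f)
    (i : ℕ) (x : X) (hx : Order.coheight x = i) :
    ∃ hd : Module.finrank (ResidueField (X.presheaf.stalk x))
        (CotangentSpace (X.presheaf.stalk x)) = i,
      (∃! 𝒟 : ExactDuality (extDual (X.presheaf.stalk x) i), 𝒟.IsCanonical) ∧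
      (∃! c : (conormalTwist (X.presheaf.stalk x)).line ≃+
          Abelian.Ext (residueObj (X.presheaf.stalk x)).obj
            (ModuleCat.of (X.presheaf.stalk x) (X.presheaf.stalk x)) i,
        IsKoszulIso hd c) ∧
      ∀ (𝒟 : ExactDuality (extDual (X.presheaf.stalk x) i)), 𝒟.IsCanonical →
      ∀ c : (conormalTwist (X.presheaf.stalk x)).line ≃+
          Abelian.Ext (residueObj (X.presheaf.stalk x)).obj
            (ModuleCat.of (X.presheaf.stalk x) (X.presheaf.stalk x)) i,
        IsKoszulIso hd c →
        ∃! e : TwistedKMW (ResidueField (X.presheaf.stalk x)) 0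
            (conormalTwist (X.presheaf.stalk x)) ≃+ GW 𝒟,
          IsLocalMultIso 𝒟 c e := by
  have := hf.isRegularLocalRing_stalk x
  have hdim : ringKrullDim (X.presheaf.stalk x) = i := by
    rw [ringKrullDim_stalk_eq_coheight, hx]
    rfl
  have hd : Module.finrank (ResidueField (X.presheaf.stalk x))
      (CotangentSpace (X.presheaf.stalk x)) = i := by
    have := (IsRegularLocalRing.iff_finrank_cotangentSpace (X.presheaf.stalk x)).1 inferInstance
    rw [hdim] at this
    exact_mod_cast this
  have := HasExtDuality.of_finrank_eq hdim hd
  exact ⟨hd, existsUnique_isCanonical, existsUnique_isKoszulIso hdim hd, fun 𝒟 h𝒟 c hc =>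
    existsUnique_isLocalMultIso h𝒟 c hc.1⟩
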